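/- **Setting.** Processes are qCCS process terms (value-passing CCS with real-valued classical variables and countably many qubit variables $qVar$), $$t ::= \mathbf{nil}\mid A(\tilde e;\tilde q)\mid \tau.t\mid c?x.t\mid c!e.t\mid \mathsf c?q.t\mid \mathsf c!q.t\mid \mathcal E[\tilde q].t\mid M[\tilde q;x].t\mid t+t\mid t\|t\mid t\backslash L\mid t[f]\mid \mathbf{if}\ b\ \mathbf{then}\ t,$$ up to $\alpha$-equivalence, subject to: $q\notin qv(t)$ in $\mathsf c!q.t$; $qv(t)\cap qv(u)=\emptyset$ in $t\|u$; tuples $\tilde q$ have no repetition; $\mathcal E$ is a trace-preserving super-operator on the qubits $\tilde q$; $M$ is a non-degenerate Hermitian operator on $\tilde q$; process constants have defining equations $A(\tilde x;\tilde q):=t$ with $fv(t)\subseteq\tilde x$ and $qv(t)\subseteq\tilde q$. Here $fv$ and $qv$ denote the sets of free classical and quantum variables. Let $\mathcal H$ be the state space of all qubits in $qVar$, and for $V\subseteq qVar$ let $\overline V$ be its complement and $\mathcal H_V$ the state space of the qubits in $V$. $CP(\mathcal H)$ and $CP_t(\mathcal H)$ are the sets of completely positive, and of completely positive trace-preserving,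 maps on the trace class operators of $\mathcal H$; products are compositions; a $\mathcal G\in CP_t(\mathcal H_V)$ is identified with $\mathcal G\otimes\mathcal I_{\mathcal H_{\overline V}}\in CP_t(\mathcal H)$. Write $\mathcal E\eqsim_V\mathcal F$ if $\mathrm{tr}_{\overline V}\,\mathcal E(\rho)=\mathrm{tr}_{\overline V}\,\mathcal F(\rho)$ for all density operators $\rho$, and $\eqsim$ for $\eqsim_\emptyset$ (equality of traces). A *snapshot* is a pair $(\!|t,\mathcal E|\!)$ of a term and an $\mathcal E\in CP_t(\mathcal H)$. A *distribution* $\Delta$ is a finitely supported function from snapshots to $CP(\mathcal H)$, and $(\mathcal E\bullet\Delta)(s)=\Delta(s)\mathcal E$. Symbolic transitions $(\!|t,\mathcal E|\!)\xrightarrow{b,\gamma}\Delta$, where $b$ is a Boolean expression (the guard) and $\gamma\in\{\tau,\ c?x,\ c!e,\ \mathsf c?r,\ \mathsf c!r\}$, are generated by the usual rules of symbolic value-passing CCS (an input $c?x$ or $\mathsf c?r$ of a prefix uses any variable not free in that prefix term; in $t\|u$ a variable bound by an action of one component must not be free in the other component) together with $$(\!|\mathcal F[\tilde r].t,\mathcal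 E|\!)\xrightarrow{\mathrm{tt},\tau}\mathcal I\bullet(\!|t,\mathcal F_{\tilde r}\mathcal E|\!),\qquad (\!|M[\tilde r;x].t,\mathcal E|\!)\xrightarrow{\mathrm{tt},\tau}\sum_i \mathcal A_i\bullet(\!|t\{\lambda_i/x\},\mathcal S_i\mathcal E|\!)$$ for $M=\sum_i\lambda_i|\phi_i\rangle\langle\phi_i|$, where $\mathcal A_i(\rho)=|\phi_i\rangle_{\tilde r}\langle\phi_i|\rho|\phi_i\rangle_{\tilde r}\langle\phi_i|$ and $\mathcal S_i(\rho)=\sum_j|\phi_i\rangle_{\tilde r}\langle\phi_j|\rho|\phi_j\rangle_{\tilde r}\langle\phi_i|$. All other prefixes leave $\mathcal E$ unchanged and have guard $\mathrm{tt}$ and weight $\mathcal I$. An equivalence relation $S$ on snapshots is lifted to distributions by: $\Delta\,S\,\Xi$ iff $\sum_{s\in T}\Delta(s)\eqsim\sum_{s\in T}\Xi(s)$ for every equivalence class $T$ of $S$. Write $\gamma=_b\gamma'$ if $\gamma=c!e$, $\gamma'=c!e'$ and $b\to(e=e')$ is valid, or if $\gamma=\gamma'$. Let $(S^b)_b$ be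 a family of equivalence relations on snapshots indexed by the Boolean expressions. Say that $(\!|t,\mathcal E|\!)$, $(\!|u,\mathcal F|\!)$ have the *transfer property* at $b$ if, whenever $(\!|t,\mathcal E|\!)\xrightarrow{b_1,\gamma}\Delta$ and the variable bound by $\gamma$ (if any) is not free in $b,t,u$, there is a finite set $B$ of Boolean expressions such that $b\wedge b_1\to\bigvee B$ is valid and for every $b'\in B$ there are $b_2,\gamma',\Xi$ with $b'\to b_2$ valid, $\gamma=_{b'}\gamma'$, $(\!|u,\mathcal F|\!)\xrightarrow{b_2,\gamma'}\Xi$ and $(\mathcal E\bullet\Delta)\,S^{b'}\,(\mathcal F\bullet\Xi)$. - $(S^b)_b$ is a *symbolic bisimulation* if for all $b$ and all $(\!|t,\mathcal E|\!)\,S^b\,(\!|u,\mathcal F|\!)$: (1) if $b$ is satisfiable, then $qv(t)=qv(u)$ and $\mathcal E\eqsim_{\overline{qv(t)}}\mathcal F$; (2) for every $\mathcal G\in CP_t(\mathcal H_{\overline{qv(t)}})$, the snapshots $(\!|t,\mathcal G\mathcal E|\!)$, $(\!|u,\mathcal G\mathcal F|\!)$ have the transfer property at $b$. - It is a *symbolic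 ground bisimulation* if for all $b$ and all $(\!|t,\mathcal E|\!)\,S^b\,(\!|u,\mathcal F|\!)$: (1) $qv(t)=qv(u)$ and $\mathcal E\eqsim_{\overline{qv(t)}}\mathcal F$; (2) $(\!|t,\mathcal E|\!)$, $(\!|u,\mathcal F|\!)$ have the transfer property at $b$. Write $\sim^b$ (respectively $\sim^b_g$) for the relation that holds of two snapshots if some symbolic bisimulation (respectively symbolic ground bisimulation) relates them by its member $S^b$. A term is *free of quantum input* if neither it nor any of its descendants (the terms reached by transitions with satisfiable guards) has a transition with a satisfiable guard and an action $\mathsf c?r$. **Theorem.** Let $t$ and $u$ be process terms that are free of quantum input, $\mathcal E,\mathcal F\in CP_t(\mathcal H)$ and $b$ a Boolean expression. 1. If $b$ is satisfiable, then $(\!|t,\mathcal E|\!)\sim^b(\!|u,\mathcal F|\!)$ if and only if $(\!|t,\mathcal E|\!)\sim^b_g(\!|u,\mathcal F|\!)$. 2. If $(\!|t,\mathcal E|\!)\sim^b_g(\!|u,\mathcal F|\!)$, then $(\!|t,\mathcal G\mathcal E|\!)\sim^b_g(\!|u,\mathcal G\mathcal F|\!)$ for every $\mathcal G\in CP_t(\mathcal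 H_{\overline{qv(t)}})$. -/

import Mathlib

open scoped ComplexOrder

noncomputable section

namespace QCCS

section TraceClass

variable {E F : Type} [NormedAddCommGroup E] [InnerProductSpace ℂ E] [CompleteSpace E]
  [NormedAddCommGroup F] [InnerProductSpace ℂ F] [CompleteSpace F]

/-- `A` is trace class: it is nuclear, i.e. a sum `∑ |x n⟩⟨y n|` with `∑ ‖x n‖ ‖y n‖ < ∞`. -/
def IsTraceClass (A : E →L[ℂ] E) : Prop :=
  ∃ x y : ℕ → E, Summable (fun n => ‖x n‖ * ‖y n‖) ∧
    HasSum (fun n => InnerProductSpace.rankOne ℂ (x n) (y n)) A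

theorem hasSum_interleave {G : Type} [AddCommMonoid G] [TopologicalSpace G] [ContinuousAdd G]
    {f g h : ℕ → G} {a b : G} (hf : HasSum f a) (hg : HasSum g b)
    (hl : ∀ n m, Equiv.natSumNatEquivNat.symm n = Sum.inl m → h n = f m)
    (hr : ∀ n m, Equiv.natSumNatEquivNat.symm n = Sum.inr m → h n = g m) :
    HasSum h (a + b) := by
  have h1 : HasSum (Sum.elim f g) (a + b) := HasSum.sum (f := Sum.elim f g)
    (by simpa [Function.comp_def] using hf) (by simpa [Function.comp_def] using hg)
  have h2 := (Equiv.hasSum_iff (f := Sum.elim f g) Equiv.natSumNatEquivNat.symm).2 h1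
  refine (funext fun n => ?_ : h = _) ▸ h2
  rcases hn : Equiv.natSumNatEquivNat.symm n with m | m
  · simpa [hn] using hl n m hn
  · simpa [hn] using hr n m hn

theorem IsTraceClass.add {A B : E →L[ℂ] E}
    (hA : IsTraceClass A) (hB : IsTraceClass B) : IsTraceClass (A + B) := by
  obtain ⟨x, y, h1, h2⟩ := hA
  obtain ⟨x', y', h1', h2'⟩ := hB
  refine ⟨fun n => Sum.elim x x' (Equiv.natSumNatEquivNat.symm n),
    fun n => Sum.elim y y' (Equiv.natSumNatEquivNat.symm n),
    (hasSum_interleave h1.hasSum h1'.hasSum ?_ ?_).summable, hasSum_interleave h2 h2' ?_ ?_⟩ <;>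
  · intro n m h
    simp only [h, Sum.elim_inl, Sum.elim_inr]

theorem IsTraceClass.sandwich {A : E →L[ℂ] E} (hA : IsTraceClass A)
    (B : E →L[ℂ] F) (C : F →L[ℂ] E) : IsTraceClass (B ∘L A ∘L C) := by
  obtain ⟨x, y, h1, h2⟩ := hA
  refine ⟨fun n => B (x n), fun n => ContinuousLinearMap.adjoint C (y n), ?_, ?_⟩
  · refine Summable.of_nonneg_of_le (fun n => by positivity) (fun n => ?_)
      (h1.mul_left (‖B‖ * ‖ContinuousLinearMap.adjoint C‖))
    calc _ ≤ (‖B‖ * ‖x n‖) * (‖ContinuousLinearMap.adjoint C‖ * ‖y n‖) := by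
          gcongr <;> exact ContinuousLinearMap.le_opNorm _ _
      _ = _ := by ring
  · have h3 := h2.mapL ((ContinuousLinearMap.compL ℂ F E F B).comp
      ((ContinuousLinearMap.compL ℂ F E E).flip C))
    refine (h3.congr_fun ?_)
    intro n
    ext z
    simp [ContinuousLinearMap.adjoint_inner_left]

theorem isTraceClass_rankOne (x y : E) : IsTraceClass (InnerProductSpace.rankOne ℂ x y) := by
  refine ⟨fun n => if n = 0 then x else 0, fun n => if n = 0 then y else 0, ?_, ?_⟩
  · refine summable_of_ne_finset_zero (s := {0}) fun n hn => ?_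
    simp at hn
    simp [hn]
  · convert hasSum_ite_eq (α := E →L[ℂ] E) 0 (InnerProductSpace.rankOne ℂ x y) using 2 with n
    split <;> simp [*]

variable (E) in
/-- The space of trace class operators on `E`. -/
def TC : Submodule ℂ (E →L[ℂ] E) where
  carrier := {A | IsTraceClass A}
  add_mem' := IsTraceClass.add
  zero_mem' := ⟨0, 0, by simp, by simp⟩
  smul_mem' c A hA := by
    have := hA.sandwich (c • ContinuousLinearMap.id ℂ _) (ContinuousLinearMap.id ℂ _)
    simpa using this

/-- `A ↦ B A C`. -/
def TC.sandwich (B : E →L[ℂ] F) (C : F →L[ℂ] E) : TC E →ₗ[ℂ] TC F where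
  toFun A := ⟨B ∘L A.1 ∘L C, A.2.sandwich B C⟩
  map_add' A A' := by ext1; simp
  map_smul' c A := by ext1; simp

/-- `|x⟩⟨y|`. -/
def TC.rankOne (x y : E) : TC E := ⟨InnerProductSpace.rankOne ℂ x y, isTraceClass_rankOne x y⟩

theorem TC.summable_trace (A : TC E) {ι : Type} (b : HilbertBasis ι ℂ E) :
    Summable fun s => inner ℂ (b s) (A.1 (b s)) := by
  obtain ⟨A, x, y, h1, h2⟩ := A
  have key : ∀ n, Summable (fun s => ‖(inner ℂ (b s) (x n) : ℂ)‖ * ‖(inner ℂ (y n) (b s) : ℂ)‖) ∧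
      ∑' s, ‖(inner ℂ (b s) (x n) : ℂ)‖ * ‖(inner ℂ (y n) (b s) : ℂ)‖ ≤ ‖x n‖ * ‖y n‖ := by
    intro n
    have hx := b.orthonormal.inner_products_summable (x := x n)
    have hy := b.orthonormal.inner_products_summable (x := y n)
    have hx' := b.orthonormal.tsum_inner_products_le (x := x n)
    have hy' := b.orthonormal.tsum_inner_products_le (x := y n)
    simp only [norm_inner_symm (y n)]
    have h := Real.summable_and_inner_le_Lp_mul_Lq_tsum_of_nonneg (p := 2) (q := 2)
      (f := fun s => ‖(inner ℂ (b s) (x n) : ℂ)‖) (g := fun s => ‖(inner ℂ (b s) (y n) : ℂ)‖)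
      ⟨by norm_num, by norm_num, by norm_num⟩ (fun _ => norm_nonneg _) (fun _ => norm_nonneg _)
      (by simpa using hx) (by simpa using hy)
    refine ⟨h.1, h.2.trans ?_⟩
    simp only [Real.rpow_two, ← Real.sqrt_eq_rpow]
    gcongr
    · exact Real.sqrt_le_iff.2 ⟨norm_nonneg _, hx'⟩
    · exact Real.sqrt_le_iff.2 ⟨norm_nonneg _, hy'⟩
  have hs : Summable (fun p : ℕ × ι => (inner ℂ (b p.2) (x p.1) * inner ℂ (y p.1) (b p.2) : ℂ)) := by
    refine Summable.of_norm ?_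
    rw [summable_prod_of_nonneg (fun _ => norm_nonneg _)]
    simp only [norm_mul]
    exact ⟨fun n => (key n).1, h1.of_nonneg_of_le (fun n => tsum_nonneg fun s => by positivity)
      fun n => (key n).2⟩
  have hs' := (hs.prod_symm).prod
  refine hs'.congr fun s => ?_
  have h3 := h2.mapL ((innerSL ℂ (b s)).comp (ContinuousLinearMap.apply ℂ E (b s)))
  refine Eq.trans ?_ h3.tsum_eq
  simp [mul_comm]

/-- The block operator `(A i j)` on the direct sum of `ι` copies of `E` is positive. -/
def BlockPos {ι : Type} [Fintype ι] (A : ι → ι → TC E) : Prop :=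
  ∀ x : ι → E, 0 ≤ ∑ i, ∑ j, inner ℂ (x i) ((A i j).1 (x j))

/-- Complete positivity: every amplification by a finite matrix algebra preserves positivity. -/
def IsCP (Φ : TC E →ₗ[ℂ] TC E) : Prop :=
  ∀ (ι : Type) [Fintype ι] (A : ι → ι → TC E), BlockPos A → BlockPos fun i j => Φ (A i j)

variable (E) in
/-- Super-operators on `E`: completely positive maps on trace class operators. Multiplication is
composition, addition is pointwise. -/
def CP : Subsemiring (Module.End ℂ (TC E)) where
  carrier := {Φ | IsCP Φ}
  mul_mem' hΦ hΨ ι _ A hA := hΦ ι _ (hΨ ι A hA)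
  one_mem' ι _ A hA := hA
  add_mem' {Φ Ψ} hΦ hΨ ι _ A hA x := by
    simpa [inner_add_right, Finset.sum_add_distrib] using add_nonneg (hΦ ι A hA x) (hΨ ι A hA x)
  zero_mem' ι _ A hA x := by simp


/-- If `E` is `G ⊗ K` by means of the embeddings `C s = e s ⊗ · : K → E`, for an orthonormal basis `e`
of the finite-dimensional space `G`, then `CP.lift e C Φ` is `Φ ⊗ id`:
with `A = ∑ |e s⟩⟨e s'| ⊗ A s s'` it sends `A` to `∑ Φ |e s⟩⟨e s'| ⊗ A s s'`. -/
def CP.lift {G K : Type} [NormedAddCommGroup G] [InnerProductSpace ℂ G] [CompleteSpace G]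
    [NormedAddCommGroup K] [InnerProductSpace ℂ K] [CompleteSpace K]
    {σ : Type} [Fintype σ] (e : σ → G) (C : σ → K →L[ℂ] E) (Φ : CP G) : CP E :=
  ⟨∑ u, ∑ u', ∑ s, ∑ s', (inner ℂ (e u) ((Φ.1 (TC.rankOne (e s) (e s'))).1 (e u')) : ℂ) •
    TC.sandwich (C u ∘L (C s).adjoint) (C s' ∘L (C u').adjoint), by
    intro ι _ A hA x
    let y : ι × σ → K := fun k => (C k.2).adjoint (x k.1)
    let B : ι × σ → ι × σ → TC G := fun k l => ∑ s, ∑ s',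
      (inner ℂ (C s (y k)) ((A k.1 l.1).1 (C s' (y l))) : ℂ) • TC.rankOne (e s) (e s')
    have hB : BlockPos B := by
      intro z
      have h := hA fun i => ∑ u, ∑ s, (inner ℂ (e s) (z (i, u)) : ℂ) • C s (y (i, u))
      refine h.trans_eq ?_
      simp only [B, Fintype.sum_prod_type]
      refine Finset.sum_congr rfl fun i _ => ?_
      refine Eq.trans ?_ Finset.sum_comm
      refine Finset.sum_congr rfl fun j _ => ?_
      simp only [map_sum, map_smul, sum_inner, inner_sum, inner_smul_left, inner_smul_right,
        Submodule.coe_sum, Submodule.coe_smul, _root_.sum_apply,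
        _root_.smul_apply, TC.rankOne, InnerProductSpace.rankOne_apply,
        inner_conj_symm]
      simp only [Finset.mul_sum]
      calc _ = ∑ u', ∑ u, ∑ s', ∑ s, _ := Finset.sum_congr rfl fun u' _ => Finset.sum_comm
        _ = ∑ u, ∑ u', ∑ s', ∑ s, _ := Finset.sum_comm
        _ = ∑ u, ∑ u', ∑ s, ∑ s', _ :=
          Finset.sum_congr rfl fun u _ => Finset.sum_congr rfl fun u' _ => Finset.sum_comm
        _ = _ := Finset.sum_congr rfl fun u _ => Finset.sum_congr rfl fun u' _ =>
          Finset.sum_congr rfl fun s _ => Finset.sum_congr rfl fun s' _ => by ring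
    have h := Φ.2 _ B hB fun k => e k.2
    refine h.trans_eq ?_
    simp only [B, Fintype.sum_prod_type, map_sum, map_smul, inner_sum, inner_smul_right,
        Submodule.coe_sum, Submodule.coe_smul, _root_.sum_apply,
        _root_.smul_apply, LinearMap.sum_apply, LinearMap.smul_apply]
    refine Finset.sum_congr rfl fun i _ => ?_
    refine Finset.sum_comm.trans ?_
    refine Finset.sum_congr rfl fun j _ => ?_
    refine Finset.sum_congr rfl fun u _ => Finset.sum_congr rfl fun u' _ => ?_
    refine Finset.sum_congr rfl fun s _ => Finset.sum_congr rfl fun s' _ => ?_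
    rw [mul_comm]
    congr 1
    simp [TC.sandwich, y, ← ContinuousLinearMap.adjoint_inner_right]⟩

/-- `A ↦ K A K†`. -/
def CP.conj (K : E →L[ℂ] E) : CP E :=
  ⟨TC.sandwich K K.adjoint, by
    intro ι _ A hA x
    simpa [TC.sandwich, ContinuousLinearMap.adjoint_inner_left] using hA fun i => K.adjoint (x i)⟩

end TraceClass

/-- The state space of a set `Q` of qubits: the tensor product of the `ℂ²` for the qubits in `Q` (along
the reference vector `|0⟩` when `Q` is infinite). The basis ket indexed by a finite set `s` has the
qubits in `s` in state `|1⟩` and all others in state `|0⟩`. -/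
abbrev Hilb (Q : Type) : Type := lp (fun _ : Finset Q => ℂ) 2

/-- The computational basis. -/
def kets (Q : Type) : HilbertBasis (Finset Q) ℂ (Hilb Q) :=
  HilbertBasis.ofRepr (LinearIsometryEquiv.refl ℂ (Hilb Q))

/-- The trace, computed in the computational basis. -/
def TC.trace {Q : Type} (A : TC (Hilb Q)) : ℂ := ∑' s, inner ℂ (kets Q s) (A.1 (kets Q s))

/-- Trace preserving super-operators on the state space of the qubits in `Q`. -/
def CPt (Q : Type) : Submonoid (CP (Hilb Q)) where
  carrier := {Φ | ∀ A, TC.trace (Φ.1 A) = TC.trace A}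
  mul_mem' {_ Ψ} hΦ hΨ A := (hΦ (Ψ.1 A)).trans (hΨ A)
  one_mem' _ := rfl

/-- A computational basis label for the qubits in the range of `r`, together with one for the remaining
qubits, gives one for all qubits. -/
def merge {P Q : Type} (r : P ↪ Q) (s : Finset P) (w : Finset ↥(Set.range r)ᶜ) : Finset Q :=
  (s.map r).disjUnion (w.map (Function.Embedding.subtype _)) (by
    rw [Finset.disjoint_left]
    intro a ha ha'
    simp only [Finset.mem_map, Function.Embedding.subtype_apply] at ha ha'
    obtain ⟨p, -, rfl⟩ := ha
    obtain ⟨q, -, hq⟩ := ha'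
    exact q.2 ⟨p, hq.symm⟩)

theorem merge_bijective {P Q : Type} (r : P ↪ Q) :
    Function.Bijective fun p : Finset P × Finset ↥(Set.range r)ᶜ => merge r p.1 p.2 := by
  classical
  have hm : ∀ s w p, r p ∈ merge r s w ↔ p ∈ s := by
    intro s w p
    simp [merge]
  have hm' : ∀ s w (q : ↥(Set.range r)ᶜ), q.1 ∈ merge r s w ↔ q ∈ w := by
    rintro s w ⟨q, hq⟩
    have : ∀ p, r p ≠ q := fun p h => hq ⟨p, h⟩
    simp [merge, this]
  constructor
  · rintro ⟨s, w⟩ ⟨s', w'⟩ h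
    simp only at h
    refine Prod.ext (Finset.ext fun p => ?_) (Finset.ext fun q => ?_)
    · exact (hm s w p).symm.trans ((by rw [h]) : _ ↔ _) |>.trans (hm s' w' p)
    · exact (hm' s w q).symm.trans ((by rw [h]) : _ ↔ _) |>.trans (hm' s' w' q)
  · intro v
    refine ⟨(v.preimage r r.injective.injOn,
      v.preimage (Subtype.val) Subtype.val_injective.injOn), Finset.ext fun q => ?_⟩
    by_cases hq : q ∈ Set.range r
    · obtain ⟨p, rfl⟩ := hq
      simp [hm]
    · exact (hm' _ _ ⟨q, hq⟩).trans (by simp)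


/-- The isometry sending the basis ket `s` to the basis ket `f s`. -/
def ketMap {P Q : Type} (f : Finset P → Finset Q) (hf : Function.Injective f) :
    Hilb P →L[ℂ] Hilb Q :=
  ((kets Q).orthonormal.comp f hf).orthogonalFamily.linearIsometry.toContinuousLinearMap

theorem ketMap_kets {P Q : Type} (f : Finset P → Finset Q) (hf : Function.Injective f)
    (s : Finset P) : ketMap f hf (kets P s) = kets Q (f s) := by
  classical
  have h := ((kets Q).orthonormal.comp f hf).orthogonalFamily.linearIsometry_apply_single
    (i := s) (1 : ℂ)
  simp only [LinearIsometry.toSpanSingleton_apply, one_smul, Function.comp] at h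
  rw [← h]
  unfold ketMap kets
  rw [← HilbertBasis.repr_symm_single]
  rfl

/-- `x ↦ x ⊗ |w⟩`, where `x` lives on the qubits `r` and `|w⟩` is a basis ket of the other qubits. -/
def insR {P Q : Type} (r : P ↪ Q) (w : Finset ↥(Set.range r)ᶜ) : Hilb P →L[ℂ] Hilb Q :=
  ketMap (fun s => merge r s w) fun _ _ h =>
    congrArg Prod.fst ((merge_bijective r).1 (a₁ := (_, w)) (a₂ := (_, w)) h)

/-- `y ↦ |s⟩ ⊗ y`, where `|s⟩` is a basis ket of the qubits `r` and `y` lives on the other qubits. -/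
def insL {P Q : Type} (r : P ↪ Q) (s : Finset P) : Hilb ↥(Set.range r)ᶜ →L[ℂ] Hilb Q :=
  ketMap (fun w => merge r s w) fun _ _ h =>
    congrArg Prod.snd ((merge_bijective r).1 (a₁ := (s, _)) (a₂ := (s, _)) h)

theorem insL_kets {P Q : Type} (r : P ↪ Q) (s : Finset P) (w : Finset ↥(Set.range r)ᶜ) :
    insL r s (kets _ w) = kets Q (merge r s w) := ketMap_kets _ _ _

theorem inner_kets {Q : Type} (s t : Finset Q) [Decidable (s = t)] :
    (inner ℂ (kets Q s) (kets Q t) : ℂ) = if s = t then 1 else 0 := by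
  classical
  rw [orthonormal_iff_ite.1 (kets Q).orthonormal]
  congr

theorem insL_adjoint_insL {P Q : Type} (r : P ↪ Q) (s t : Finset P)
    (w : Finset ↥(Set.range r)ᶜ) [Decidable (s = t)] :
    (insL r s).adjoint (insL r t (kets _ w)) = if s = t then kets _ w else 0 := by
  classical
  refine (kets _).repr.injective ?_
  ext v
  rw [HilbertBasis.repr_apply_apply, HilbertBasis.repr_apply_apply,
    ContinuousLinearMap.adjoint_inner_right]
  rw [insL_kets, insL_kets, inner_kets]
  have : merge r s v = merge r t w ↔ s = t ∧ v = w := by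
    have := (merge_bijective r).1.eq_iff (a := (s, v)) (b := (t, w))
    simpa using this
  by_cases h : s = t
  · subst h
    simp only [true_and] at this
    simp [this, inner_kets]
  · simp [this, h]

theorem TC.trace_split {P Q : Type} [Fintype P] (r : P ↪ Q) (A : TC (Hilb Q)) :
    TC.trace A = ∑ s, TC.trace (TC.sandwich (insL r s).adjoint (insL r s) A) := by
  classical
  have h := TC.summable_trace A (kets Q)
  unfold TC.trace
  let e := Equiv.ofBijective _ (merge_bijective r)
  rw [← e.tsum_eq]
  refine (Summable.tsum_prod ((e.summable_iff (f := fun s =>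
    inner ℂ (kets Q s) (A.1 (kets Q s)))).2 h)).trans ?_
  rw [tsum_fintype]
  refine Finset.sum_congr rfl fun s _ => tsum_congr fun w => ?_
  simp [TC.sandwich, ContinuousLinearMap.adjoint_inner_right, e, insL_kets]

/-- `Φ` applied to the qubits `r`: the super-operator `Φ_r ⊗ id` on all qubits in `Q`. -/
def CP.liftAt {P Q : Type} [Fintype P] (r : P ↪ Q) (Φ : CP (Hilb P)) : CP (Hilb Q) :=
  CP.lift (kets P) (insL r) Φ

theorem CP.trace_liftAt {P Q : Type} [Fintype P] (r : P ↪ Q) (Φ : CP (Hilb P)) (A : TC (Hilb Q)) :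
    TC.trace ((CP.liftAt r Φ).1 A) = ∑ s, ∑ s', TC.trace (Φ.1 (TC.rankOne (kets P s) (kets P s'))) *
      TC.trace (TC.sandwich (insL r s).adjoint (insL r s') A) := by
  classical
  have hsum : ∀ s s', Summable fun w => (inner ℂ (kets _ w)
      ((TC.sandwich (insL r s).adjoint (insL r s') A).1 (kets _ w)) : ℂ) :=
    fun s s' => TC.summable_trace _ _
  rw [TC.trace_split r]
  have key : ∀ v, TC.trace (TC.sandwich (insL r v).adjoint (insL r v) ((CP.liftAt r Φ).1 A)) =
      ∑ s, ∑ s', (inner ℂ (kets P v)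
        ((Φ.1 (TC.rankOne (kets P s) (kets P s'))).1 (kets P v)) : ℂ) *
      TC.trace (TC.sandwich (insL r s).adjoint (insL r s') A) := by
    intro v
    unfold TC.trace
    simp only [← tsum_mul_left]
    simp only [← Summable.tsum_finsetSum fun s' _ => (hsum _ s').mul_left _]
    rw [← Summable.tsum_finsetSum fun s _ => summable_sum fun s' _ => (hsum s s').mul_left _]
    refine tsum_congr fun w => ?_
    simp only [liftAt, lift, TC.sandwich, LinearMap.coe_mk, AddHom.coe_mk, LinearMap.sum_apply,
      LinearMap.smul_apply, Submodule.coe_sum, Submodule.coe_smul, ContinuousLinearMap.comp_apply,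
      ContinuousLinearMap.adjoint_inner_right, _root_.sum_apply, _root_.smul_apply, inner_sum,
      inner_smul_right]
    rw [Finset.sum_eq_single v, Finset.sum_eq_single v]
    · simp [← ContinuousLinearMap.adjoint_inner_left, insL_adjoint_insL]
    · intro u _ hu
      simp [insL_adjoint_insL, hu]
    · simp
    · intro u _ hu
      simp [← ContinuousLinearMap.adjoint_inner_left, insL_adjoint_insL, hu]
    · simp
  simp only [key]
  rw [Finset.sum_comm]
  refine Finset.sum_congr rfl fun s _ => ?_
  rw [Finset.sum_comm]
  refine Finset.sum_congr rfl fun s' _ => ?_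
  rw [← Finset.sum_mul, TC.trace.eq_1 (Φ.1 _), tsum_fintype]

theorem TC.trace_rankOne {Q : Type} (x y : Hilb Q) :
    TC.trace (TC.rankOne x y) = inner ℂ y x := by
  rw [← (kets Q).tsum_inner_mul_inner y x]
  refine tsum_congr fun s => ?_
  simp [TC.rankOne]

theorem CP.trace_liftAt_of {P Q : Type} [Fintype P] (r : P ↪ Q) (Φ : CP (Hilb P))
    (h : ∀ A, TC.trace (Φ.1 A) = TC.trace A) (A : TC (Hilb Q)) :
    TC.trace ((CP.liftAt r Φ).1 A) = TC.trace A := by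
  classical
  rw [CP.trace_liftAt, TC.trace_split r A]
  refine Finset.sum_congr rfl fun s _ => ?_
  rw [Finset.sum_eq_single s]
  · simp [h, TC.trace_rankOne, (kets P).orthonormal.1 s]
  · intro s' _ hs
    simp [h, TC.trace_rankOne, inner_kets, hs]
  · simp

/-- `Φ` applied to the qubits `r`, for trace preserving `Φ`. -/
def CPt.liftAt {P Q : Type} [Fintype P] (r : P ↪ Q) (Φ : CPt P) : CPt Q :=
  ⟨CP.liftAt r Φ.1, CP.trace_liftAt_of r Φ.1 Φ.2⟩

theorem TC.trace_eq_sum {Q ι : Type} [Fintype Q] [Fintype ι] (φ : OrthonormalBasis ι ℂ (Hilb Q))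
    (A : TC (Hilb Q)) : TC.trace A = ∑ j, inner ℂ (φ j) (A.1 (φ j)) := by
  classical
  have h : ∀ j, (inner ℂ (φ j) (A.1 (φ j)) : ℂ) =
      ∑ s, inner ℂ (φ j) (kets Q s) * inner ℂ (kets Q s) (A.1 (φ j)) := fun j => by
    rw [← tsum_fintype (L := .unconditional _), (kets Q).tsum_inner_mul_inner]
  rw [TC.trace, tsum_fintype]
  simp only [h]
  rw [Finset.sum_comm]
  refine Finset.sum_congr rfl fun s _ => ?_
  simp only [← ContinuousLinearMap.adjoint_inner_left A.1]
  rw [← φ.sum_inner_mul_inner]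
  exact Finset.sum_congr rfl fun j _ => mul_comm _ _

/-- `ρ ↦ |φ i⟩⟨φ i| ρ |φ i⟩⟨φ i|`. -/
def projAt {n : ℕ} (φ : OrthonormalBasis (Fin (2 ^ n)) ℂ (Hilb (Fin n))) (i : Fin (2 ^ n)) :
    CP (Hilb (Fin n)) :=
  CP.conj (InnerProductSpace.rankOne ℂ (φ i) (φ i))

/-- `ρ ↦ ∑ j, |φ i⟩⟨φ j| ρ |φ j⟩⟨φ i|`. -/
def setTo {n : ℕ} (φ : OrthonormalBasis (Fin (2 ^ n)) ℂ (Hilb (Fin n))) (i : Fin (2 ^ n)) :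
    CPt (Fin n) :=
  ⟨∑ j, CP.conj (InnerProductSpace.rankOne ℂ (φ i) (φ j)), fun A => by
    rw [TC.trace_eq_sum φ, TC.trace_eq_sum φ]
    simp [CP.conj, TC.sandwich, orthonormal_iff_ite.1 φ.orthonormal]⟩

/-- The partial trace over all qubits outside `V`. -/
def ptrace {Q : Type} (V : Set Q) (A : TC (Hilb Q)) : Hilb V →L[ℂ] Hilb V :=
  ∑' w, (insR (Function.Embedding.subtype (· ∈ V)) w).adjoint ∘L A.1 ∘L
    insR (Function.Embedding.subtype (· ∈ V)) w

/-- Density operators. -/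
def IsDensity {Q : Type} (ρ : TC (Hilb Q)) : Prop := ρ.1.IsPositive ∧ TC.trace ρ = 1

/-- `Φ ≲_V Ψ`: for every density operator `ρ`, the reduced operators on `V` satisfy
`tr_{Vᶜ} Φ(ρ) ⊑ tr_{Vᶜ} Ψ(ρ)` in the Löwner order. -/
def Lesssim {Q : Type} (V : Set Q) (Φ Ψ : CP (Hilb Q)) : Prop :=
  ∀ ρ : TC (Hilb Q), IsDensity ρ → ptrace V (Φ.1 ρ) ≤ ptrace V (Ψ.1 ρ)

/-- `Φ ≂_V Ψ`. For `V = ∅` this is `Φ ≂ Ψ`: equality of the traces of `Φ ρ` and `Ψ ρ`. -/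
def Eqsim {Q : Type} (V : Set Q) (Φ Ψ : CP (Hilb Q)) : Prop := Lesssim V Φ Ψ ∧ Lesssim V Ψ Φ

/-- `Φ ∈ CP_t(H_V)`, seen as a super-operator on all qubits: `Φ = φ ⊗ id` for a trace preserving `φ` on
`V`. For infinite `V` the tensor product is described by the matrix blocks with respect to the basis
kets `w`, `w'` of the qubits outside `V`, on each of which `Φ` acts as `φ`. -/
def ActsOn {Q : Type} (V : Set Q) (Φ : CPt Q) : Prop :=
  ∃ φ : CPt V, ∀ A w w',
    TC.sandwich (insR (Function.Embedding.subtype (· ∈ V)) w).adjoint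
      (insR (Function.Embedding.subtype (· ∈ V)) w') (Φ.1.1 A) =
    φ.1.1 (TC.sandwich (insR (Function.Embedding.subtype (· ∈ V)) w).adjoint
      (insR (Function.Embedding.subtype (· ∈ V)) w') A)

/-- The parameters of the language: classical and quantum channel names, function and predicate
symbols on the reals for expressions, and process constants with their arities. -/
structure Sig where
  cChan : Type
  qChan : Type
  Fn : Type
  fnArity : Fn → ℕ
  fnEval : ∀ f, (Fin (fnArity f) → ℝ) → ℝ
  Pr : Type
  prArity : Pr → ℕ
  prEval : ∀ p, (Fin (prArity p) → ℝ) → Prop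
  Con : Type
  arC : Con → ℕ
  arQ : Con → ℕ

/-- Comparison symbols. -/
inductive Cmp | gt | lt | ge | le | eq

def Cmp.eval : Cmp → ℝ → ℝ → Prop
  | gt, a, b => a > b
  | lt, a, b => a < b
  | ge, a, b => a ≥ b
  | le, a, b => a ≤ b
  | eq, a, b => a = b

/-- Data expressions over the classical variables `X`; the values are real numbers. -/
inductive CExp (σ : Sig) (X : Type) : Type
  | var (x : X)
  | const (v : ℝ)
  | app (f : σ.Fn) (args : Fin (σ.fnArity f) → CExp σ X)

/-- Boolean expressions over the classical variables `X`. -/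
inductive BExp (σ : Sig) (X : Type) : Type
  | tt
  | ff
  | cmp (c : Cmp) (e e' : CExp σ X)
  | pred (p : σ.Pr) (args : Fin (σ.prArity p) → CExp σ X)
  | not (b : BExp σ X)
  | and (b b' : BExp σ X)
  | or (b b' : BExp σ X)
  | imp (b b' : BExp σ X)

namespace CExp
variable {σ : Sig} {X Y : Type}

def eval (ψ : X → ℝ) : CExp σ X → ℝ
  | var x => ψ x
  | const v => v
  | app f args => σ.fnEval f fun i => (args i).eval ψ

def fv : CExp σ X → Set X
  | var x => {x}
  | const _ => ∅
  | app _ args => ⋃ i, (args i).fv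

def subst (θ : X → CExp σ Y) : CExp σ X → CExp σ Y
  | var x => θ x
  | const v => const v
  | app f args => app f fun i => (args i).subst θ
end CExp

namespace BExp
variable {σ : Sig} {X Y : Type}

def eval (ψ : X → ℝ) : BExp σ X → Prop
  | tt => True
  | ff => False
  | cmp c e e' => c.eval (e.eval ψ) (e'.eval ψ)
  | pred p args => σ.prEval p fun i => (args i).eval ψ
  | not b => ¬ b.eval ψ
  | and b b' => b.eval ψ ∧ b'.eval ψ
  | or b b' => b.eval ψ ∨ b'.eval ψ
  | imp b b' => b.eval ψ → b'.eval ψ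

def fv : BExp σ X → Set X
  | tt => ∅
  | ff => ∅
  | cmp _ e e' => e.fv ∪ e'.fv
  | pred _ args => ⋃ i, (args i).fv
  | not b => b.fv
  | and b b' => b.fv ∪ b'.fv
  | or b b' => b.fv ∪ b'.fv
  | imp b b' => b.fv ∪ b'.fv

def subst (θ : X → CExp σ Y) : BExp σ X → BExp σ Y
  | tt => tt
  | ff => ff
  | cmp c e e' => cmp c (e.subst θ) (e'.subst θ)
  | pred p args => pred p fun i => (args i).subst θ
  | not b => not (b.subst θ)
  | and b b' => and (b.subst θ) (b'.subst θ)
  | or b b' => or (b.subst θ) (b'.subst θ)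
  | imp b b' => imp (b.subst θ) (b'.subst θ)

/-- `b` is satisfiable. -/
def Sat (b : BExp σ X) : Prop := ∃ ψ, b.eval ψ
/-- `b → b'` holds under every evaluation. -/
def Implies (b b' : BExp σ X) : Prop := ∀ ψ, b.eval ψ → b'.eval ψ
end BExp

/-- Non-degenerate projective measurements on `n` qubits, given by a Hermitian operator. -/
structure Meas (n : ℕ) where
  op : Hilb (Fin n) →L[ℂ] Hilb (Fin n)
  selfAdj : IsSelfAdjoint op
  nondeg : ∀ μ : ℂ, Module.finrank ℂ (Module.End.eigenspace op.toLinearMap μ) ≤ 1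

/-- Process terms with free classical variables in `X` and free quantum variables in `Q`, up to
α-equivalence: a binder adds the element `none` to the type of variables. `oper` applies a trace
preserving super-operator, `meas` measures, `res` restricts, `rel` relabels and `guard b t` is
`if b then t`. -/
inductive Term (σ : Sig) : Type → Type → Type 1
  | nil {X Q : Type} : Term σ X Q
  | con {X Q : Type} (A : σ.Con) (e : Fin (σ.arC A) → CExp σ X) (q : Fin (σ.arQ A) → Q) : Term σ X Q
  | tau {X Q : Type} (t : Term σ X Q) : Term σ X Q
  | cin {X Q : Type} (c : σ.cChan) (t : Term σ (Option X) Q) : Term σ X Q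
  | cout {X Q : Type} (c : σ.cChan) (e : CExp σ X) (t : Term σ X Q) : Term σ X Q
  | qin {X Q : Type} (c : σ.qChan) (t : Term σ X (Option Q)) : Term σ X Q
  | qout {X Q : Type} (c : σ.qChan) (q : Q) (t : Term σ X Q) : Term σ X Q
  | oper {X Q : Type} (n : ℕ) (F : CPt (Fin n)) (q : Fin n → Q) (t : Term σ X Q) : Term σ X Q
  | meas {X Q : Type} (n : ℕ) (M : Meas n) (q : Fin n → Q) (t : Term σ (Option X) Q) : Term σ X Q
  | sum {X Q : Type} (t u : Term σ X Q) : Term σ X Q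
  | par {X Q : Type} (t u : Term σ X Q) : Term σ X Q
  | res {X Q : Type} (t : Term σ X Q) (L : Set (σ.cChan ⊕ σ.qChan)) : Term σ X Q
  | rel {X Q : Type} (t : Term σ X Q) (fc : σ.cChan ↪ σ.cChan) (fq : σ.qChan ↪ σ.qChan) : Term σ X Q
  | guard {X Q : Type} (b : BExp σ X) (t : Term σ X Q) : Term σ X Q

namespace Term
variable {σ : Sig}

/-- Free quantum variables. -/
def qv : {X Q : Type} → Term σ X Q → Set Q
  | _, _, nil => ∅
  | _, _, con _ _ q => Set.range q
  | _, _, tau t => t.qv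
  | _, _, cin _ t => t.qv
  | _, _, cout _ _ t => t.qv
  | _, _, qin _ t => some ⁻¹' t.qv
  | _, _, qout _ q t => insert q t.qv
  | _, _, oper _ _ q t => t.qv ∪ Set.range q
  | _, _, meas _ _ q t => t.qv ∪ Set.range q
  | _, _, sum t u => t.qv ∪ u.qv
  | _, _, par t u => t.qv ∪ u.qv
  | _, _, res t _ => t.qv
  | _, _, rel t _ _ => t.qv
  | _, _, guard _ t => t.qv

/-- Free classical variables. -/
def fv : {X Q : Type} → Term σ X Q → Set X
  | _, _, nil => ∅
  | _, _, con _ e _ => ⋃ i, (e i).fv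
  | _, _, tau t => t.fv
  | _, _, cin _ t => some ⁻¹' t.fv
  | _, _, cout _ e t => e.fv ∪ t.fv
  | _, _, qin _ t => t.fv
  | _, _, qout _ _ t => t.fv
  | _, _, oper _ _ _ t => t.fv
  | _, _, meas _ _ _ t => some ⁻¹' t.fv
  | _, _, sum t u => t.fv ∪ u.fv
  | _, _, par t u => t.fv ∪ u.fv
  | _, _, res t _ => t.fv
  | _, _, rel t _ _ => t.fv
  | _, _, guard b t => b.fv ∪ t.fv

/-- The syntactic conditions of the language: tuples of quantum variables are repetition-free, an output
qubit is not used afterwards, and parallel components have no quantum variable in common. -/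
def WF : {X Q : Type} → Term σ X Q → Prop
  | _, _, nil => True
  | _, _, con _ _ q => Function.Injective q
  | _, _, tau t => t.WF
  | _, _, cin _ t => t.WF
  | _, _, cout _ _ t => t.WF
  | _, _, qin _ t => t.WF
  | _, _, qout _ q t => q ∉ t.qv ∧ t.WF
  | _, _, oper _ _ q t => Function.Injective q ∧ t.WF
  | _, _, meas _ _ q t => Function.Injective q ∧ t.WF
  | _, _, sum t u => t.WF ∧ u.WF
  | _, _, par t u => Disjoint t.qv u.qv ∧ t.WF ∧ u.WF
  | _, _, res t _ => t.WF
  | _, _, rel t _ _ => t.WF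
  | _, _, guard _ t => t.WF

/-- Substitution under a binder. -/
def lift {X Y : Type} (θ : X → CExp σ Y) : Option X → CExp σ (Option Y)
  | none => .var none
  | some x => (θ x).subst fun y => .var (some y)

/-- Capture-avoiding substitution for classical variables. -/
def csubst : {X Q : Type} → Term σ X Q → {Y : Type} → (X → CExp σ Y) → Term σ Y Q
  | _, _, nil, _, _ => nil
  | _, _, con A e q, _, θ => con A (fun i => (e i).subst θ) q
  | _, _, tau t, _, θ => tau (t.csubst θ)
  | _, _, cin c t, _, θ => cin c (t.csubst (lift θ))
  | _, _, cout c e t, _, θ => cout c (e.subst θ) (t.csubst θ)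
  | _, _, qin c t, _, θ => qin c (t.csubst θ)
  | _, _, qout c q t, _, θ => qout c q (t.csubst θ)
  | _, _, oper n F q t, _, θ => oper n F q (t.csubst θ)
  | _, _, meas n M q t, _, θ => meas n M q (t.csubst (lift θ))
  | _, _, sum t u, _, θ => sum (t.csubst θ) (u.csubst θ)
  | _, _, par t u, _, θ => par (t.csubst θ) (u.csubst θ)
  | _, _, res t L, _, θ => res (t.csubst θ) L
  | _, _, rel t fc fq, _, θ => rel (t.csubst θ) fc fq
  | _, _, guard b t, _, θ => guard (b.subst θ) (t.csubst θ)

/-- Capture-avoiding renaming of quantum variables. -/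
def qren : {X Q : Type} → Term σ X Q → {R : Type} → (Q → R) → Term σ X R
  | _, _, nil, _, _ => nil
  | _, _, con A e q, _, f => con A e (f ∘ q)
  | _, _, tau t, _, f => tau (t.qren f)
  | _, _, cin c t, _, f => cin c (t.qren f)
  | _, _, cout c e t, _, f => cout c e (t.qren f)
  | _, _, qin c t, _, f => qin c (t.qren (Option.map f))
  | _, _, qout c q t, _, f => qout c (f q) (t.qren f)
  | _, _, oper n F q t, _, f => oper n F (f ∘ q) (t.qren f)
  | _, _, meas n M q t, _, f => meas n M (f ∘ q) (t.qren f)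
  | _, _, sum t u, _, f => sum (t.qren f) (u.qren f)
  | _, _, par t u, _, f => par (t.qren f) (u.qren f)
  | _, _, res t L, _, f => res (t.qren f) L
  | _, _, rel t fc fq, _, f => rel (t.qren f) fc fq
  | _, _, guard b t, _, f => guard b (t.qren f)

/-- Instantiate the outermost bound classical variable. -/
def cinst {X Q : Type} (t : Term σ (Option X) Q) (e : CExp σ X) : Term σ X Q :=
  t.csubst fun x => x.elim e .var

/-- Instantiate the outermost bound quantum variable. -/
def qinst {X Q : Type} (t : Term σ X (Option Q)) (r : Q) : Term σ X Q :=
  t.qren fun q => q.getD r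

end Term


/-- Defining equations `A(x̃; q̃) := t` of the process constants, with `fv(t) ⊆ x̃` and `qv(t) ⊆ q̃`. -/
structure Env (σ : Sig) where
  body : ∀ A : σ.Con, Term σ (Fin (σ.arC A)) (Fin (σ.arQ A))
  wf : ∀ A, (body A).WF

/-- Symbolic actions. -/
inductive Act (σ : Sig) : Type
  | tau
  | cin (c : σ.cChan) (x : ℕ)
  | cout (c : σ.cChan) (e : CExp σ ℕ)
  | qin (c : σ.qChan) (r : ℕ)
  | qout (c : σ.qChan) (r : ℕ)

namespace Act
variable {σ : Sig}

/-- Bound classical variables of an action. -/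
def bv : Act σ → Set ℕ
  | cin _ x => {x}
  | _ => ∅

/-- Bound quantum variables of an action. -/
def qbv : Act σ → Set ℕ
  | qin _ r => {r}
  | _ => ∅

/-- Channel names of an action. -/
def cn : Act σ → Set (σ.cChan ⊕ σ.qChan)
  | tau => ∅
  | cin c _ => {Sum.inl c}
  | cout c _ => {Sum.inl c}
  | qin c _ => {Sum.inr c}
  | qout c _ => {Sum.inr c}

def relabel (fc : σ.cChan ↪ σ.cChan) (fq : σ.qChan ↪ σ.qChan) : Act σ → Act σ
  | tau => tau
  | cin c x => cin (fc c) x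
  | cout c e => cout (fc c) e
  | qin c r => qin (fq c) r
  | qout c r => qout (fq c) r

/-- `γ =_b γ'`. -/
def EqUnder (b : BExp σ ℕ) : Act σ → Act σ → Prop
  | cout c e, cout c' e' => c = c' ∧ b.Implies (.cmp .eq e e')
  | γ, γ' => γ = γ'

end Act

/-- Pairs of a term and a trace preserving super-operator on the state space of all qubits. -/
abbrev PreSnap (σ : Sig) : Type 1 := Term σ ℕ ℕ × CPt ℕ

/-- Finitely supported super-operator valued distributions. -/
abbrev SDist (S : Type 1) : Type 1 := S →₀ CP (Hilb ℕ)

/-- The distribution giving weight `I` to `s`. -/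
def point {S : Type 1} (s : S) : SDist S := Finsupp.single s 1

/-- Apply an operation on terms to all terms in a distribution. -/
def mapTerm {σ : Sig} (f : Term σ ℕ ℕ → Term σ ℕ ℕ) (Δ : SDist (PreSnap σ)) : SDist (PreSnap σ) :=
  Δ.mapDomain fun s => (f s.1, s.2)

/-- The symbolic transition relation. The channel functions of `rel` are injective. -/
inductive Trans {σ : Sig} (D : Env σ) : PreSnap σ → BExp σ ℕ → Act σ → SDist (PreSnap σ) → Prop
  | tau (t : Term σ ℕ ℕ) (E : CPt ℕ) :
      Trans D (.tau t, E) .tt .tau (point (t, E))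
  | cin (c : σ.cChan) (t : Term σ (Option ℕ) ℕ) (x : ℕ) (hx : x ∉ (Term.cin c t).fv)
      (E : CPt ℕ) :
      Trans D (.cin c t, E) .tt (.cin c x) (point (t.cinst (.var x), E))
  | cout (c : σ.cChan) (e : CExp σ ℕ) (t : Term σ ℕ ℕ) (E : CPt ℕ) :
      Trans D (.cout c e t, E) .tt (.cout c e) (point (t, E))
  | qin (c : σ.qChan) (t : Term σ ℕ (Option ℕ)) (r : ℕ) (hr : r ∉ (Term.qin c t).qv)
      (E : CPt ℕ) :
      Trans D (.qin c t, E) .tt (.qin c r) (point (t.qinst r, E))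
  | qout (c : σ.qChan) (r : ℕ) (t : Term σ ℕ ℕ) (E : CPt ℕ) :
      Trans D (.qout c r t, E) .tt (.qout c r) (point (t, E))
  | oper (n : ℕ) (F : CPt (Fin n)) (r : Fin n ↪ ℕ) (t : Term σ ℕ ℕ) (E : CPt ℕ) :
      Trans D (.oper n F r t, E) .tt .tau (point (t, CPt.liftAt r F * E))
  | meas (n : ℕ) (M : Meas n) (r : Fin n ↪ ℕ) (t : Term σ (Option ℕ) ℕ) (E : CPt ℕ)
      (l : Fin (2 ^ n) → ℝ) (φ : OrthonormalBasis (Fin (2 ^ n)) ℂ (Hilb (Fin n)))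
      (hM : M.op = ∑ i, (l i : ℂ) • InnerProductSpace.rankOne ℂ (φ i) (φ i)) :
      Trans D (.meas n M r t, E) .tt .tau
        (∑ i, Finsupp.single (t.cinst (.const (l i)), CPt.liftAt r (setTo φ i) * E)
          (CP.liftAt r (projAt φ i)))
  | sumL (t u : Term σ ℕ ℕ) (E : CPt ℕ) (b γ Δ) (h : Trans D (t, E) b γ Δ) :
      Trans D (.sum t u, E) b γ Δ
  | sumR (t u : Term σ ℕ ℕ) (E : CPt ℕ) (b γ Δ) (h : Trans D (u, E) b γ Δ) :
      Trans D (.sum t u, E) b γ Δ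
  | parL (t u : Term σ ℕ ℕ) (E : CPt ℕ) (b γ Δ) (h : Trans D (t, E) b γ Δ)
      (hq : Disjoint γ.qbv u.qv) (hc : Disjoint γ.bv u.fv) :
      Trans D (.par t u, E) b γ (mapTerm (fun t' => .par t' u) Δ)
  | parR (t u : Term σ ℕ ℕ) (E : CPt ℕ) (b γ Δ) (h : Trans D (u, E) b γ Δ)
      (hq : Disjoint γ.qbv t.qv) (hc : Disjoint γ.bv t.fv) :
      Trans D (.par t u, E) b γ (mapTerm (fun u' => .par t u') Δ)
  | cComL (t u t' u' : Term σ ℕ ℕ) (E : CPt ℕ) (b₁ b₂ c x e)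
      (h₁ : Trans D (t, E) b₁ (.cin c x) (point (t', E)))
      (h₂ : Trans D (u, E) b₂ (.cout c e) (point (u', E))) :
      Trans D (.par t u, E) (.and b₁ b₂) .tau
        (point (.par (t'.csubst (Function.update .var x e)) u', E))
  | cComR (t u t' u' : Term σ ℕ ℕ) (E : CPt ℕ) (b₁ b₂ c x e)
      (h₁ : Trans D (t, E) b₁ (.cout c e) (point (t', E)))
      (h₂ : Trans D (u, E) b₂ (.cin c x) (point (u', E))) :
      Trans D (.par t u, E) (.and b₁ b₂) .tau
        (point (.par t' (u'.csubst (Function.update .var x e)), E))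
  | qComL (t u t' u' : Term σ ℕ ℕ) (E : CPt ℕ) (b₁ b₂ c r)
      (h₁ : Trans D (t, E) b₁ (.qin c r) (point (t', E)))
      (h₂ : Trans D (u, E) b₂ (.qout c r) (point (u', E))) :
      Trans D (.par t u, E) (.and b₁ b₂) .tau (point (.par t' u', E))
  | qComR (t u t' u' : Term σ ℕ ℕ) (E : CPt ℕ) (b₁ b₂ c r)
      (h₁ : Trans D (t, E) b₁ (.qout c r) (point (t', E)))
      (h₂ : Trans D (u, E) b₂ (.qin c r) (point (u', E))) :
      Trans D (.par t u, E) (.and b₁ b₂) .tau (point (.par t' u', E))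
  | res (t : Term σ ℕ ℕ) (L) (E : CPt ℕ) (b γ Δ) (h : Trans D (t, E) b γ Δ)
      (hL : Disjoint γ.cn L) :
      Trans D (.res t L, E) b γ (mapTerm (fun t' => .res t' L) Δ)
  | rel (t : Term σ ℕ ℕ) (fc fq) (E : CPt ℕ) (b γ Δ) (h : Trans D (t, E) b γ Δ) :
      Trans D (.rel t fc fq, E) b (γ.relabel fc fq) (mapTerm (fun t' => .rel t' fc fq) Δ)
  | guard (b : BExp σ ℕ) (t : Term σ ℕ ℕ) (E : CPt ℕ) (b' γ Δ) (h : Trans D (t, E) b' γ Δ) :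
      Trans D (.guard b t, E) (.and b b') γ Δ
  | con (A : σ.Con) (e : Fin (σ.arC A) → CExp σ ℕ) (q : Fin (σ.arQ A) → ℕ) (E : CPt ℕ) (b γ Δ)
      (h : Trans D (((D.body A).csubst e).qren q, E) b γ Δ) :
      Trans D (.con A e q, E) b γ Δ

/-- Snapshots. -/
def Snap (σ : Sig) : Type 1 := {s : PreSnap σ // s.1.WF}

namespace Snap
variable {σ : Sig}

/-- The snapshot `⦇t, E⦈`. -/
def mk (t : Term σ ℕ ℕ) (h : t.WF) (E : CPt ℕ) : Snap σ := ⟨(t, E), h⟩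

def term (s : Snap σ) : Term σ ℕ ℕ := s.1.1
def op (s : Snap σ) : CPt ℕ := s.1.2
def qv (s : Snap σ) : Set ℕ := s.term.qv
def fv (s : Snap σ) : Set ℕ := s.term.fv

/-- `⦇t, E⦈ ↦ ⦇t, G E⦈`. -/
def act (G : CPt ℕ) (s : Snap σ) : Snap σ := mk s.term s.2 (G * s.op)

end Snap

section Bisimulation
variable {σ : Sig}

/-- The symbolic transition relation on snapshots. -/
def STrans (D : Env σ) (s : Snap σ) (b : BExp σ ℕ) (γ : Act σ) (Δ : SDist (Snap σ)) : Prop :=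
  Trans D s.1 b γ (Δ.mapDomain Subtype.val)

/-- `E • Δ`: the distribution with weights `Δ(s) E`. -/
def preMul {S : Type 1} (E : CPt ℕ) (Δ : SDist S) : SDist S :=
  Δ.mapRange (fun A => A * E.1) (zero_mul _)

open Classical in
/-- `Δ(T)` for a set `T` of states. -/
def mass {S : Type 1} (Δ : SDist S) (T : Set S) : CP (Hilb ℕ) :=
  ∑ x ∈ Δ.support with x ∈ T, Δ x

/-- The lifting of an equivalence relation `R` to distributions: both distributions give equivalent
weights to every equivalence class. -/
def liftRel {S : Type 1} (R : S → S → Prop) (Δ Ξ : SDist S) : Prop :=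
  ∀ s, Eqsim ∅ (mass Δ {x | R s x}) (mass Ξ {x | R s x})

/-- The transfer property: the transitions of `s` are matched under `b` by those of `s'`. -/
def Transfer (D : Env σ) (S : BExp σ ℕ → Snap σ → Snap σ → Prop) (b : BExp σ ℕ)
    (s s' : Snap σ) : Prop :=
  ∀ b₁ γ Δ, STrans D s b₁ γ Δ → Disjoint γ.bv (b.fv ∪ s.fv ∪ s'.fv) →
    ∃ B : Set (BExp σ ℕ), B.Finite ∧ (∀ ψ, (b.and b₁).eval ψ → ∃ b' ∈ B, b'.eval ψ) ∧
      ∀ b' ∈ B, ∃ b₂ γ' Ξ, b'.Implies b₂ ∧ γ.EqUnder b' γ' ∧ STrans D s' b₂ γ' Ξ ∧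
        liftRel (S b') (preMul s.op Δ) (preMul s'.op Ξ)

/-- Symbolic (open) bisimulations. -/
def IsSymBisim (D : Env σ) (S : BExp σ ℕ → Snap σ → Snap σ → Prop) : Prop :=
  (∀ b, Equivalence (S b)) ∧ ∀ b s s', S b s s' →
    (b.Sat → s.qv = s'.qv ∧ Eqsim s.qvᶜ s.op.1 s'.op.1) ∧
    ∀ G : CPt ℕ, ActsOn s.qvᶜ G → Transfer D S b (s.act G) (s'.act G)

/-- Symbolic ground bisimulations. -/
def IsGroundBisim (D : Env σ) (S : BExp σ ℕ → Snap σ → Snap σ → Prop) : Prop :=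
  (∀ b, Equivalence (S b)) ∧ ∀ b s s', S b s s' →
    (s.qv = s'.qv ∧ Eqsim s.qvᶜ s.op.1 s'.op.1) ∧ Transfer D S b s s'

/-- Symbolic `b`-bisimilarity `∼^b`. -/
def SymBisim (D : Env σ) (b : BExp σ ℕ) (s s' : Snap σ) : Prop :=
  ∃ S, IsSymBisim D S ∧ S b s s'

/-- Symbolic ground `b`-bisimilarity `∼_g^b`. -/
def GroundBisim (D : Env σ) (b : BExp σ ℕ) (s s' : Snap σ) : Prop :=
  ∃ S, IsGroundBisim D S ∧ S b s s'

/-- `u` is reached from `t` by one transition with a satisfiable guard. -/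
def Step (D : Env σ) (t u : Term σ ℕ ℕ) : Prop :=
  ∃ (E E' : CPt ℕ) (b : BExp σ ℕ) (γ : Act σ) (Δ : SDist (PreSnap σ)),
    Trans D (t, E) b γ Δ ∧ b.Sat ∧ Δ (u, E') ≠ 0

/-- No descendant of `t`, including `t` itself, can perform a quantum input. -/
def FreeOfQInput (D : Env σ) (t : Term σ ℕ ℕ) : Prop :=
  ∀ u, Relation.ReflTransGen (Step D) t u →
    ¬ ∃ (E : CPt ℕ) (b : BExp σ ℕ) (c : σ.qChan) (r : ℕ) (Δ : SDist (PreSnap σ)),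
      Trans D (u, E) b (.qin c r) Δ ∧ b.Sat

end Bisimulation

end QCCS

end

namespace QCCS

/-! ### Operators determined by their entries on computational basis kets. -/

section Kets

variable {P Q : Type}

/-! The proof exhibits one family of relations, `GroundChain D`, that is at once a symbolic and a
symbolic ground bisimulation and is closed under super-operators acting outside the free qubits.
Start from ground bisimilar snapshots free of quantum input. Strengthen the Boolean, rename
classical variables by a permutation, and apply a `G` local to the unused qubits; this is
`GroundStep`. Its transitive closure is an equivalence relation, as the lifting to distributions
requires. Both parts of the theorem follow from this one family. The passage from symbolic to ground
bisimilarity is easy for satisfiable `b`, once the relations at unsatisfiable Booleans are replaced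
by equality.

Three facts make a step compatible with `G`. First, a transition never inspects the accumulated
super-operator. Its target is a fixed kernel composed with that super-operator, and the kernel only
touches qubits in `qv`, so it commutes with `G` (`Trans.exists_kernel`). Hence the transitions of
`⦇t, G E⦈` are exactly those of `⦇t, E⦈` with `G` applied to the targets (`STrans.act`,
`STrans.of_act`). Second, `G` preserves traces and commutes with the weights, so it drops out of the
masses compared by the lifted relation (`liftRel_mapDomain`). Third, for `G` local to `V` the
partial trace of `G X` onto `V` depends only on the partial trace of `X`, so `≂_V` survives `G`
(`Eqsim.local_mul`). With infinitely many qubits this third fact is a limit argument, resting on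
positivity.

Freedom from quantum input keeps the induction going. Without an input the free qubits of a
descendant lie among those of its ancestor, so `G` still acts outside them. A received qubit could
be one that `G` touches.

Transitivity meets a problem with bound variables. The transfer property speaks of bound variables
that are not free in the two end terms, but the matching also needs them fresh for the intermediate
snapshots. The argument therefore uses `FreshTransfer`, which may exclude any finite set of bound
variables and composes along chains. Invariance under permutations of variables (`Trans.rename`)
then recovers the full transfer property. -/

theorem clm_ext_kets {F : Type} [NormedAddCommGroup F] [InnerProductSpace ℂ F]
    {L M : Hilb P →L[ℂ] F} (h : ∀ s, L (kets P s) = M (kets P s)) : L = M := by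
  refine ContinuousLinearMap.ext_on (s := Set.range (kets P)) ?_ ?_
  · exact Submodule.dense_iff_topologicalClosure_eq_top.2 (kets P).dense_span
  · rintro _ ⟨s, rfl⟩
    exact h s

theorem eq_of_inner_kets {x y : Hilb P}
    (h : ∀ s, (inner ℂ (kets P s) x : ℂ) = inner ℂ (kets P s) y) : x = y := by
  refine (kets P).repr.injective ?_
  ext s
  rw [HilbertBasis.repr_apply_apply, HilbertBasis.repr_apply_apply, h]

theorem clm_ext_inner_kets {L M : Hilb P →L[ℂ] Hilb Q}
    (h : ∀ a b, (inner ℂ (kets Q a) (L (kets P b)) : ℂ) = inner ℂ (kets Q a) (M (kets P b))) :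
    L = M :=
  clm_ext_kets fun b => eq_of_inner_kets fun a => h a b

theorem insR_kets (r : P ↪ Q) (w : Finset ↥(Set.range r)ᶜ) (s : Finset P) :
    insR r w (kets _ s) = kets Q (merge r s w) := ketMap_kets _ _ _

theorem merge_inj (r : P ↪ Q) {s t : Finset P} {v w : Finset ↥(Set.range r)ᶜ} :
    merge r s v = merge r t w ↔ s = t ∧ v = w := by
  simpa using (merge_bijective r).1.eq_iff (a := (s, v)) (b := (t, w))

theorem insR_adjoint_insR (r : P ↪ Q) (v w : Finset ↥(Set.range r)ᶜ)
    (s : Finset P) [Decidable (v = w)] :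
    (insR r v).adjoint (insR r w (kets _ s)) = if v = w then kets _ s else 0 := by
  classical
  refine eq_of_inner_kets fun t => ?_
  rw [ContinuousLinearMap.adjoint_inner_right, insR_kets, insR_kets, inner_kets]
  by_cases h : v = w
  · simp [h, inner_kets, merge_inj]
  · simp [h, merge_inj]

theorem insR_adjoint_comp_insR (r : P ↪ Q) (w : Finset ↥(Set.range r)ᶜ) :
    (insR r w).adjoint ∘L insR r w = ContinuousLinearMap.id ℂ _ := by
  classical
  exact clm_ext_kets fun s => by simp [insR_adjoint_insR]

theorem merge_eq_union [DecidableEq Q] (r : P ↪ Q) (s : Finset P)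
    (w : Finset ↥(Set.range r)ᶜ) :
    merge r s w = s.map r ∪ w.map (Function.Embedding.subtype _) :=
  Finset.disjUnion_eq_union _ _ _

theorem exists_finset_map {r : P ↪ Q} {s : Finset Q} (h : (s : Set Q) ⊆ Set.range r) :
    ∃ s' : Finset P, s = s'.map r := by
  classical
  refine ⟨s.preimage r r.injective.injOn, ?_⟩
  ext q
  simp only [Finset.mem_map, Finset.mem_preimage]
  constructor
  · intro hq
    obtain ⟨p, rfl⟩ := h hq
    exact ⟨p, hq, rfl⟩
  · rintro ⟨p, hp, rfl⟩
    exact hp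

theorem exists_finset_map_compl {r : P ↪ Q} {s : Finset Q} (h : (s : Set Q) ⊆ (Set.range r)ᶜ) :
    ∃ s' : Finset ↥(Set.range r)ᶜ, s = s'.map (Function.Embedding.subtype _) :=
  exists_finset_map (by rwa [show Set.range (Function.Embedding.subtype (· ∈ (Set.range r)ᶜ)) =
    (Set.range r)ᶜ from Subtype.range_coe])

theorem TC.ext_kets {A B : TC (Hilb Q)}
    (h : ∀ a b, (inner ℂ (kets Q a) (A.1 (kets Q b)) : ℂ) = inner ℂ (kets Q a) (B.1 (kets Q b))) :
    A = B :=
  Subtype.ext (clm_ext_inner_kets h)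

/-- Every basis ket of `Q` splits uniquely over `r` and its complement, so each matrix entry lies in
some block. -/
theorem TC.ext_blocks (r : P ↪ Q) {A B : TC (Hilb Q)}
    (h : ∀ v w, TC.sandwich (insR r v).adjoint (insR r w) A =
      TC.sandwich (insR r v).adjoint (insR r w) B) : A = B := by
  refine TC.ext_kets fun a b => ?_
  obtain ⟨⟨s, v⟩, rfl⟩ := (merge_bijective r).2 a
  obtain ⟨⟨t, w⟩, rfl⟩ := (merge_bijective r).2 b
  have := congrArg (fun X => (inner ℂ (kets P s) (X.1 (kets P t)) : ℂ)) (h v w)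
  simpa [TC.sandwich, ContinuousLinearMap.adjoint_inner_right, insR_kets] using this

end Kets

/-! ### Super-operators acting on a set of qubits, described by commutation. -/

section Local

variable {P Q : Type} [DecidableEq Q]

/-- `L` maps basis kets to basis kets or to `0`, in a way that neither looks at the qubits in `V` nor
changes them. -/
def OffKets (V : Set Q) (L : Hilb Q →L[ℂ] Hilb Q) : Prop :=
  ∀ w : Finset Q, (w : Set Q) ⊆ Vᶜ →
    (∀ s : Finset Q, (s : Set Q) ⊆ V → L (kets Q (s ∪ w)) = 0) ∨
    ∃ w' : Finset Q, (w' : Set Q) ⊆ Vᶜ ∧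
      ∀ s : Finset Q, (s : Set Q) ⊆ V → L (kets Q (s ∪ w)) = kets Q (s ∪ w')

/-- An operator that ignores the qubits in `W` ignores those in the smaller set `V`: the part of the
outer label lying in `W` is carried along unchanged. -/
theorem OffKets.mono {V W : Set Q} (hVW : V ⊆ W) {L : Hilb Q →L[ℂ] Hilb Q} (h : OffKets W L) :
    OffKets V L := by
  classical
  intro w hw
  -- The half of `w` inside `W` joins the inner label `s`, and only the other half is moved by `L`.
  have hsplit : w = w.filter (· ∈ W) ∪ w.filter (· ∉ W) := (Finset.filter_union_filter_not_eq _ _).symm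
  have h1 : ∀ s : Finset Q, (s : Set Q) ⊆ V → ((s ∪ w.filter (· ∈ W) : Finset Q) : Set Q) ⊆ W := by
    intro s hs q hq
    rcases Finset.mem_union.1 hq with hq | hq
    · exact hVW (hs hq)
    · exact (Finset.mem_filter.1 hq).2
  rcases h (w.filter (· ∉ W)) (fun q hq => (Finset.mem_filter.1 hq).2) with h | ⟨w', hw', h⟩
  · left
    intro s hs
    rw [hsplit, ← Finset.union_assoc]
    exact h _ (h1 s hs)
  · right
    refine ⟨w.filter (· ∈ W) ∪ w', ?_, fun s hs => ?_⟩
    · intro q hq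
      rcases Finset.mem_union.1 hq with hq | hq
      · exact hw (Finset.mem_filter.1 hq).1
      · exact fun hV => hw' hq (hVW hV)
    · rw [hsplit, ← Finset.union_assoc, ← Finset.union_assoc, ← hsplit]
      exact h _ (h1 s hs)

theorem OffKets.comp_insR {V : Set Q} {L : Hilb Q →L[ℂ] Hilb Q} (h : OffKets V L)
    (w : Finset ↥(Set.range (Function.Embedding.subtype (· ∈ V)))ᶜ) :
    L ∘L insR (Function.Embedding.subtype (· ∈ V)) w = 0 ∨
    ∃ w', L ∘L insR (Function.Embedding.subtype (· ∈ V)) w =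
      insR (Function.Embedding.subtype (· ∈ V)) w' := by
  have hr : Set.range (Function.Embedding.subtype (· ∈ V)) = V := by simp
  have hs : ∀ s : Finset V, ((s.map (Function.Embedding.subtype (· ∈ V)) : Finset Q) : Set Q) ⊆ V := by
    intro s q hq
    simp at hq
    exact hq.1
  rcases h (w.map (Function.Embedding.subtype _)) (by
    intro q hq
    obtain ⟨⟨q, h⟩, -, rfl⟩ := Finset.mem_map.1 hq
    rwa [hr] at h) with h | ⟨w', hw', h⟩
  · left
    refine clm_ext_kets fun s => ?_
    rw [ContinuousLinearMap.comp_apply, insR_kets, merge_eq_union, h _ (hs s)]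
    rfl
  · right
    obtain ⟨v, rfl⟩ := exists_finset_map_compl (r := Function.Embedding.subtype (· ∈ V))
      (s := w') (by rwa [hr])
    refine ⟨v, clm_ext_kets fun s => ?_⟩
    rw [ContinuousLinearMap.comp_apply, insR_kets, insR_kets, merge_eq_union, h _ (hs s),
      merge_eq_union]

/-- `G` acts on the qubits in `V` only: it commutes with all matrix units outside `V`. -/
def LocalTo (V : Set Q) (G : CPt Q) : Prop :=
  ∀ K L : Hilb Q →L[ℂ] Hilb Q, OffKets V K.adjoint → OffKets V L →
    ∀ A, G.1.1 (TC.sandwich K L A) = TC.sandwich K L (G.1.1 A)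

/-- A larger `W` leaves fewer operators to commute with. This makes commutation more convenient than
`ActsOn`, whose enlargement would require building a super-operator on `W`. -/
theorem LocalTo.mono {V W : Set Q} (h : V ⊆ W) {G : CPt Q} (hG : LocalTo V G) : LocalTo W G :=
  fun K L hK hL => hG K L (hK.mono h) (hL.mono h)

theorem LocalTo.one (V : Set Q) : LocalTo V (1 : CPt Q) := fun _ _ _ _ _ => rfl

theorem LocalTo.mul {V : Set Q} {G H : CPt Q} (hG : LocalTo V G) (hH : LocalTo V H) :
    LocalTo V (G * H) := fun K L hK hL A => by
  change G.1.1 (H.1.1 _) = TC.sandwich K L (G.1.1 (H.1.1 A))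
  rw [hH K L hK hL, hG K L hK hL]

/-- Multiplying by operators off `V` only permutes or kills the blocks over `V`, while `G` acts on
every block by the same `φ`. -/
theorem ActsOn.localTo {V : Set Q} {G : CPt Q} (h : ActsOn V G) : LocalTo V G := by
  obtain ⟨φ, hφ⟩ := h
  intro K L hK hL A
  refine TC.ext_blocks (Function.Embedding.subtype (· ∈ V)) fun v w => ?_
  have hb : ∀ X : TC (Hilb Q), TC.sandwich (insR (Function.Embedding.subtype (· ∈ V)) v).adjoint
      (insR (Function.Embedding.subtype (· ∈ V)) w) (TC.sandwich K L X) =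
      TC.sandwich (K.adjoint ∘L insR (Function.Embedding.subtype (· ∈ V)) v).adjoint
        (L ∘L insR (Function.Embedding.subtype (· ∈ V)) w) X := by
    intro X
    refine Subtype.ext ?_
    simp [TC.sandwich, ContinuousLinearMap.adjoint_comp, ContinuousLinearMap.comp_assoc]
  rw [hφ, hb, hb]
  have h0 : ∀ (B : Hilb Q →L[ℂ] Hilb V) (X : TC (Hilb Q)), TC.sandwich B 0 X = 0 := fun B X =>
    Subtype.ext (by simp [TC.sandwich])
  have h0' : ∀ (B : Hilb V →L[ℂ] Hilb Q) (X : TC (Hilb Q)), TC.sandwich 0 B X = 0 := fun B X =>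
    Subtype.ext (by simp [TC.sandwich])
  rcases hK.comp_insR v with h | ⟨v', h⟩
  · simp [h, h0']
  rcases hL.comp_insR w with h' | ⟨w', h'⟩
  · simp [h', h0]
  rw [h, h', hφ]

/-- This operator is the matrix unit `|s⟩⟨t|` on the qubits `r`, tensored with the identity
elsewhere. -/
theorem offKets_insL (r : P ↪ Q) (s t : Finset P) {V : Set Q} (hV : Disjoint V (Set.range r)) :
    OffKets V (insL r s ∘L (insL r t).adjoint) := by
  classical
  refine OffKets.mono (W := (Set.range r)ᶜ) (Set.subset_compl_iff_disjoint_right.2 hV) ?_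
  intro w hw
  rw [compl_compl] at hw
  obtain ⟨w, rfl⟩ := exists_finset_map hw
  have key : ∀ v : Finset Q, (v : Set Q) ⊆ (Set.range r)ᶜ →
      (insL r s ∘L (insL r t).adjoint) (kets Q (v ∪ w.map r)) =
      if t = w then kets Q (v ∪ s.map r) else 0 := by
    intro v hv
    obtain ⟨v, rfl⟩ := exists_finset_map_compl hv
    rw [Finset.union_comm, ← merge_eq_union, Finset.union_comm, ← merge_eq_union,
      ContinuousLinearMap.comp_apply, ← insL_kets, ← insL_kets, insL_adjoint_insL]
    split <;> simp
  by_cases h : t = w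
  · right
    refine ⟨s.map r, by simp, fun v hv => ?_⟩
    rw [key v hv, if_pos h]
  · left
    intro v hv
    rw [key v hv, if_neg h]

/-- This is the matrix unit `|v⟩⟨w|` on the qubits outside `V`; such operators move one block over
`V` to another. -/
theorem offKets_insR {V : Set Q}
    (v w : Finset ↥(Set.range (Function.Embedding.subtype (· ∈ V)))ᶜ) :
    OffKets V (insR (Function.Embedding.subtype (· ∈ V)) v ∘L
      (insR (Function.Embedding.subtype (· ∈ V)) w).adjoint) := by
  classical
  have hr : Set.range (Function.Embedding.subtype (· ∈ V)) = V := by simp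
  intro u hu
  obtain ⟨u, rfl⟩ := exists_finset_map_compl (r := Function.Embedding.subtype (· ∈ V))
      (s := u) (by rwa [hr])
  have key : ∀ s : Finset Q, (s : Set Q) ⊆ V →
      (insR (Function.Embedding.subtype (· ∈ V)) v ∘L
      (insR (Function.Embedding.subtype (· ∈ V)) w).adjoint)
        (kets Q (s ∪ u.map (Function.Embedding.subtype _))) =
      if w = u then kets Q (s ∪ v.map (Function.Embedding.subtype _)) else 0 := by
    intro s hs
    obtain ⟨s, rfl⟩ := exists_finset_map (r := Function.Embedding.subtype (· ∈ V))
      (s := s) (by rwa [hr])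
    rw [← merge_eq_union, ← merge_eq_union,
      ContinuousLinearMap.comp_apply, ← insR_kets, ← insR_kets, insR_adjoint_insR]
    split <;> simp
  by_cases h : w = u
  · right
    refine ⟨v.map (Function.Embedding.subtype _), ?_, fun s hs => ?_⟩
    · intro q hq
      obtain ⟨⟨q, h⟩, -, rfl⟩ := Finset.mem_map.1 hq
      rwa [hr] at h
    · rw [key s hs, if_pos h]
  · left
    intro s hs
    rw [key s hs, if_neg h]

/-- A lifted super-operator is a linear combination of sandwiches between matrix units on `r`, and
`G` commutes with each of these. -/
theorem LocalTo.commute_liftAt [Fintype P] {V : Set Q} {G : CPt Q} (hG : LocalTo V G) (r : P ↪ Q)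
    (hV : Disjoint V (Set.range r)) (Φ : CP (Hilb P)) : Commute (CP.liftAt r Φ) G.1 := by
  refine Subtype.ext (LinearMap.ext fun A => ?_)
  change (CP.liftAt r Φ).1 (G.1.1 A) = G.1.1 ((CP.liftAt r Φ).1 A)
  simp only [CP.liftAt, CP.lift, LinearMap.sum_apply, LinearMap.smul_apply, map_sum, map_smul]
  refine Finset.sum_congr rfl fun u _ => Finset.sum_congr rfl fun u' _ =>
    Finset.sum_congr rfl fun s _ => Finset.sum_congr rfl fun s' _ => ?_
  rw [hG]
  · rw [ContinuousLinearMap.adjoint_comp, ContinuousLinearMap.adjoint_adjoint]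
    exact offKets_insL r s u hV
  · exact offKets_insL r s' u' hV

end Local

/-! ### Convergence of partial traces, and entries of positive trace class operators. -/

section PartialTrace

theorem isTraceClass_of_countable {E : Type} [NormedAddCommGroup E] [InnerProductSpace ℂ E]
    [CompleteSpace E] {ι : Type} [Countable ι] {x y : ι → E} {A : E →L[ℂ] E}
    (h : Summable fun i => ‖x i‖ * ‖y i‖)
    (hA : HasSum (fun i => InnerProductSpace.rankOne ℂ (x i) (y i)) A) : IsTraceClass A := by
  obtain ⟨e, he⟩ := exists_injective_nat ι
  refine ⟨Function.extend e x 0, Function.extend e y 0, ?_, ?_⟩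
  · convert ((hasSum_extend_zero he).2 h.hasSum).summable using 2 with n
    by_cases hn : ∃ i, e i = n
    · obtain ⟨i, rfl⟩ := hn
      simp [he.extend_apply]
    · simp [Function.extend_apply' _ _ _ hn]
  · convert (hasSum_extend_zero he).2 hA using 2 with n
    by_cases hn : ∃ i, e i = n
    · obtain ⟨i, rfl⟩ := hn
      simp [he.extend_apply]
    · simp [Function.extend_apply' _ _ _ hn]

theorem hasSum_norm_sq_inner {E ι : Type} [NormedAddCommGroup E] [InnerProductSpace ℂ E]
    (b : HilbertBasis ι ℂ E) (x : E) :
    HasSum (fun i => ‖(inner ℂ (b i) x : ℂ)‖ ^ 2) (‖x‖ ^ 2) := by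
  have h := b.hasSum_inner_mul_inner x x
  rw [inner_self_eq_norm_sq_to_K] at h
  refine Complex.hasSum_ofReal.1 ?_
  rw [Complex.ofReal_pow]
  refine h.congr_fun ?_
  intro i
  rw [← inner_conj_symm x, RCLike.conj_mul, Complex.ofReal_pow]
  rfl

variable {P Q : Type}

theorem hasSum_norm_sq_insR_adjoint (r : P ↪ Q) (x : Hilb Q) :
    HasSum (fun w => ‖(insR r w).adjoint x‖ ^ 2) (‖x‖ ^ 2) := by
  have h := hasSum_norm_sq_inner (kets Q) x
  let e := Equiv.ofBijective _ (merge_bijective r)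
  have h2 := ((Equiv.prodComm _ _).trans e).hasSum_iff.2 h
  refine h2.prod_fiberwise fun w => ?_
  have h3 := hasSum_norm_sq_inner (kets P) ((insR r w).adjoint x)
  refine h3.congr_fun ?_
  intro s
  simp [ContinuousLinearMap.adjoint_inner_right, insR_kets, e]

/-- Cutting each rank-one term of a nuclear expansion into its blocks gives a doubly indexed nuclear
expansion. It is summable by Cauchy–Schwarz over the blocks and the Parseval identity
`hasSum_norm_sq_insR_adjoint`. -/
theorem exists_hasSum_blocks [Countable Q] (r : P ↪ Q) (A : TC (Hilb Q)) :
    ∃ T : TC (Hilb P), HasSum (fun w => (insR r w).adjoint ∘L A.1 ∘L insR r w) T.1 := by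
  classical
  obtain ⟨A, x, y, h1, h2⟩ := A
  have key : ∀ n, Summable (fun w => ‖(insR r w).adjoint (x n)‖ * ‖(insR r w).adjoint (y n)‖) ∧
      ∑' w, ‖(insR r w).adjoint (x n)‖ * ‖(insR r w).adjoint (y n)‖ ≤ ‖x n‖ * ‖y n‖ := by
    intro n
    have hx := hasSum_norm_sq_insR_adjoint r (x n)
    have hy := hasSum_norm_sq_insR_adjoint r (y n)
    have h := Real.summable_and_inner_le_Lp_mul_Lq_tsum_of_nonneg (p := 2) (q := 2)
      (f := fun w => ‖(insR r w).adjoint (x n)‖) (g := fun w => ‖(insR r w).adjoint (y n)‖)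
      ⟨by norm_num, by norm_num, by norm_num⟩ (fun _ => norm_nonneg _) (fun _ => norm_nonneg _)
      (by simpa using hx.summable) (by simpa using hy.summable)
    refine ⟨h.1, h.2.trans ?_⟩
    simp only [Real.rpow_two, ← Real.sqrt_eq_rpow, hx.tsum_eq, hy.tsum_eq]
    simp
  have hs : Summable fun p : ℕ × Finset ↥(Set.range r)ᶜ =>
      ‖(insR r p.2).adjoint (x p.1)‖ * ‖(insR r p.2).adjoint (y p.1)‖ := by
    rw [summable_prod_of_nonneg (fun _ => by positivity)]
    exact ⟨fun n => (key n).1, h1.of_nonneg_of_le (fun n => tsum_nonneg fun s => by positivity)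
      fun n => (key n).2⟩
  have hs' := (hs.prod_symm)
  have hS : Summable fun p : Finset ↥(Set.range r)ᶜ × ℕ => InnerProductSpace.rankOne ℂ
      ((insR r p.1).adjoint (x p.2)) ((insR r p.1).adjoint (y p.2)) := by
    refine Summable.of_norm ?_
    simpa [InnerProductSpace.norm_rankOne] using hs'
  -- Trace class is witnessed by sequences, so the double index set has to be countable; hence the
  -- assumption on `Q`.
  have : Countable (Finset ↥(Set.range r)ᶜ × ℕ) := inferInstance
  refine ⟨⟨_, isTraceClass_of_countable hs' hS.hasSum⟩, ?_⟩
  refine hS.hasSum.prod_fiberwise fun w => ?_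
  have h3 := h2.mapL ((ContinuousLinearMap.compL ℂ (Hilb P) (Hilb Q) (Hilb P)
    (insR r w).adjoint).comp ((ContinuousLinearMap.compL ℂ (Hilb P) (Hilb Q) (Hilb Q)).flip
      (insR r w)))
  refine h3.congr_fun ?_
  intro n
  ext z : 1
  simp [ContinuousLinearMap.adjoint_inner_left]

/-- `ptrace` is a `tsum`, which would be `0` if the blocks were not summable; convergence in
operator norm rules this out. -/
theorem hasSum_ptrace [Countable Q] (V : Set Q) (A : TC (Hilb Q)) :
    HasSum (fun w => (insR (Function.Embedding.subtype (· ∈ V)) w).adjoint ∘L A.1 ∘L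
      insR (Function.Embedding.subtype (· ∈ V)) w) (ptrace V A) := by
  obtain ⟨T, hT⟩ := exists_hasSum_blocks (Function.Embedding.subtype (· ∈ V)) A
  unfold ptrace
  exact hT.summable.hasSum

theorem isTraceClass_ptrace [Countable Q] (V : Set Q) (A : TC (Hilb Q)) :
    IsTraceClass (ptrace V A) := by
  obtain ⟨T, hT⟩ := exists_hasSum_blocks (Function.Embedding.subtype (· ∈ V)) A
  unfold ptrace
  rw [hT.tsum_eq]
  exact T.2

theorem hasSum_inner_ptrace [Countable Q] (V : Set Q) (A : TC (Hilb Q)) (x y : Hilb V) :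
    HasSum (fun w => (inner ℂ (insR (Function.Embedding.subtype (· ∈ V)) w x)
      (A.1 (insR (Function.Embedding.subtype (· ∈ V)) w y)) : ℂ)) (inner ℂ x (ptrace V A y)) := by
  have h := (hasSum_ptrace V A).mapL ((innerSL ℂ x).comp (ContinuousLinearMap.apply ℂ _ y))
  simpa [ContinuousLinearMap.adjoint_inner_right] using h

theorem TC.hasSum_trace (A : TC (Hilb Q)) :
    HasSum (fun s => (inner ℂ (kets Q s) (A.1 (kets Q s)) : ℂ)) (TC.trace A) :=
  (TC.summable_trace A (kets Q)).hasSum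

theorem trace_ptrace [Countable Q] (V : Set Q) (A : TC (Hilb Q)) :
    TC.trace ⟨ptrace V A, isTraceClass_ptrace V A⟩ = (TC.trace A) := by
  have h1 := (Equiv.ofBijective _ (merge_bijective
    (Function.Embedding.subtype (· ∈ V)))).hasSum_iff.2 (TC.hasSum_trace A)
  have h2 : HasSum (fun s => (inner ℂ (kets V s) (ptrace V A (kets V s)) : ℂ)) (TC.trace A) := by
    refine HasSum.prod_fiberwise h1 fun s => ?_
    refine (hasSum_inner_ptrace V A (kets V s) (kets V s)).congr_fun ?_
    intro w
    rw [insR_kets]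
    rfl
  exact h2.tsum_eq

theorem hasSum_trace_blocks [Countable Q] (r : P ↪ Q) (A : TC (Hilb Q)) :
    HasSum (fun w => TC.trace (TC.sandwich (insR r w).adjoint (insR r w) A)) (TC.trace A) := by
  let e := (Equiv.prodComm _ _).trans (Equiv.ofBijective _ (merge_bijective r))
  refine (e.hasSum_iff.2 (TC.hasSum_trace A)).prod_fiberwise fun w => ?_
  refine (TC.hasSum_trace _).congr_fun ?_
  intro s
  simp [TC.sandwich, ContinuousLinearMap.adjoint_inner_right, insR_kets, e]

theorem trace_sandwich_insR (r : P ↪ Q) (w : Finset ↥(Set.range r)ᶜ) (A : TC (Hilb P)) :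
    TC.trace (TC.sandwich (insR r w) (insR r w).adjoint A) = (TC.trace A) := by
  classical
  have hi : Function.Injective fun s : Finset P => merge r s w := fun _ _ h =>
    ((merge_inj r).1 h).1
  unfold TC.trace
  rw [← hi.tsum_eq]
  · refine tsum_congr fun s => ?_
    rw [← insR_kets]
    simp [TC.sandwich, ← ContinuousLinearMap.adjoint_inner_left, insR_adjoint_insR]
  · intro q hq
    obtain ⟨⟨s, v⟩, rfl⟩ := (merge_bijective r).2 q
    by_cases h : w = v
    · exact ⟨s, by simp [h]⟩
    · refine absurd ?_ hq
      simp [TC.sandwich, ← insR_kets, insR_adjoint_insR, h]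

/-- All expectations are nonnegative. -/
def TC.Nonneg (A : TC (Hilb Q)) : Prop := ∀ x, 0 ≤ (inner ℂ x (A.1 x) : ℂ)

theorem IsCP.nonneg {Φ : TC (Hilb Q) →ₗ[ℂ] TC (Hilb Q)} (hΦ : IsCP Φ) {A : TC (Hilb Q)}
    (hA : TC.Nonneg A) : TC.Nonneg (Φ A) := by
  intro x
  have h := hΦ Unit (fun _ _ => A) (fun y => by simpa using hA (y ())) fun _ => x
  simpa using h

theorem TC.Nonneg.sandwich {A : TC (Hilb Q)} (hA : TC.Nonneg A) (K : Hilb Q →L[ℂ] Hilb P) :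
    TC.Nonneg (TC.sandwich K K.adjoint A) := by
  intro x
  simpa [TC.sandwich, ContinuousLinearMap.adjoint_inner_left] using hA (K.adjoint x)

theorem TC.Nonneg.inner_kets_le_trace {A : TC (Hilb Q)} (hA : TC.Nonneg A) (a : Finset Q) :
    (inner ℂ (kets Q a) (A.1 (kets Q a)) : ℂ) ≤ (TC.trace A) := by
  have h := sum_le_hasSum {a} (fun s _ => hA (kets Q s)) (TC.hasSum_trace A)
  simpa using h

/-- Positivity on `|a⟩ - c|b⟩`, with a phase `c` aligning the off-diagonal entry, bounds twice its
modulus by the sum of two diagonal entries. Each of those is at most the trace. -/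
theorem TC.Nonneg.norm_inner_kets_le {A : TC (Hilb Q)} (hA : TC.Nonneg A) (a b : Finset Q) :
    ‖(inner ℂ (kets Q a) (A.1 (kets Q b)) : ℂ)‖ ≤ (TC.trace A).re := by
  have hsym : (A.1 : Hilb Q →ₗ[ℂ] Hilb Q).IsSymmetric := by
    rw [LinearMap.isSymmetric_iff_inner_map_self_real]
    intro v
    have h1 : (inner ℂ v (A.1 v) : ℂ).im = 0 := ((Complex.le_def.1 (hA v)).2).symm
    have h2 := inner_conj_symm (𝕜 := ℂ) (A.1 v) v
    rw [Complex.conj_eq_iff_im]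
    change (inner ℂ (A.1 v) v : ℂ).im = 0
    rw [← h2, Complex.conj_im, h1, neg_zero]
  set z : ℂ := inner ℂ (kets Q a) (A.1 (kets Q b)) with hz
  have hz' : (inner ℂ (kets Q b) (A.1 (kets Q a)) : ℂ) = starRingEnd ℂ z := by
    rw [hz, inner_conj_symm]
    exact (hsym _ _).symm
  have ha := (Complex.le_def.1 (hA.inner_kets_le_trace a)).1
  have hb := (Complex.le_def.1 (hA.inner_kets_le_trace b)).1
  -- The phase `c` rotates `z` onto the nonnegative real axis.
  obtain ⟨c, hc1, hc2⟩ : ∃ c : ℂ, ‖c‖ = 1 ∧ c * z = ‖z‖ := by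
    by_cases h0 : z = 0
    · exact ⟨1, by simp, by simp [h0]⟩
    · have hn : (‖z‖ : ℂ) ≠ 0 := by simpa using h0
      refine ⟨starRingEnd ℂ z / ‖z‖, by simp [h0], ?_⟩
      rw [div_mul_eq_mul_div, RCLike.conj_mul]
      field_simp
      simp
  have hcc : c * starRingEnd ℂ c = 1 := by
    rw [RCLike.mul_conj, hc1]; simp
  have h := (Complex.le_def.1 (hA (kets Q a - c • kets Q b))).1
  have hexp : (inner ℂ (kets Q a - c • kets Q b) (A.1 (kets Q a - c • kets Q b)) : ℂ) =
      inner ℂ (kets Q a) (A.1 (kets Q a)) + inner ℂ (kets Q b) (A.1 (kets Q b))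
        - (c * z + starRingEnd ℂ (c * z)) := by
    simp only [map_sub, map_smul, inner_sub_left, inner_sub_right, inner_smul_left,
      inner_smul_right, ← hz, hz', map_mul]
    linear_combination (inner ℂ (kets Q b) (A.1 (kets Q b)) : ℂ) * hcc
  rw [hexp, hc2] at h
  simp only [Complex.conj_ofReal, Complex.sub_re, Complex.add_re, Complex.ofReal_re,
    Complex.zero_re] at h
  linarith

end PartialTrace

/-! ### Equality of reduced states is preserved by local super-operators. -/

section EqsimLocal

variable {P Q : Type}

theorem TC.trace_sub (A B : TC (Hilb Q)) : TC.trace (A - B) = TC.trace A - TC.trace B := by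
  refine (TC.hasSum_trace _).unique (((TC.hasSum_trace A).sub (TC.hasSum_trace B)).congr_fun ?_)
  intro s
  simp

theorem TC.trace_sum {ι : Type*} (F : Finset ι) (A : ι → TC (Hilb Q)) :
    TC.trace (∑ i ∈ F, A i) = ∑ i ∈ F, TC.trace (A i) := by
  refine (TC.hasSum_trace _).unique
    ((hasSum_sum fun i (_ : i ∈ F) => TC.hasSum_trace (A i)).congr_fun ?_)
  intro s
  simp

theorem eqsim_iff (V : Set Q) (Φ Ψ : CP (Hilb Q)) : Eqsim V Φ Ψ ↔
    ∀ ρ : TC (Hilb Q), IsDensity ρ → ptrace V (Φ.1 ρ) = ptrace V (Ψ.1 ρ) :=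
  ⟨fun h ρ hρ => le_antisymm (h.1 ρ hρ) (h.2 ρ hρ),
    fun h => ⟨fun ρ hρ => (h ρ hρ).le, fun ρ hρ => (h ρ hρ).ge⟩⟩

theorem IsDensity.nonneg {ρ : TC (Hilb Q)} (h : IsDensity ρ) : TC.Nonneg ρ := fun x =>
  h.1.inner_nonneg_right x

/-- Over no qubits the state space is one-dimensional, and the single entry of the partial trace is
the full trace. -/
theorem eqsim_empty_iff [Countable Q] (Φ Ψ : CP (Hilb Q)) : Eqsim ∅ Φ Ψ ↔
    ∀ ρ : TC (Hilb Q), IsDensity ρ → TC.trace (Φ.1 ρ) = TC.trace (Ψ.1 ρ) := by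
  rw [eqsim_iff]
  refine forall₂_congr fun ρ _ => ?_
  rw [← trace_ptrace ∅ (Φ.1 ρ), ← trace_ptrace ∅ (Ψ.1 ρ)]
  constructor
  · intro h
    congr 1
    exact Subtype.ext h
  · intro h
    refine clm_ext_inner_kets fun a b => ?_
    have hs : ∀ s : Finset (∅ : Set Q), s = ∅ := fun s =>
      Finset.eq_empty_of_forall_notMem fun x => absurd x.2 (Set.notMem_empty x.1)
    rw [TC.trace, TC.trace, tsum_eq_single ∅ fun s h => absurd (hs s) h,
      tsum_eq_single ∅ fun s h => absurd (hs s) h] at h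
    rw [hs a, hs b]
    exact h

set_option maxHeartbeats 2000000 in
-- `Y` is the reduced operator of `X`, placed back in the block of the all-zero outer state. Block
-- by block, moving a block there commutes with `G`. To sum over infinitely many blocks, positivity
-- and trace preservation take the place of continuity of `G`: the remainder after finitely many
-- blocks is positive, its image under `G` has the same trace, and that trace bounds all entries and
-- tends to `0`.
theorem inner_eq_of_commute_blocks [Countable Q] (r : P ↪ Q) (G : CPt Q)
    (hG : ∀ w A, G.1.1 (TC.sandwich (insR r ∅ ∘L (insR r w).adjoint)
      (insR r w ∘L (insR r ∅).adjoint) A) = TC.sandwich (insR r ∅ ∘L (insR r w).adjoint)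
      (insR r w ∘L (insR r ∅).adjoint) (G.1.1 A))
    {X : TC (Hilb Q)} (hX : TC.Nonneg X) {Y : TC (Hilb P)} (htrY : TC.trace Y = TC.trace X)
    (hY : ∀ x, HasSum (fun w => (inner ℂ (insR r w x) (X.1 (insR r w x)) : ℂ)) (inner ℂ x (Y.1 x)))
    (a b : Finset P) :
    HasSum (fun w => (inner ℂ (insR r w (kets P a)) ((G.1.1 X).1 (insR r w (kets P b))) : ℂ))
      (inner ℂ (insR r ∅ (kets P a))
        ((G.1.1 (TC.sandwich (insR r ∅) (insR r ∅).adjoint Y)).1 (insR r ∅ (kets P b)))) := by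
  classical
  let B := fun w => TC.sandwich (insR r w).adjoint (insR r w) X
  let D := TC.sandwich (insR r ∅) (insR r ∅).adjoint
  have hGD : ∀ w, G.1.1 (D (B w)) = TC.sandwich (insR r ∅ ∘L (insR r w).adjoint)
      (insR r w ∘L (insR r ∅).adjoint) (G.1.1 X) := by
    intro w
    rw [← hG]
    rfl
  have hterm : ∀ w, (inner ℂ (insR r ∅ (kets P a))
      ((G.1.1 (D (B w))).1 (insR r ∅ (kets P b))) : ℂ) =
      inner ℂ (insR r w (kets P a)) ((G.1.1 X).1 (insR r w (kets P b))) := by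
    intro w
    have h1 : ∀ z, (insR r ∅).adjoint (insR r ∅ z) = z := fun z =>
      DFunLike.congr_fun (insR_adjoint_comp_insR r ∅) z
    rw [hGD]
    simp only [TC.sandwich, LinearMap.coe_mk, AddHom.coe_mk, ContinuousLinearMap.comp_apply, h1]
    rw [← ContinuousLinearMap.adjoint_inner_left, h1, ContinuousLinearMap.adjoint_inner_right]
  -- Partial sums of the nonnegative diagonal expectations stay below their total.
  have hpos : ∀ F : Finset (Finset _), TC.Nonneg (Y - ∑ w ∈ F, B w) := by
    intro F x
    have h := sum_le_hasSum F (fun w _ => hX (insR r w x)) (hY x)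
    have h2 : (inner ℂ x ((Y - ∑ w ∈ F, B w).1 x) : ℂ) =
        inner ℂ x (Y.1 x) - ∑ w ∈ F, inner ℂ (insR r w x) (X.1 (insR r w x)) := by
      simp [B, TC.sandwich, ContinuousLinearMap.adjoint_inner_right]
    rw [h2]
    exact sub_nonneg.2 h
  have hGt : ∀ A, TC.trace (G.1.1 A) = TC.trace A := G.2
  -- The error is an entry of `G` applied to the positive remainder, hence at most its trace.
  have hbound : ∀ F : Finset (Finset _),
      ‖(∑ w ∈ F, (inner ℂ (insR r w (kets P a)) ((G.1.1 X).1 (insR r w (kets P b))) : ℂ)) -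
        inner ℂ (insR r ∅ (kets P a)) ((G.1.1 (D Y)).1 (insR r ∅ (kets P b)))‖ ≤
      ((TC.trace X) - ∑ w ∈ F, TC.trace (B w)).re := by
    intro F
    have h : TC.Nonneg (G.1.1 (D (Y - ∑ w ∈ F, B w))) :=
      G.1.2.nonneg ((hpos F).sandwich (insR r ∅))
    have htr : TC.trace (G.1.1 (D (Y - ∑ w ∈ F, B w))) =
        TC.trace X - ∑ w ∈ F, TC.trace (B w) := by
      rw [hGt, trace_sandwich_insR, TC.trace_sub, TC.trace_sum, htrY]
    rw [← htr]
    have hb : ∀ x y, x = kets Q (merge r a ∅) → y = kets Q (merge r b ∅) →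
        ‖(inner ℂ x ((G.1.1 (D (Y - ∑ w ∈ F, B w))).1 y) : ℂ)‖ ≤
          (TC.trace (G.1.1 (D (Y - ∑ w ∈ F, B w)))).re := by
      rintro _ _ rfl rfl
      exact h.norm_inner_kets_le _ _
    refine le_trans (le_of_eq ?_) (hb _ _ (insR_kets r ∅ a) (insR_kets r ∅ b))
    rw [norm_sub_rev, Finset.sum_congr rfl fun w _ => (hterm w).symm]
    have h3 : G.1.1 (TC.sandwich (insR r ∅) (insR r ∅).adjoint (Y - ∑ w ∈ F, B w)) =
        G.1.1 (D Y) - ∑ w ∈ F, G.1.1 (D (B w)) := by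
      rw [← map_sum, ← map_sum, ← map_sub, ← map_sub]
    rw [h3]
    simp only [Submodule.coe_sub, Submodule.coe_sum, _root_.sub_apply,
      _root_.sum_apply, inner_sub_right, inner_sum]
  rw [HasSum, tendsto_iff_norm_sub_tendsto_zero]
  refine squeeze_zero (fun _ => norm_nonneg _) hbound ?_
  have h0 := (tendsto_const_nhds (x := TC.trace X)).sub (hasSum_trace_blocks r X)
  rw [sub_self] at h0
  exact (Complex.continuous_re.tendsto 0).comp h0

/-- The right-hand side sees `X` only through its partial trace, so a local `G` induces a map on
reduced operators. -/
theorem LocalTo.inner_ptrace [DecidableEq Q] [Countable Q] {V : Set Q} {G : CPt Q}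
    (hG : LocalTo V G) {X : TC (Hilb Q)} (hX : TC.Nonneg X) (a b : Finset V) :
    (inner ℂ (kets V a) (ptrace V (G.1.1 X) (kets V b)) : ℂ) =
      inner ℂ (insR (Function.Embedding.subtype (· ∈ V)) ∅ (kets V a))
        ((G.1.1 (TC.sandwich (insR (Function.Embedding.subtype (· ∈ V)) ∅)
          (insR (Function.Embedding.subtype (· ∈ V)) ∅).adjoint
          ⟨ptrace V X, isTraceClass_ptrace V X⟩)).1
          (insR (Function.Embedding.subtype (· ∈ V)) ∅ (kets V b))) := by
  refine (hasSum_inner_ptrace V (G.1.1 X) (kets V a) (kets V b)).unique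
    (inner_eq_of_commute_blocks (Function.Embedding.subtype (· ∈ V)) G (fun w A => ?_) hX
      (trace_ptrace V X) (fun x => hasSum_inner_ptrace V X x x) a b)
  refine hG _ _ ?_ (offKets_insR w ∅) A
  rw [ContinuousLinearMap.adjoint_comp, ContinuousLinearMap.adjoint_adjoint]
  exact offKets_insR w ∅

theorem Eqsim.local_mul [DecidableEq Q] [Countable Q] {V : Set Q} {G : CPt Q}
    (hG : LocalTo V G) {E F : CPt Q} (h : Eqsim V E.1 F.1) : Eqsim V (G * E).1 (G * F).1 := by
  rw [eqsim_iff] at h ⊢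
  intro ρ hρ
  change ptrace V (G.1.1 (E.1.1 ρ)) = ptrace V (G.1.1 (F.1.1 ρ))
  refine clm_ext_inner_kets fun a b => ?_
  rw [hG.inner_ptrace (E.1.2.nonneg hρ.nonneg), hG.inner_ptrace (F.1.2.nonneg hρ.nonneg)]
  simp only [h ρ hρ]

end EqsimLocal

/-! ### Substitution, free variables and well-formedness. -/

namespace CExp
variable {σ : Sig} {X Y Z : Type}

theorem subst_subst (e : CExp σ X) (θ : X → CExp σ Y) (η : Y → CExp σ Z) :
    (e.subst θ).subst η = e.subst fun x => (θ x).subst η := by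
  induction e with
  | var x => rfl
  | const v => rfl
  | app f args ih => simp only [subst, ih]

theorem subst_congr {e : CExp σ X} {θ η : X → CExp σ Y} (h : ∀ x ∈ e.fv, θ x = η x) :
    e.subst θ = e.subst η := by
  induction e with
  | var x => exact h x rfl
  | const v => rfl
  | app f args ih =>
    simp only [subst]
    congr 1
    exact funext fun i => ih i fun x hx => h x (Set.mem_iUnion.2 ⟨i, hx⟩)

theorem subst_var (e : CExp σ X) : e.subst .var = e := by
  induction e with
  | var x => rfl
  | const v => rfl
  | app f args ih => simp only [subst, ih]

theorem eval_subst (e : CExp σ X) (θ : X → CExp σ Y) (ψ : Y → ℝ) :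
    (e.subst θ).eval ψ = e.eval fun x => (θ x).eval ψ := by
  induction e with
  | var x => rfl
  | const v => rfl
  | app f args ih => simp only [subst, eval, ih]

theorem exists_of_mem_fv_subst {e : CExp σ X} {θ : X → CExp σ Y} {y : Y}
    (h : y ∈ (e.subst θ).fv) : ∃ x ∈ e.fv, y ∈ (θ x).fv := by
  induction e with
  | var x => exact ⟨x, rfl, h⟩
  | const v => exact h.elim
  | app f args ih =>
    obtain ⟨i, hi⟩ := Set.mem_iUnion.1 h
    obtain ⟨x, hx, hy⟩ := ih i hi
    exact ⟨x, Set.mem_iUnion.2 ⟨i, hx⟩, hy⟩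

theorem finite_fv (e : CExp σ X) : e.fv.Finite := by
  induction e with
  | var x => exact Set.finite_singleton x
  | const v => exact Set.finite_empty
  | app f args ih => exact Set.finite_iUnion ih

end CExp

namespace BExp
variable {σ : Sig} {X Y Z : Type}

theorem subst_subst (b : BExp σ X) (θ : X → CExp σ Y) (η : Y → CExp σ Z) :
    (b.subst θ).subst η = b.subst fun x => (θ x).subst η := by
  induction b <;> simp_all only [subst, CExp.subst_subst]

theorem subst_congr {b : BExp σ X} {θ η : X → CExp σ Y} (h : ∀ x ∈ b.fv, θ x = η x) :
    b.subst θ = b.subst η := by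
  induction b with
  | tt => rfl
  | ff => rfl
  | cmp c e e' =>
    simp only [subst, CExp.subst_congr fun x hx => h x (Or.inl hx),
      CExp.subst_congr fun x hx => h x (Or.inr hx)]
  | pred p args =>
    simp only [subst]
    congr 1
    exact funext fun i => CExp.subst_congr fun x hx => h x (Set.mem_iUnion.2 ⟨i, hx⟩)
  | not b ih => simp only [subst, ih h]
  | and b b' ih ih' | or b b' ih ih' | imp b b' ih ih' =>
    simp only [subst, ih fun x hx => h x (Or.inl hx), ih' fun x hx => h x (Or.inr hx)]

theorem subst_var (b : BExp σ X) : b.subst .var = b := by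
  induction b <;> simp_all only [subst, CExp.subst_var]

theorem eval_subst (b : BExp σ X) (θ : X → CExp σ Y) (ψ : Y → ℝ) :
    (b.subst θ).eval ψ ↔ b.eval fun x => (θ x).eval ψ := by
  induction b <;> simp_all only [subst, eval, CExp.eval_subst]

theorem exists_of_mem_fv_subst {b : BExp σ X} {θ : X → CExp σ Y} {y : Y}
    (h : y ∈ (b.subst θ).fv) : ∃ x ∈ b.fv, y ∈ (θ x).fv := by
  induction b with
  | tt => exact h.elim
  | ff => exact h.elim
  | cmp c e e' =>
    rcases h with h | h
    · obtain ⟨x, hx, hy⟩ := CExp.exists_of_mem_fv_subst h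
      exact ⟨x, Or.inl hx, hy⟩
    · obtain ⟨x, hx, hy⟩ := CExp.exists_of_mem_fv_subst h
      exact ⟨x, Or.inr hx, hy⟩
  | pred p args =>
    obtain ⟨i, hi⟩ := Set.mem_iUnion.1 h
    obtain ⟨x, hx, hy⟩ := CExp.exists_of_mem_fv_subst hi
    exact ⟨x, Set.mem_iUnion.2 ⟨i, hx⟩, hy⟩
  | not b ih => exact ih h
  | and b b' ih ih' | or b b' ih ih' | imp b b' ih ih' =>
    rcases h with h | h
    · obtain ⟨x, hx, hy⟩ := ih h
      exact ⟨x, Or.inl hx, hy⟩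
    · obtain ⟨x, hx, hy⟩ := ih' h
      exact ⟨x, Or.inr hx, hy⟩

theorem finite_fv (b : BExp σ X) : b.fv.Finite := by
  induction b with
  | tt => exact Set.finite_empty
  | ff => exact Set.finite_empty
  | cmp c e e' => exact e.finite_fv.union e'.finite_fv
  | pred p args => exact Set.finite_iUnion fun i => (args i).finite_fv
  | not b ih => exact ih
  | and b b' ih ih' | or b b' ih ih' | imp b b' ih ih' => exact ih.union ih'

end BExp

namespace Term
variable {σ : Sig} {X Y Z Q R : Type}

theorem lift_subst_lift (θ : X → CExp σ Y) (η : Y → CExp σ Z) (x : Option X) :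
    (lift θ x).subst (lift η) = lift (fun x => (θ x).subst η) x := by
  cases x with
  | none => rfl
  | some x => simp only [lift, CExp.subst_subst, CExp.subst]

theorem lift_var : lift (.var : X → CExp σ X) = .var := by
  funext x
  cases x <;> rfl

theorem csubst_csubst (t : Term σ X Q) (θ : X → CExp σ Y) (η : Y → CExp σ Z) :
    (t.csubst θ).csubst η = t.csubst fun x => (θ x).subst η := by
  induction t generalizing Y Z <;>
    simp_all only [csubst, CExp.subst_subst, BExp.subst_subst, lift_subst_lift]

theorem csubst_var (t : Term σ X Q) : t.csubst .var = t := by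
  induction t <;> simp_all only [csubst, CExp.subst_var, BExp.subst_var, lift_var]

theorem lift_congr {S : Set (Option X)} {θ η : X → CExp σ Y}
    (h : ∀ x ∈ some ⁻¹' S, θ x = η x) : ∀ x ∈ S, lift θ x = lift η x := by
  intro x hx
  cases x with
  | none => rfl
  | some x => simp only [lift, h x hx]

theorem csubst_congr {t : Term σ X Q} {θ η : X → CExp σ Y} (h : ∀ x ∈ t.fv, θ x = η x) :
    t.csubst θ = t.csubst η := by
  induction t generalizing Y with
  | nil => rfl
  | con A e q =>
    simp only [csubst]
    congr 1
    exact funext fun i => CExp.subst_congr fun x hx => h x (Set.mem_iUnion.2 ⟨i, hx⟩)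
  | tau t ih | qin c t ih | qout c q t ih | oper n F q t ih | res t L ih | rel t fc fq ih =>
    simp only [csubst, ih h]
  | cin c t ih | meas n M q t ih => simp only [csubst, ih (lift_congr h)]
  | cout c e t ih =>
    simp only [csubst, CExp.subst_congr fun x hx => h x (Or.inl hx), ih fun x hx => h x (Or.inr hx)]
  | sum t u ih ih' | par t u ih ih' =>
    simp only [csubst, ih fun x hx => h x (Or.inl hx), ih' fun x hx => h x (Or.inr hx)]
  | guard b t ih =>
    simp only [csubst, BExp.subst_congr fun x hx => h x (Or.inl hx), ih fun x hx => h x (Or.inr hx)]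

theorem exists_of_mem_fv_lift {S : Set (Option X)} {θ : X → CExp σ Y} {y : Y}
    (h : ∃ x ∈ S, some y ∈ (lift θ x).fv) : ∃ x ∈ some ⁻¹' S, y ∈ (θ x).fv := by
  obtain ⟨x, hx, hy⟩ := h
  cases x with
  | none => cases hy
  | some x =>
    obtain ⟨z, hz, hzy⟩ := CExp.exists_of_mem_fv_subst hy
    cases hzy
    exact ⟨x, hx, hz⟩

theorem exists_of_mem_fv_csubst {t : Term σ X Q} {θ : X → CExp σ Y} {y : Y}
    (h : y ∈ (t.csubst θ).fv) : ∃ x ∈ t.fv, y ∈ (θ x).fv := by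
  induction t generalizing Y with
  | nil => exact h.elim
  | con A e q =>
    obtain ⟨i, hi⟩ := Set.mem_iUnion.1 h
    obtain ⟨x, hx, hy⟩ := CExp.exists_of_mem_fv_subst hi
    exact ⟨x, Set.mem_iUnion.2 ⟨i, hx⟩, hy⟩
  | tau t ih | qin c t ih | qout c q t ih | oper n F q t ih | res t L ih | rel t fc fq ih =>
    exact ih h
  | cin c t ih | meas n M q t ih => exact exists_of_mem_fv_lift (ih h)
  | cout c e t ih =>
    rcases h with h | h
    · obtain ⟨x, hx, hy⟩ := CExp.exists_of_mem_fv_subst h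
      exact ⟨x, Or.inl hx, hy⟩
    · obtain ⟨x, hx, hy⟩ := ih h
      exact ⟨x, Or.inr hx, hy⟩
  | sum t u ih ih' | par t u ih ih' =>
    rcases h with h | h
    · obtain ⟨x, hx, hy⟩ := ih h
      exact ⟨x, Or.inl hx, hy⟩
    · obtain ⟨x, hx, hy⟩ := ih' h
      exact ⟨x, Or.inr hx, hy⟩
  | guard b t ih =>
    rcases h with h | h
    · obtain ⟨x, hx, hy⟩ := BExp.exists_of_mem_fv_subst h
      exact ⟨x, Or.inl hx, hy⟩
    · obtain ⟨x, hx, hy⟩ := ih h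
      exact ⟨x, Or.inr hx, hy⟩

theorem finite_fv (t : Term σ X Q) : t.fv.Finite := by
  induction t with
  | nil => exact Set.finite_empty
  | con A e q => exact Set.finite_iUnion fun i => (e i).finite_fv
  | tau t ih | qin c t ih | qout c q t ih | oper n F q t ih | res t L ih | rel t fc fq ih =>
    exact ih
  | cin c t ih | meas n M q t ih => exact ih.preimage (Option.some_injective _).injOn
  | cout c e t ih => exact e.finite_fv.union ih
  | sum t u ih ih' | par t u ih ih' => exact ih.union ih'
  | guard b t ih => exact b.finite_fv.union ih

theorem qv_csubst (t : Term σ X Q) (θ : X → CExp σ Y) : (t.csubst θ).qv = t.qv := by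
  induction t generalizing Y <;> simp_all only [csubst, qv]

theorem wf_csubst {t : Term σ X Q} (h : t.WF) (θ : X → CExp σ Y) : (t.csubst θ).WF := by
  induction t generalizing Y <;> simp_all [csubst, WF, qv_csubst]

theorem csubst_qren (t : Term σ X Q) (f : Q → R) (θ : X → CExp σ Y) :
    (t.qren f).csubst θ = (t.csubst θ).qren f := by
  induction t generalizing Y R <;> simp_all only [csubst, qren]

theorem qv_qren_subset (t : Term σ X Q) (f : Q → R) : (t.qren f).qv ⊆ f '' t.qv := by
  induction t generalizing R with
  | nil => exact Set.empty_subset _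
  | con A e q => simp only [qren, qv, Set.range_comp]; exact subset_rfl
  | tau t ih | cin c t ih | cout c e t ih | res t L ih | rel t fc fq ih | guard b t ih => exact ih f
  | qin c t ih =>
    intro r hr
    obtain ⟨q, hq, hqr⟩ := ih (Option.map f) hr
    obtain ⟨q, rfl, rfl⟩ := Option.map_eq_some_iff.1 hqr
    exact ⟨q, hq, rfl⟩
  | qout c q t ih =>
    simp only [qren, qv, Set.image_insert_eq]
    exact Set.insert_subset_insert (ih f)
  | oper n F q t ih | meas n M q t ih =>
    simp only [qren, qv, Set.image_union, Set.range_comp]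
    exact Set.union_subset_union_left _ (ih f)
  | sum t u ih ih' | par t u ih ih' =>
    simp only [qren, qv, Set.image_union]
    exact Set.union_subset_union (ih f) (ih' f)

/-- Injectivity is needed only on the free qubits, where it keeps tuples repetition-free and
parallel components disjoint. This covers both unfolding a constant and receiving a fresh qubit. -/
theorem wf_qren {t : Term σ X Q} {f : Q → R} (hf : Set.InjOn f t.qv) (h : t.WF) :
    (t.qren f).WF := by
  have hcomp : ∀ {n : ℕ} {Q R : Type} {f : Q → R} {q : Fin n → Q}, Set.InjOn f (Set.range q) →
      Function.Injective q → Function.Injective (f ∘ q) := fun hf hq i j hij =>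
    hq (hf ⟨i, rfl⟩ ⟨j, rfl⟩ hij)
  induction t generalizing R with
  | nil => trivial
  | con A e q => exact hcomp hf h
  | tau t ih | cin c t ih | cout c e t ih | res t L ih | rel t fc fq ih | guard b t ih => exact ih hf h
  | qin c t ih =>
    refine ih ?_ h
    rintro (_ | q) hq (_ | q') hq' he
    · rfl
    · cases he
    · cases he
    · exact congrArg some (hf hq hq' (Option.some.inj he))
  | qout c q t ih =>
    refine ⟨fun hq => ?_, ih (hf.mono (Set.subset_insert _ _)) h.2⟩
    obtain ⟨q', hq', he⟩ := qv_qren_subset _ _ hq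
    rw [hf (Set.mem_insert_of_mem _ hq') (Set.mem_insert _ _) he] at hq'
    exact h.1 hq'
  | oper n F q t ih | meas n M q t ih =>
    exact ⟨hcomp (hf.mono Set.subset_union_right) h.1, ih (hf.mono Set.subset_union_left) h.2⟩
  | sum t u ih ih' =>
    exact ⟨ih (hf.mono Set.subset_union_left) h.1, ih' (hf.mono Set.subset_union_right) h.2⟩
  | par t u ih ih' =>
    refine ⟨Set.disjoint_left.2 fun r hr hr' => ?_, ih (hf.mono Set.subset_union_left) h.2.1,
      ih' (hf.mono Set.subset_union_right) h.2.2⟩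
    obtain ⟨q, hq, rfl⟩ := qv_qren_subset _ _ hr
    obtain ⟨q', hq', he⟩ := qv_qren_subset _ _ hr'
    rw [hf (Or.inr hq') (Or.inl hq) he] at hq'
    exact Set.disjoint_left.1 h.1 hq hq'

theorem qv_qinst_subset (t : Term σ X (Option Q)) (r : Q) :
    (t.qinst r).qv ⊆ some ⁻¹' t.qv ∪ {r} := by
  intro q hq
  obtain ⟨_ | q', hq', rfl⟩ := qv_qren_subset _ _ hq
  · exact Or.inr rfl
  · exact Or.inl hq'

theorem wf_qinst {t : Term σ X (Option Q)} {r : Q} (hr : some r ∉ t.qv) (h : t.WF) :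
    (t.qinst r).WF := by
  refine wf_qren ?_ h
  rintro (_ | q) hq (_ | q') hq' he
  · rfl
  · cases he
    exact absurd hq' hr
  · cases he
    exact absurd hq hr
  · exact congrArg some he

end Term

/-! ### Point distributions and supports. -/

section Distributions
variable {σ : Sig}

theorem eq_of_mem_support_point {S : Type 1} {s y : S} (h : y ∈ (point s).support) : y = s := by
  classical
  exact Finset.mem_singleton.1 (Finsupp.support_single_subset h)

theorem exists_of_mem_support_mapDomain {S T : Type 1} {f : S → T} {Δ : SDist S} {y : T}
    (h : y ∈ (Δ.mapDomain f).support) : ∃ x ∈ Δ.support, f x = y := by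
  classical
  exact Finset.mem_image.1 (Finsupp.mapDomain_support h)

theorem exists_of_mem_support_sum_single {ι : Type} [Fintype ι] {S : Type 1} {f : ι → S}
    {A : ι → CP (Hilb ℕ)} {y : S} (h : y ∈ (∑ i, Finsupp.single (f i) (A i)).support) :
    ∃ i, y = f i := by
  classical
  obtain ⟨i, -, hi⟩ := Finset.mem_biUnion.1 (Finsupp.support_finsetSum h)
  exact ⟨i, Finset.mem_singleton.1 (Finsupp.support_single_subset hi)⟩

theorem point_mapDomain {S T : Type 1} (f : S → T) (s : S) :
    (point s).mapDomain f = point (f s) := Finsupp.mapDomain_single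

theorem mapTerm_point (f : Term σ ℕ ℕ → Term σ ℕ ℕ) (t : Term σ ℕ ℕ) (E : CPt ℕ) :
    mapTerm f (point (t, E)) = point (f t, E) := point_mapDomain _ _

/-- A point distribution has weight `1`; it determines its state because `1 ≠ 0`. -/
instance : Nontrivial (CP (Hilb ℕ)) := by
  refine ⟨0, 1, fun h => ?_⟩
  have h1 := congrArg (fun Φ : CP (Hilb ℕ) =>
    (inner ℂ (kets ℕ ∅) ((Φ.1 (TC.rankOne (kets ℕ ∅) (kets ℕ ∅))).1 (kets ℕ ∅)) : ℂ)) h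
  simp [TC.rankOne, (kets ℕ).orthonormal.1 ∅] at h1

theorem point_injective {S : Type 1} {s s' : S} (h : point s = point s') : s = s' :=
  Finsupp.single_left_injective one_ne_zero h

end Distributions

/-! ### How transitions depend on qubits and on the accumulated super-operator. -/

section Transitions
variable {σ : Sig} {D : Env σ}

theorem Trans.of_eq {p : PreSnap σ} {b γ Δ Δ'} (h : Trans D p b γ Δ) (e : Δ = Δ') :
    Trans D p b γ Δ' := e ▸ h

theorem Trans.mem_qv_of_qout {p : PreSnap σ} {b γ Δ} (h : Trans D p b γ Δ) {c r}
    (hγ : γ = .qout c r) : r ∈ p.1.qv := by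
  induction h generalizing c with
  | tau | cin | cout | qin | oper | meas | cComL | cComR | qComL | qComR => cases hγ
  | qout => cases hγ; exact Set.mem_insert _ _
  | sumL t u E b γ Δ h ih | parL t u E b γ Δ h hq hc ih => exact Or.inl (ih hγ)
  | sumR t u E b γ Δ h ih | parR t u E b γ Δ h hq hc ih => exact Or.inr (ih hγ)
  | res t L E b γ Δ h hL ih => exact ih hγ
  | rel t fc fq E b γ Δ h ih =>
    cases γ <;> cases hγ
    exact ih rfl
  | guard b t E b' γ Δ h ih => exact ih hγ
  | con A e q E b γ Δ h ih =>
    obtain ⟨i, -, hi⟩ := Term.qv_qren_subset _ _ (ih hγ)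
    exact ⟨i, hi⟩

theorem Act.qbv_relabel (γ : Act σ) (fc fq) : (γ.relabel fc fq).qbv = γ.qbv := by
  cases γ <;> rfl

/-- Only an input brings in a new qubit. In a communication the received qubit was already free in
the sender, by `Trans.mem_qv_of_qout`. -/
theorem Trans.qv_subset {p : PreSnap σ} {b γ Δ} (h : Trans D p b γ Δ) :
    ∀ y ∈ Δ.support, y.1.qv ⊆ p.1.qv ∪ γ.qbv := by
  induction h with
  | tau t E | cout c e t E =>
    intro y hy
    rw [eq_of_mem_support_point hy]
    exact Set.subset_union_left
  | cin c t x hx E =>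
    intro y hy
    rw [eq_of_mem_support_point hy]
    exact (Term.qv_csubst _ _).le.trans Set.subset_union_left
  | qin c t r hr E =>
    intro y hy
    rw [eq_of_mem_support_point hy]
    exact Term.qv_qinst_subset t r
  | qout c r t E =>
    intro y hy
    rw [eq_of_mem_support_point hy]
    exact (Set.subset_insert _ _).trans Set.subset_union_left
  | oper n F r t E =>
    intro y hy
    rw [eq_of_mem_support_point hy]
    exact Set.subset_union_left.trans Set.subset_union_left
  | meas n M r t E l φ hM =>
    intro y hy
    obtain ⟨i, rfl⟩ := exists_of_mem_support_sum_single hy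
    exact (Term.qv_csubst _ _).le.trans (Set.subset_union_left.trans Set.subset_union_left)
  | sumL t u E b γ Δ h ih =>
    exact fun y hy => (ih y hy).trans (Set.union_subset_union_left _ Set.subset_union_left)
  | sumR t u E b γ Δ h ih =>
    exact fun y hy => (ih y hy).trans (Set.union_subset_union_left _ Set.subset_union_right)
  | parL t u E b γ Δ h hq hc ih =>
    intro y hy
    obtain ⟨x, hx, rfl⟩ := exists_of_mem_support_mapDomain hy
    refine Set.union_subset ?_ (Set.subset_union_right.trans Set.subset_union_left)
    exact (ih x hx).trans (Set.union_subset_union_left _ Set.subset_union_left)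
  | parR t u E b γ Δ h hq hc ih =>
    intro y hy
    obtain ⟨x, hx, rfl⟩ := exists_of_mem_support_mapDomain hy
    refine Set.union_subset (Set.subset_union_left.trans Set.subset_union_left) ?_
    exact (ih x hx).trans (Set.union_subset_union_left _ Set.subset_union_right)
  | cComL t u t' u' E b₁ b₂ c x e h₁ h₂ ih₁ ih₂ =>
    intro y hy
    rw [eq_of_mem_support_point hy]
    have h1 := ih₁ (t', E) (by simp [point])
    have h2 := ih₂ (u', E) (by simp [point])
    simp only [Act.qbv, Set.union_empty] at h1 h2 ⊢
    exact Set.union_subset_union ((Term.qv_csubst _ _).le.trans h1) h2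
  | cComR t u t' u' E b₁ b₂ c x e h₁ h₂ ih₁ ih₂ =>
    intro y hy
    rw [eq_of_mem_support_point hy]
    have h1 := ih₁ (t', E) (by simp [point])
    have h2 := ih₂ (u', E) (by simp [point])
    simp only [Act.qbv, Set.union_empty] at h1 h2 ⊢
    exact Set.union_subset_union h1 ((Term.qv_csubst _ _).le.trans h2)
  | qComL t u t' u' E b₁ b₂ c r h₁ h₂ ih₁ ih₂ =>
    intro y hy
    rw [eq_of_mem_support_point hy]
    have h1 := ih₁ (t', E) (by simp [point])
    have h2 := ih₂ (u', E) (by simp [point])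
    have h3 := h₂.mem_qv_of_qout rfl
    simp only [Act.qbv, Set.union_empty] at h1 h2 ⊢
    refine Set.union_subset (h1.trans ?_) (h2.trans Set.subset_union_right)
    exact Set.union_subset_union_right _ (Set.singleton_subset_iff.2 h3)
  | qComR t u t' u' E b₁ b₂ c r h₁ h₂ ih₁ ih₂ =>
    intro y hy
    rw [eq_of_mem_support_point hy]
    have h1 := ih₁ (t', E) (by simp [point])
    have h2 := ih₂ (u', E) (by simp [point])
    have h3 := h₁.mem_qv_of_qout rfl
    simp only [Act.qbv, Set.union_empty] at h1 h2 ⊢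
    refine Set.union_subset (h1.trans Set.subset_union_left) (h2.trans ?_)
    exact Set.union_subset Set.subset_union_right
      (Set.singleton_subset_iff.2 (Set.mem_union_left _ h3))
  | res t L E b γ Δ h hL ih =>
    intro y hy
    obtain ⟨x, hx, rfl⟩ := exists_of_mem_support_mapDomain hy
    exact ih x hx
  | rel t fc fq E b γ Δ h ih =>
    intro y hy
    obtain ⟨x, hx, rfl⟩ := exists_of_mem_support_mapDomain hy
    rw [Act.qbv_relabel]
    exact ih x hx
  | guard b t E b' γ Δ h ih => exact ih
  | con A e q E b γ Δ h ih =>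
    refine fun y hy => (ih y hy).trans (Set.union_subset_union_left _ ?_)
    exact (Term.qv_qren_subset _ _).trans (Set.image_subset_range _ _)

/-- The clause on outputs is needed for the induction: after a quantum communication the receiver
owns `r`, and the components stay disjoint only because the sender has given `r` up. -/
theorem Trans.wf {p : PreSnap σ} {b γ Δ} (h : Trans D p b γ Δ) (hp : p.1.WF) :
    ∀ y ∈ Δ.support, y.1.WF ∧ ∀ c r, γ = .qout c r → r ∉ y.1.qv := by
  induction h with
  | tau t E | cout c e t E =>
    intro y hy
    rw [eq_of_mem_support_point hy]
    exact ⟨hp, by simp⟩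
  | cin c t x hx E =>
    intro y hy
    rw [eq_of_mem_support_point hy]
    exact ⟨Term.wf_csubst (t := t) hp _, by simp⟩
  | qin c t r hr E =>
    intro y hy
    rw [eq_of_mem_support_point hy]
    exact ⟨Term.wf_qinst hr hp, by simp⟩
  | qout c r t E =>
    intro y hy
    rw [eq_of_mem_support_point hy]
    refine ⟨hp.2, fun c' r' h => ?_⟩
    cases h
    exact hp.1
  | oper n F r t E =>
    intro y hy
    rw [eq_of_mem_support_point hy]
    exact ⟨hp.2, by simp⟩
  | meas n M r t E l φ hM =>
    intro y hy
    obtain ⟨i, rfl⟩ := exists_of_mem_support_sum_single hy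
    exact ⟨Term.wf_csubst (t := t) hp.2 _, by simp⟩
  | sumL t u E b γ Δ h ih => exact ih hp.1
  | sumR t u E b γ Δ h ih => exact ih hp.2
  | parL t u E b γ Δ h hq hc ih =>
    intro y hy
    obtain ⟨x, hx, rfl⟩ := exists_of_mem_support_mapDomain hy
    have h1 := ih hp.2.1 x hx
    refine ⟨⟨Set.disjoint_of_subset_left (h.qv_subset x hx) (Set.disjoint_union_left.2 ⟨hp.1, hq⟩),
      h1.1, hp.2.2⟩, fun c r hγ hr => ?_⟩
    rcases hr with hr | hr
    · exact h1.2 c r hγ hr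
    · exact Set.disjoint_left.1 hp.1 (h.mem_qv_of_qout hγ) hr
  | parR t u E b γ Δ h hq hc ih =>
    intro y hy
    obtain ⟨x, hx, rfl⟩ := exists_of_mem_support_mapDomain hy
    have h1 := ih hp.2.2 x hx
    refine ⟨⟨Set.disjoint_of_subset_right (h.qv_subset x hx)
      (Set.disjoint_union_right.2 ⟨hp.1, hq.symm⟩), hp.2.1, h1.1⟩, fun c r hγ hr => ?_⟩
    rcases hr with hr | hr
    · exact Set.disjoint_right.1 hp.1 (h.mem_qv_of_qout hγ) hr
    · exact h1.2 c r hγ hr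
  | cComL t u t' u' E b₁ b₂ c x e h₁ h₂ ih₁ ih₂ =>
    intro y hy
    rw [eq_of_mem_support_point hy]
    have h1 := h₁.qv_subset (t', E) (by simp [point])
    have h2 := h₂.qv_subset (u', E) (by simp [point])
    simp only [Act.qbv, Set.union_empty] at h1 h2
    refine ⟨⟨?_, Term.wf_csubst (ih₁ hp.2.1 (t', E) (by simp [point])).1 _,
      (ih₂ hp.2.2 (u', E) (by simp [point])).1⟩, by simp⟩
    rw [Term.qv_csubst]
    exact Set.disjoint_of_subset h1 h2 hp.1
  | cComR t u t' u' E b₁ b₂ c x e h₁ h₂ ih₁ ih₂ =>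
    intro y hy
    rw [eq_of_mem_support_point hy]
    have h1 := h₁.qv_subset (t', E) (by simp [point])
    have h2 := h₂.qv_subset (u', E) (by simp [point])
    simp only [Act.qbv, Set.union_empty] at h1 h2
    refine ⟨⟨?_, (ih₁ hp.2.1 (t', E) (by simp [point])).1,
      Term.wf_csubst (ih₂ hp.2.2 (u', E) (by simp [point])).1 _⟩, by simp⟩
    rw [Term.qv_csubst]
    exact Set.disjoint_of_subset h1 h2 hp.1
  | qComL t u t' u' E b₁ b₂ c r h₁ h₂ ih₁ ih₂ =>
    intro y hy
    rw [eq_of_mem_support_point hy]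
    have h1 := h₁.qv_subset (t', E) (by simp [point])
    have h2 := h₂.qv_subset (u', E) (by simp [point])
    have w1 := ih₁ hp.2.1 (t', E) (by simp [point])
    have w2 := ih₂ hp.2.2 (u', E) (by simp [point])
    simp only [Act.qbv, Set.union_empty] at h1 h2
    refine ⟨⟨Set.disjoint_of_subset_left h1 (Set.disjoint_union_left.2
      ⟨Set.disjoint_of_subset_right h2 hp.1, Set.disjoint_singleton_left.2 (w2.2 c r rfl)⟩),
      w1.1, w2.1⟩, by simp⟩
  | qComR t u t' u' E b₁ b₂ c r h₁ h₂ ih₁ ih₂ =>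
    intro y hy
    rw [eq_of_mem_support_point hy]
    have h1 := h₁.qv_subset (t', E) (by simp [point])
    have h2 := h₂.qv_subset (u', E) (by simp [point])
    have w1 := ih₁ hp.2.1 (t', E) (by simp [point])
    have w2 := ih₂ hp.2.2 (u', E) (by simp [point])
    simp only [Act.qbv, Set.union_empty] at h1 h2
    refine ⟨⟨Set.disjoint_of_subset_right h2 (Set.disjoint_union_right.2
      ⟨Set.disjoint_of_subset_left h1 hp.1, Set.disjoint_singleton_right.2 (w1.2 c r rfl)⟩),
      w1.1, w2.1⟩, by simp⟩
  | res t L E b γ Δ h hL ih =>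
    intro y hy
    obtain ⟨x, hx, rfl⟩ := exists_of_mem_support_mapDomain hy
    exact ih hp x hx
  | rel t fc fq E b γ Δ h ih =>
    intro y hy
    obtain ⟨x, hx, rfl⟩ := exists_of_mem_support_mapDomain hy
    refine ⟨(ih hp x hx).1, fun c r hγ => ?_⟩
    cases γ <;> cases hγ
    exact (ih hp x hx).2 _ _ rfl
  | guard b t E b' γ Δ h ih => exact ih hp
  | con A e q E b γ Δ h ih => exact ih (Term.wf_qren hp.injOn (Term.wf_csubst (D.wf A) _))

set_option maxHeartbeats 2000000 in
-- Visible actions come from prefixes that leave the super-operator alone. The communication rules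
-- have such transitions as premises, which must be replayed at an arbitrary `E`.
theorem Trans.visible {p : PreSnap σ} {b γ Δ} (h : Trans D p b γ Δ) (hγ : γ ≠ .tau) :
    ∃ t', Δ = point (t', p.2) ∧ ∀ E, Trans D (p.1, E) b γ (point (t', E)) := by
  induction h with
  | tau | oper | meas | cComL | cComR | qComL | qComR => exact absurd rfl hγ
  | cin c t x hx E => exact ⟨_, rfl, fun E => .cin c t x hx E⟩
  | cout c e t E => exact ⟨_, rfl, fun E => .cout c e t E⟩
  | qin c t r hr E => exact ⟨_, rfl, fun E => .qin c t r hr E⟩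
  | qout c r t E => exact ⟨_, rfl, fun E => .qout c r t E⟩
  | sumL t u E b γ Δ h ih =>
    obtain ⟨t', rfl, h'⟩ := ih hγ
    exact ⟨t', rfl, fun E => .sumL t u E b γ _ (h' E)⟩
  | sumR t u E b γ Δ h ih =>
    obtain ⟨t', rfl, h'⟩ := ih hγ
    exact ⟨t', rfl, fun E => .sumR t u E b γ _ (h' E)⟩
  | parL t u E b γ Δ h hq hc ih =>
    obtain ⟨t', rfl, h'⟩ := ih hγ
    exact ⟨.par t' u, mapTerm_point _ _ _, fun E => (Trans.parL t u E b γ _ (h' E) hq hc).of_eq (mapTerm_point _ _ _)⟩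
  | parR t u E b γ Δ h hq hc ih =>
    obtain ⟨t', rfl, h'⟩ := ih hγ
    exact ⟨.par t t', mapTerm_point _ _ _, fun E => (Trans.parR t u E b γ _ (h' E) hq hc).of_eq (mapTerm_point _ _ _)⟩
  | res t L E b γ Δ h hL ih =>
    obtain ⟨t', rfl, h'⟩ := ih hγ
    exact ⟨.res t' L, mapTerm_point _ _ _, fun E => (Trans.res t L E b γ _ (h' E) hL).of_eq (mapTerm_point _ _ _)⟩
  | rel t fc fq E b γ Δ h ih =>
    obtain ⟨t', rfl, h'⟩ := ih (by rintro rfl; exact hγ rfl)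
    exact ⟨.rel t' fc fq, mapTerm_point _ _ _, fun E => (Trans.rel t fc fq E b γ _ (h' E)).of_eq (mapTerm_point _ _ _)⟩
  | guard b t E b' γ Δ h ih =>
    obtain ⟨t', rfl, h'⟩ := ih hγ
    exact ⟨t', rfl, fun E => .guard b t E b' γ _ (h' E)⟩
  | con A e q E b γ Δ h ih =>
    obtain ⟨t', rfl, h'⟩ := ih hγ
    exact ⟨t', rfl, fun E => .con A e q E b γ _ (h' E)⟩

theorem Trans.point_of_visible {t t' : Term σ ℕ ℕ} {E : CPt ℕ} {b γ}
    (h : Trans D (t, E) b γ (point (t', E))) (hγ : γ ≠ .tau) (E' : CPt ℕ) :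
    Trans D (t, E') b γ (point (t', E')) := by
  obtain ⟨t'', h1, h2⟩ := h.visible hγ
  cases point_injective h1
  exact h2 E'

/-- The distribution `Δ` with all super-operators in its states applied after `E`. -/
noncomputable def precompose (E : CPt ℕ) (Δ : SDist (PreSnap σ)) : SDist (PreSnap σ) :=
  Δ.mapDomain fun y => (y.1, y.2 * E)

theorem precompose_point (E : CPt ℕ) (t : Term σ ℕ ℕ) (H : CPt ℕ) :
    precompose E (point (t, H)) = point (t, H * E) := point_mapDomain _ _

theorem precompose_mapTerm (E : CPt ℕ) (f : Term σ ℕ ℕ → Term σ ℕ ℕ) (Δ : SDist (PreSnap σ)) :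
    precompose E (mapTerm f Δ) = mapTerm f (precompose E Δ) := by
  simp only [precompose, mapTerm, ← Finsupp.mapDomain_comp]
  rfl

/-- All super-operators in `δ` commute with those that act only outside the qubits in `W`. -/
def CommutesOff (W : Set ℕ) (δ : SDist (PreSnap σ)) : Prop :=
  ∀ G : CPt ℕ, LocalTo Wᶜ G → ∀ y ∈ δ.support, Commute (δ y) G.1 ∧ Commute y.2 G

theorem CommutesOff.mono {W W' : Set ℕ} (h : W ⊆ W') {δ : SDist (PreSnap σ)}
    (hδ : CommutesOff W δ) : CommutesOff W' δ :=
  fun G hG => hδ G (hG.mono (Set.compl_subset_compl.2 h))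

/-- A map on terms may merge states, so a new weight is a sum of old ones, each of which commutes.
-/
theorem CommutesOff.mapTerm {W : Set ℕ} {δ : SDist (PreSnap σ)} (hδ : CommutesOff W δ)
    (f : Term σ ℕ ℕ → Term σ ℕ ℕ) : CommutesOff W (mapTerm f δ) := by
  classical
  intro G hG y hy
  obtain ⟨x, hx, rfl⟩ := exists_of_mem_support_mapDomain hy
  refine ⟨?_, (hδ G hG x hx).2⟩
  rw [QCCS.mapTerm, Finsupp.mapDomain, Finsupp.sum_apply]
  refine Commute.sum_left _ _ _ fun z hz => ?_
  dsimp only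
  rw [Finsupp.single_apply]
  split
  · exact (hδ G hG z hz).1
  · exact Commute.zero_left _

theorem CommutesOff.point {W : Set ℕ} {t : Term σ ℕ ℕ} {H : CPt ℕ}
    (h : ∀ G : CPt ℕ, LocalTo Wᶜ G → Commute H G) : CommutesOff W (point (t, H)) := by
  intro G hG y hy
  obtain rfl := eq_of_mem_support_point hy
  refine ⟨?_, h G hG⟩
  simp [QCCS.point]

theorem LocalTo.commute_liftAt_cpt {P : Type} [Fintype P] {V : Set ℕ} {G : CPt ℕ}
    (hG : LocalTo V G) (r : P ↪ ℕ) (hV : Disjoint V (Set.range r)) (Φ : CPt P) :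
    Commute (CPt.liftAt r Φ) G :=
  Subtype.ext (hG.commute_liftAt r hV Φ.1)

set_option maxHeartbeats 2000000 in
-- The kernel is what the transition does starting from the identity. Nontrivial super-operators
-- enter only through operations and measurements, which act on tuples contained in the free qubits
-- and so commute with anything local to the complement.
theorem Trans.exists_kernel {p : PreSnap σ} {b γ Δ} (h : Trans D p b γ Δ) :
    ∃ δ, Δ = precompose p.2 δ ∧ (∀ E, Trans D (p.1, E) b γ (precompose E δ)) ∧
      CommutesOff p.1.qv δ := by
  -- Transitions that leave the super-operator unchanged have the identity as kernel.
  have hpt : ∀ {t t' : Term σ ℕ ℕ} {E : CPt ℕ} {b γ}, (∀ E, Trans D (t, E) b γ (point (t', E))) →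
      ∃ δ, point (t', E) = precompose E δ ∧ (∀ E, Trans D (t, E) b γ (precompose E δ)) ∧
      CommutesOff t.qv δ := by
    intro t t' E b γ h
    have key : ∀ E : CPt ℕ, precompose E (point (t', 1)) = point (t', E) := fun E =>
      (precompose_point E t' 1).trans (congrArg (fun H => point (t', H)) (one_mul E))
    exact ⟨point (t', 1), (key E).symm, fun E' => (h E').of_eq (key E').symm,
      .point fun G _ => .one_left G⟩
  induction h with
  | tau t E => exact hpt fun E => .tau t E
  | cin c t x hx E => exact hpt fun E => .cin c t x hx E
  | cout c e t E => exact hpt fun E => .cout c e t E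
  | qin c t r hr E => exact hpt fun E => .qin c t r hr E
  | qout c r t E => exact hpt fun E => .qout c r t E
  | cComL t u t' u' E b₁ b₂ c x e h₁ h₂ =>
    exact hpt fun E' => .cComL t u t' u' E' b₁ b₂ c x e (h₁.point_of_visible (by simp) E')
      (h₂.point_of_visible (by simp) E')
  | cComR t u t' u' E b₁ b₂ c x e h₁ h₂ =>
    exact hpt fun E' => .cComR t u t' u' E' b₁ b₂ c x e (h₁.point_of_visible (by simp) E')
      (h₂.point_of_visible (by simp) E')
  | qComL t u t' u' E b₁ b₂ c r h₁ h₂ =>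
    exact hpt fun E' => .qComL t u t' u' E' b₁ b₂ c r (h₁.point_of_visible (by simp) E')
      (h₂.point_of_visible (by simp) E')
  | qComR t u t' u' E b₁ b₂ c r h₁ h₂ =>
    exact hpt fun E' => .qComR t u t' u' E' b₁ b₂ c r (h₁.point_of_visible (by simp) E')
      (h₂.point_of_visible (by simp) E')
  | oper n F r t E =>
    refine ⟨point (t, CPt.liftAt r F), (precompose_point _ _ _).symm,
      fun E' => (Trans.oper n F r t E').of_eq (precompose_point _ _ _).symm,
      .point fun G hG => hG.commute_liftAt_cpt r ?_ F⟩
    exact Set.disjoint_compl_left_iff_subset.2 Set.subset_union_right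
  | meas n M r t E l φ hM =>
    have key : ∀ E' : CPt ℕ, precompose E' (∑ i, Finsupp.single
        (t.cinst (.const (l i)), CPt.liftAt r (setTo φ i)) (CP.liftAt r (projAt φ i))) =
        ∑ i, Finsupp.single (t.cinst (.const (l i)), CPt.liftAt r (setTo φ i) * E')
          (CP.liftAt r (projAt φ i)) := by
      intro E'
      rw [precompose, Finsupp.mapDomain_finsetSum]
      simp only [Finsupp.mapDomain_single]
    refine ⟨_, (key E).symm, fun E' => (Trans.meas n M r t E' l φ hM).of_eq (key E').symm, ?_⟩
    · intro G hG y hy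
      have hd : Disjoint (Term.meas n M r t).qvᶜ (Set.range r) :=
        Set.disjoint_compl_left_iff_subset.2 Set.subset_union_right
      obtain ⟨i, rfl⟩ := exists_of_mem_support_sum_single hy
      refine ⟨?_, hG.commute_liftAt_cpt r hd _⟩
      classical
      rw [Finsupp.finsetSum_apply]
      refine Commute.sum_left _ _ _ fun j _ => ?_
      rw [Finsupp.single_apply]
      split
      · exact hG.commute_liftAt r hd _
      · exact Commute.zero_left _
  | sumL t u E b γ Δ h ih =>
    obtain ⟨δ, rfl, h1, h2⟩ := ih
    exact ⟨δ, rfl, fun E => .sumL t u E b γ _ (h1 E), h2.mono Set.subset_union_left⟩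
  | sumR t u E b γ Δ h ih =>
    obtain ⟨δ, rfl, h1, h2⟩ := ih
    exact ⟨δ, rfl, fun E => .sumR t u E b γ _ (h1 E), h2.mono Set.subset_union_right⟩
  | parL t u E b γ Δ h hq hc ih =>
    obtain ⟨δ, rfl, h1, h2⟩ := ih
    exact ⟨mapTerm (fun t' => .par t' u) δ, (precompose_mapTerm _ _ _).symm, fun E =>
      (Trans.parL t u E b γ _ (h1 E) hq hc).of_eq (precompose_mapTerm _ _ _).symm, (h2.mapTerm _).mono Set.subset_union_left⟩
  | parR t u E b γ Δ h hq hc ih =>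
    obtain ⟨δ, rfl, h1, h2⟩ := ih
    exact ⟨mapTerm (fun u' => .par t u') δ, (precompose_mapTerm _ _ _).symm, fun E =>
      (Trans.parR t u E b γ _ (h1 E) hq hc).of_eq (precompose_mapTerm _ _ _).symm, (h2.mapTerm _).mono Set.subset_union_right⟩
  | res t L E b γ Δ h hL ih =>
    obtain ⟨δ, rfl, h1, h2⟩ := ih
    exact ⟨mapTerm (fun t' => .res t' L) δ, (precompose_mapTerm _ _ _).symm, fun E =>
      (Trans.res t L E b γ _ (h1 E) hL).of_eq (precompose_mapTerm _ _ _).symm, h2.mapTerm _⟩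
  | rel t fc fq E b γ Δ h ih =>
    obtain ⟨δ, rfl, h1, h2⟩ := ih
    exact ⟨mapTerm (fun t' => .rel t' fc fq) δ, (precompose_mapTerm _ _ _).symm, fun E =>
      (Trans.rel t fc fq E b γ _ (h1 E)).of_eq (precompose_mapTerm _ _ _).symm, h2.mapTerm _⟩
  | guard b t E b' γ Δ h ih =>
    obtain ⟨δ, rfl, h1, h2⟩ := ih
    exact ⟨δ, rfl, fun E => .guard b t E b' γ _ (h1 E), h2⟩
  | con A e q E b γ Δ h ih =>
    obtain ⟨δ, rfl, h1, h2⟩ := ih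
    exact ⟨δ, rfl, fun E => .con A e q E b γ _ (h1 E),
      h2.mono ((Term.qv_qren_subset _ _).trans (Set.image_subset_range _ _))⟩

end Transitions

/-! ### Equivariance of transitions under permutations of classical variables. -/

section Renaming
variable {σ : Sig} {D : Env σ}

/-- Renaming of the free classical variables by a permutation. -/
def Term.rename (π : Equiv.Perm ℕ) (t : Term σ ℕ ℕ) : Term σ ℕ ℕ := t.csubst fun x => .var (π x)

/-- Renaming of the variables by a permutation. -/
def BExp.rename (π : Equiv.Perm ℕ) (b : BExp σ ℕ) : BExp σ ℕ := b.subst fun x => .var (π x)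

/-- Renaming of the classical variables by a permutation. -/
def Act.rename (π : Equiv.Perm ℕ) : Act σ → Act σ
  | tau => tau
  | cin c x => cin c (π x)
  | cout c e => cout c (e.subst fun x => .var (π x))
  | qin c r => qin c r
  | qout c r => qout c r

theorem Term.rename_rename (π τ : Equiv.Perm ℕ) (t : Term σ ℕ ℕ) :
    (t.rename π).rename τ = t.rename (π.trans τ) := csubst_csubst _ _ _

theorem Term.rename_eq_self {π : Equiv.Perm ℕ} {t : Term σ ℕ ℕ} (h : ∀ x ∈ t.fv, π x = x) :
    t.rename π = t :=
  (csubst_congr fun x hx => by rw [h x hx]).trans t.csubst_var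

theorem BExp.rename_rename (π τ : Equiv.Perm ℕ) (b : BExp σ ℕ) :
    (b.rename π).rename τ = b.rename (π.trans τ) := subst_subst _ _ _

theorem BExp.rename_eq_self {π : Equiv.Perm ℕ} {b : BExp σ ℕ} (h : ∀ x ∈ b.fv, π x = x) :
    b.rename π = b :=
  (subst_congr fun x hx => by rw [h x hx]).trans b.subst_var

theorem BExp.eval_rename (π : Equiv.Perm ℕ) (b : BExp σ ℕ) (ψ : ℕ → ℝ) :
    (b.rename π).eval ψ ↔ b.eval (ψ ∘ π) := eval_subst _ _ _

theorem BExp.Implies.rename {b b' : BExp σ ℕ} (h : b.Implies b') (π : Equiv.Perm ℕ) :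
    (b.rename π).Implies (b'.rename π) := fun ψ hψ =>
  (eval_rename π b' ψ).2 (h _ ((eval_rename π b ψ).1 hψ))

theorem Act.rename_rename (π τ : Equiv.Perm ℕ) (γ : Act σ) :
    (γ.rename π).rename τ = γ.rename (π.trans τ) := by
  cases γ <;> simp [rename, CExp.subst_subst, CExp.subst]

theorem Act.rename_refl (γ : Act σ) : γ.rename (Equiv.refl ℕ) = γ := by
  cases γ with
  | cout c e => exact congrArg (cout c) e.subst_var
  | _ => rfl

theorem Act.bv_rename (π : Equiv.Perm ℕ) (γ : Act σ) : (γ.rename π).bv = π '' γ.bv := by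
  cases γ <;> simp [rename, bv]

theorem Act.qbv_rename (π : Equiv.Perm ℕ) (γ : Act σ) : (γ.rename π).qbv = γ.qbv := by
  cases γ <;> rfl

theorem Act.cn_rename (π : Equiv.Perm ℕ) (γ : Act σ) : (γ.rename π).cn = γ.cn := by
  cases γ <;> rfl

theorem Act.relabel_rename (π : Equiv.Perm ℕ) (γ : Act σ) (fc fq) :
    (γ.relabel fc fq).rename π = (γ.rename π).relabel fc fq := by
  cases γ <;> rfl

theorem Act.EqUnder.rename {b : BExp σ ℕ} {γ γ' : Act σ} (h : γ.EqUnder b γ')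
    (π : Equiv.Perm ℕ) : (γ.rename π).EqUnder (b.rename π) (γ'.rename π) := by
  cases γ <;> cases γ' <;> first
    | exact ⟨h.1, h.2.rename π⟩
    | exact congrArg (Act.rename π) h

theorem Term.fv_rename_subset (π : Equiv.Perm ℕ) (t : Term σ ℕ ℕ) :
    (t.rename π).fv ⊆ π '' t.fv := by
  intro y hy
  obtain ⟨x, hx, hy⟩ := exists_of_mem_fv_csubst hy
  exact ⟨x, hx, hy.symm⟩

theorem Act.disjoint_bv_rename {γ : Act σ} {t : Term σ ℕ ℕ} (h : Disjoint γ.bv t.fv)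
    (π : Equiv.Perm ℕ) : Disjoint (γ.rename π).bv (t.rename π).fv := by
  rw [bv_rename]
  exact Set.disjoint_of_subset_right (t.fv_rename_subset π)
    ((Set.disjoint_image_iff π.injective).2 h)

theorem Term.csubst_cinst {X Y Q : Type} (t : Term σ (Option X) Q) (e : CExp σ X)
    (θ : X → CExp σ Y) :
    (t.cinst e).csubst θ = (t.csubst (lift θ)).cinst (e.subst θ) := by
  simp only [cinst, csubst_csubst]
  congr 1
  funext x
  cases x with
  | none => rfl
  | some x =>
    simp only [lift, CExp.subst_subst]
    exact (CExp.subst_var _).symm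

theorem Term.rename_update (π : Equiv.Perm ℕ) (t : Term σ ℕ ℕ) (x : ℕ) (e : CExp σ ℕ) :
    (t.csubst (Function.update .var x e)).rename π =
      (t.rename π).csubst (Function.update .var (π x) (e.subst fun x => .var (π x))) := by
  simp only [rename, csubst_csubst]
  congr 1
  funext y
  by_cases h : y = x
  · subst h
    simp [CExp.subst]
  · simp [CExp.subst, h]

theorem mapTerm_mapTerm (f g : Term σ ℕ ℕ → Term σ ℕ ℕ) (Δ : SDist (PreSnap σ)) :
    mapTerm f (mapTerm g Δ) = mapTerm (fun t => f (g t)) Δ := by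
  simp only [mapTerm, ← Finsupp.mapDomain_comp]
  rfl

set_option maxHeartbeats 800000 in
-- A permutation, unlike a general substitution, respects the freshness conditions of input and
-- parallel composition. The communication rules need that renaming commutes with substituting the
-- received value, which is `Term.rename_update`.
theorem Trans.rename {p : PreSnap σ} {b γ Δ} (h : Trans D p b γ Δ) (π : Equiv.Perm ℕ) :
    Trans D (p.1.rename π, p.2) (b.rename π) (γ.rename π) (mapTerm (Term.rename π) Δ) := by
  induction h with
  | tau t E =>
    refine Trans.of_eq ?_ (mapTerm_point _ _ _).symm
    exact .tau _ E
  | cin c t x hx E =>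
    refine Trans.of_eq ?_ ((mapTerm_point _ _ _).trans (congrArg (fun t => point (t, E))
      (Term.csubst_cinst t _ _))).symm
    refine .cin c _ (π x) (fun h => hx ?_) E
    obtain ⟨y, hy, hyx⟩ := (Term.cin c t).fv_rename_subset π h
    rwa [π.injective hyx] at hy
  | cout c e t E =>
    refine Trans.of_eq ?_ (mapTerm_point _ _ _).symm
    exact .cout c _ _ E
  | qin c t r hr E =>
    refine Trans.of_eq ?_ ((mapTerm_point _ _ _).trans (congrArg (fun t => point (t, E))
      (Term.csubst_qren t _ _))).symm
    refine .qin c _ r ?_ E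
    change some r ∉ (t.csubst _).qv
    rw [Term.qv_csubst]
    exact hr
  | qout c r t E =>
    refine Trans.of_eq ?_ (mapTerm_point _ _ _).symm
    exact .qout c r _ E
  | oper n F r t E =>
    refine Trans.of_eq ?_ (mapTerm_point _ _ _).symm
    exact .oper n F r _ E
  | meas n M r t E l φ hM =>
    have key : mapTerm (Term.rename π) (∑ i, Finsupp.single
        (t.cinst (.const (l i)), CPt.liftAt r (setTo φ i) * E) (CP.liftAt r (projAt φ i))) =
        ∑ i, Finsupp.single ((t.csubst (Term.lift fun x => .var (π x))).cinst (.const (l i)),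
          CPt.liftAt r (setTo φ i) * E) (CP.liftAt r (projAt φ i)) := by
      rw [mapTerm, Finsupp.mapDomain_finsetSum]
      simp only [Finsupp.mapDomain_single, Term.rename, Term.csubst_cinst, CExp.subst]
    exact (Trans.meas n M r _ E l φ hM).of_eq key.symm
  | sumL t u E b γ Δ h ih => exact .sumL _ _ E _ _ _ ih
  | sumR t u E b γ Δ h ih => exact .sumR _ _ E _ _ _ ih
  | parL t u E b γ Δ h hq hc ih =>
    have h1 := Trans.parL _ (u.rename π) E _ _ _ ih
      (by rwa [Act.qbv_rename, Term.rename, Term.qv_csubst]) (Act.disjoint_bv_rename hc π)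
    refine Trans.of_eq ?_ (mapTerm_mapTerm _ _ _).symm
    exact h1.of_eq (mapTerm_mapTerm _ _ _)
  | parR t u E b γ Δ h hq hc ih =>
    have h1 := Trans.parR (t.rename π) _ E _ _ _ ih
      (by rwa [Act.qbv_rename, Term.rename, Term.qv_csubst]) (Act.disjoint_bv_rename hc π)
    refine Trans.of_eq ?_ (mapTerm_mapTerm _ _ _).symm
    exact h1.of_eq (mapTerm_mapTerm _ _ _)
  | cComL t u t' u' E b₁ b₂ c x e h₁ h₂ ih₁ ih₂ =>
    have h1 := Trans.cComL _ _ _ _ E _ _ c _ _ (ih₁.of_eq (mapTerm_point _ _ _))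
      (ih₂.of_eq (mapTerm_point _ _ _))
    rw [← Term.rename_update] at h1
    refine Trans.of_eq ?_ (mapTerm_point _ _ _).symm
    exact h1
  | cComR t u t' u' E b₁ b₂ c x e h₁ h₂ ih₁ ih₂ =>
    have h1 := Trans.cComR _ _ _ _ E _ _ c _ _ (ih₁.of_eq (mapTerm_point _ _ _))
      (ih₂.of_eq (mapTerm_point _ _ _))
    rw [← Term.rename_update] at h1
    refine Trans.of_eq ?_ (mapTerm_point _ _ _).symm
    exact h1
  | qComL t u t' u' E b₁ b₂ c r h₁ h₂ ih₁ ih₂ =>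
    refine Trans.of_eq ?_ (mapTerm_point _ _ _).symm
    exact .qComL _ _ _ _ E _ _ c r (ih₁.of_eq (mapTerm_point _ _ _))
      (ih₂.of_eq (mapTerm_point _ _ _))
  | qComR t u t' u' E b₁ b₂ c r h₁ h₂ ih₁ ih₂ =>
    refine Trans.of_eq ?_ (mapTerm_point _ _ _).symm
    exact .qComR _ _ _ _ E _ _ c r (ih₁.of_eq (mapTerm_point _ _ _))
      (ih₂.of_eq (mapTerm_point _ _ _))
  | res t L E b γ Δ h hL ih =>
    have h1 := Trans.res _ L E _ _ _ ih (by rwa [Act.cn_rename])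
    refine Trans.of_eq ?_ (mapTerm_mapTerm _ _ _).symm
    exact h1.of_eq (mapTerm_mapTerm _ _ _)
  | rel t fc fq E b γ Δ h ih =>
    have h1 := Trans.rel _ fc fq E _ _ _ ih
    rw [Act.relabel_rename]
    refine Trans.of_eq ?_ (mapTerm_mapTerm _ _ _).symm
    exact h1.of_eq (mapTerm_mapTerm _ _ _)
  | guard b t E b' γ Δ h ih => exact .guard _ _ E _ _ _ ih
  | con A e q E b γ Δ h ih =>
    refine .con A _ q E _ _ _ ?_
    simp only [Term.rename, Term.csubst_qren, Term.csubst_csubst] at ih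
    exact ih

end Renaming

/-! ### Transitions of well-formed snapshots. -/

section SnapshotTransitions
variable {σ : Sig} {D : Env σ}

/-- Renaming of the free classical variables by a permutation. -/
def Snap.rename (π : Equiv.Perm ℕ) (s : Snap σ) : Snap σ :=
  mk (s.term.rename π) (Term.wf_csubst s.2 _) s.op

theorem Snap.qv_rename (π : Equiv.Perm ℕ) (s : Snap σ) : (s.rename π).qv = s.qv :=
  Term.qv_csubst _ _

theorem Snap.rename_rename (π τ : Equiv.Perm ℕ) (s : Snap σ) :
    (s.rename π).rename τ = s.rename (π.trans τ) :=
  Subtype.ext (Prod.ext (Term.rename_rename π τ s.term) rfl)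

theorem Snap.rename_eq_self {π : Equiv.Perm ℕ} {s : Snap σ} (h : ∀ x ∈ s.fv, π x = x) :
    s.rename π = s :=
  Subtype.ext (Prod.ext (Term.rename_eq_self h) rfl)

theorem Snap.rename_refl (s : Snap σ) : s.rename (Equiv.refl ℕ) = s := rename_eq_self fun _ _ => rfl

theorem Snap.act_one (s : Snap σ) : s.act 1 = s :=
  Subtype.ext (Prod.ext rfl (one_mul _))

theorem Snap.act_act (G H : CPt ℕ) (s : Snap σ) : (s.act G).act H = s.act (H * G) :=
  Subtype.ext (Prod.ext rfl (mul_assoc _ _ _).symm)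

/-- A distribution on snapshots as a distribution on pairs. -/
noncomputable def toPre (Δ : SDist (Snap σ)) : SDist (PreSnap σ) :=
  Δ.mapDomain fun s : Snap σ => s.1

theorem toPre_apply (Δ : SDist (Snap σ)) (x : Snap σ) : toPre Δ x.1 = Δ x :=
  Finsupp.mapDomain_apply Subtype.val_injective Δ x

theorem toPre_injective {Δ Ξ : SDist (Snap σ)} (h : toPre Δ = toPre Ξ) : Δ = Ξ :=
  Finsupp.mapDomain_injective Subtype.val_injective h

theorem toPre_mapDomain {f : Snap σ → Snap σ} {g : PreSnap σ → PreSnap σ}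
    (h : ∀ s, (f s).1 = g s.1) (Δ : SDist (Snap σ)) :
    toPre (Δ.mapDomain f) = (toPre Δ).mapDomain g := by
  unfold toPre
  rw [← Finsupp.mapDomain_comp, ← Finsupp.mapDomain_comp]
  exact Finsupp.mapDomain_congr fun s _ => h s

theorem exists_toPre {Δ : SDist (PreSnap σ)} (h : ∀ y ∈ Δ.support, y.1.WF) :
    ∃ Δ' : SDist (Snap σ), toPre Δ' = Δ :=
  ⟨_, Finsupp.mapDomain_comapDomain (fun s : Snap σ => s.1) Subtype.val_injective Δ fun y hy =>
      ⟨⟨y, h y hy⟩, rfl⟩⟩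

theorem sTrans_iff {s : Snap σ} {b γ Δ} : STrans D s b γ Δ ↔ Trans D s.1 b γ (toPre Δ) := Iff.rfl

theorem STrans.rename {s : Snap σ} {b γ Δ} (h : STrans D s b γ Δ) (π : Equiv.Perm ℕ) :
    STrans D (s.rename π) (b.rename π) (γ.rename π) (Δ.mapDomain (Snap.rename π)) := by
  rw [sTrans_iff, toPre_mapDomain (g := fun y => (y.1.rename π, y.2)) fun _ => rfl]
  exact (sTrans_iff.1 h).rename π

theorem precompose_mul {W : Set ℕ} {δ : SDist (PreSnap σ)} (hδ : CommutesOff W δ) {G : CPt ℕ}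
    (hG : LocalTo Wᶜ G) (E : CPt ℕ) :
    precompose (G * E) δ = (precompose E δ).mapDomain fun y => (y.1, G * y.2) := by
  refine Eq.trans ?_ (Finsupp.mapDomain_comp (f := fun y : PreSnap σ => (y.1, y.2 * E))
    (g := fun y : PreSnap σ => (y.1, G * y.2)))
  refine Finsupp.mapDomain_congr fun y hy => Prod.ext rfl ?_
  change y.2 * (G * E) = G * (y.2 * E)
  exact (hδ G hG y hy).2.left_comm E

theorem toPre_mapDomain_act (G : CPt ℕ) (Δ : SDist (Snap σ)) :
    toPre (Δ.mapDomain (Snap.act G)) = (toPre Δ).mapDomain fun y => (y.1, G * y.2) :=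
  toPre_mapDomain (fun _ => rfl) Δ

/-- The kernel commutes with `G`, so applying `G` before the transition or to its targets comes to
the same. -/
theorem STrans.act {s : Snap σ} {b γ Δ} (h : STrans D s b γ Δ) {G : CPt ℕ}
    (hG : LocalTo s.qvᶜ G) : STrans D (s.act G) b γ (Δ.mapDomain (Snap.act G)) := by
  obtain ⟨δ, h1, h2, h3⟩ := (sTrans_iff.1 h).exists_kernel
  rw [sTrans_iff, toPre_mapDomain_act, h1]
  have h4 := h2 (G * s.op)
  rw [precompose_mul h3 hG] at h4
  exact h4

theorem STrans.commute {s : Snap σ} {b γ Δ} (h : STrans D s b γ Δ) {G : CPt ℕ}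
    (hG : LocalTo s.qvᶜ G) (x : Snap σ) : Commute (Δ x) G.1 := by
  classical
  obtain ⟨δ, h1, -, h3⟩ := (sTrans_iff.1 h).exists_kernel
  rw [← toPre_apply, h1, precompose, Finsupp.mapDomain, Finsupp.sum_apply]
  refine Commute.sum_left _ _ _ fun z hz => ?_
  dsimp only
  rw [Finsupp.single_apply]
  split
  · exact (h3 G hG z hz).1
  · exact Commute.zero_left _

/-- Converse of `STrans.act`: applying `G` creates no new behaviour. -/
theorem STrans.of_act {s : Snap σ} {b γ Δ} {G : CPt ℕ} (h : STrans D (s.act G) b γ Δ)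
    (hG : LocalTo s.qvᶜ G) : ∃ Δ', STrans D s b γ Δ' ∧ Δ = Δ'.mapDomain (Snap.act G) := by
  obtain ⟨δ, h1, h2, h3⟩ := (sTrans_iff.1 h).exists_kernel
  -- The kernel does not depend on the starting super-operator, so it also runs from `s` without
  -- `G`.
  have h4 : Trans D s.1 b γ (precompose s.op δ) := h2 s.op
  obtain ⟨Δ', h5⟩ := exists_toPre fun y hy => (h4.wf s.2 y hy).1
  refine ⟨Δ', sTrans_iff.2 (h5.symm ▸ h4), toPre_injective ?_⟩
  rw [toPre_mapDomain_act, h5, h1]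
  exact precompose_mul h3 hG s.op

theorem STrans.step {s : Snap σ} {b γ Δ} (h : STrans D s b γ Δ) (hb : b.Sat) {x : Snap σ}
    (hx : x ∈ Δ.support) : Step D s.term x.term :=
  ⟨s.op, x.op, b, γ, _, h, hb, fun h0 =>
    Finsupp.mem_support_iff.1 hx ((toPre_apply Δ x).symm.trans h0)⟩

theorem FreeOfQInput.step {t u : Term σ ℕ ℕ} (ht : FreeOfQInput D t) (h : Step D t u) :
    FreeOfQInput D u := fun v hv => ht v (.head h hv)

theorem FreeOfQInput.qbv_eq_empty {s : Snap σ} (hs : FreeOfQInput D s.term) {b γ Δ}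
    (h : STrans D s b γ Δ) (hb : b.Sat) : γ.qbv = ∅ := by
  cases γ with
  | qin c r => exact absurd ⟨s.op, b, c, r, _, h, hb⟩ (hs _ .refl)
  | _ => rfl

theorem STrans.qv_subset {s : Snap σ} {b γ Δ} (h : STrans D s b γ Δ) {x : Snap σ}
    (hx : x ∈ Δ.support) : x.qv ⊆ s.qv ∪ γ.qbv := by
  refine Trans.qv_subset h x.1 ?_
  exact Finsupp.mem_support_iff.2 fun h0 =>
    Finsupp.mem_support_iff.1 hx ((toPre_apply Δ x).symm.trans h0)

end SnapshotTransitions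

/-! ### Lifting relations to distributions through traces of weights. -/

section Lifting

open Classical in
/-- The trace of the total weight of `T` under `Δ`, applied to `ρ`. -/
noncomputable def weight {S : Type 1} (ρ : TC (Hilb ℕ)) (Δ : SDist S) (T : Set S) : ℂ :=
  Δ.sum fun x A => if x ∈ T then TC.trace (A.1 ρ) else 0

theorem TC.trace_zero : TC.trace (0 : TC (Hilb ℕ)) = 0 := by
  simpa using TC.trace_sub (0 : TC (Hilb ℕ)) 0

theorem TC.trace_add (A B : TC (Hilb ℕ)) : TC.trace (A + B) = TC.trace A + TC.trace B := by
  have h := TC.trace_sub (A + B) B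
  rw [add_sub_cancel_right] at h
  rw [h, sub_add_cancel]

variable {S : Type 1}

theorem trace_mass (ρ : TC (Hilb ℕ)) (Δ : SDist S) (T : Set S) :
    TC.trace ((mass Δ T).1 ρ) = weight ρ Δ T := by
  classical
  have h : (mass Δ T).1 ρ = ∑ x ∈ Δ.support with x ∈ T, (Δ x).1 ρ := by
    rw [mass, AddSubmonoidClass.coe_finsetSum, LinearMap.sum_apply]
  rw [h, TC.trace_sum, Finset.sum_filter, weight, Finsupp.sum]

/-- In this form the lifting is an equality of complex numbers, additive in the weights and easy to
push forward. -/
theorem liftRel_iff (R : S → S → Prop) (Δ Ξ : SDist S) : liftRel R Δ Ξ ↔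
    ∀ s ρ, IsDensity ρ → weight ρ Δ {x | R s x} = weight ρ Ξ {x | R s x} := by
  unfold liftRel
  simp only [eqsim_empty_iff, trace_mass]

theorem weight_preMul (ρ : TC (Hilb ℕ)) (E : CPt ℕ) (Δ : SDist S) (T : Set S) :
    weight ρ (preMul E Δ) T = weight (E.1.1 ρ) Δ T := by
  classical
  unfold weight preMul
  rw [Finsupp.sum_mapRange_index]
  · rfl
  · intro x
    split
    · exact TC.trace_zero
    · rfl

theorem weight_mapDomain {S' : Type 1} (ρ : TC (Hilb ℕ)) (f : S → S') (Δ : SDist S) (T : Set S') :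
    weight ρ (Δ.mapDomain f) T = weight ρ Δ (f ⁻¹' T) := by
  classical
  unfold weight
  rw [Finsupp.sum_mapDomain_index]
  · rfl
  · intro x
    split
    · exact TC.trace_zero
    · rfl
  · intro x A B
    split
    · exact TC.trace_add _ _
    · exact (add_zero _).symm

/-- `G` moves past each weight and then disappears under the trace. -/
theorem weight_commute {G : CPt ℕ} {Δ : SDist S} (h : ∀ x, Commute (Δ x) G.1) (ρ : TC (Hilb ℕ))
    (T : Set S) : weight (G.1.1 ρ) Δ T = weight ρ Δ T := by
  classical
  unfold weight
  refine Finset.sum_congr rfl fun x _ => ?_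
  have h1 : (Δ x).1 (G.1.1 ρ) = G.1.1 ((Δ x).1 ρ) :=
    DFunLike.congr_fun (congrArg Subtype.val (h x).eq) ρ
  have h2 : TC.trace (G.1.1 ((Δ x).1 ρ)) = TC.trace ((Δ x).1 ρ) := G.2 _
  dsimp only
  rw [h1, h2]

theorem weight_eq_sum [DecidableEq S] (ρ : TC (Hilb ℕ)) {Δ : SDist S} {U : Finset S}
    (hU : Δ.support ⊆ U) (T : Set S) [DecidablePred (· ∈ T)] :
    weight ρ Δ T = ∑ x ∈ U, if x ∈ T then TC.trace ((Δ x).1 ρ) else 0 := by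
  unfold weight
  rw [Finsupp.sum_of_support_subset Δ hU]
  · exact Finset.sum_congr rfl fun x _ => by congr
  · intro x _
    split
    · exact TC.trace_zero
    · rfl

/-- Within the two supports, `T` is a finite disjoint union of classes of `R`, on each of which the
weights agree. Saturation is asked only between good states because the relations used later
transfer only between those. -/
theorem weight_eq_of_saturated {R : S → S → Prop} (hR : Equivalence R) {Δ Ξ : SDist S}
    (h : liftRel R Δ Ξ) {good : S → Prop} (hΔ : ∀ x ∈ Δ.support, good x)
    (hΞ : ∀ x ∈ Ξ.support, good x) {T : Set S}
    (hT : ∀ x y, good x → good y → R x y → x ∈ T → y ∈ T) {ρ : TC (Hilb ℕ)} (hρ : IsDensity ρ) :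
    weight ρ Δ T = weight ρ Ξ T := by
  classical
  let U := Δ.support ∪ Ξ.support
  have hgood : ∀ x ∈ U, good x := fun x hx => (Finset.mem_union.1 hx).elim (hΔ x) (hΞ x)
  -- Group the sum by the classes meeting `U`: each lies, inside `U`, wholly in `T` or wholly
  -- outside it.
  have key : ∀ Θ : SDist S, Θ.support ⊆ U → weight ρ Θ T =
      ∑ c ∈ U.image fun x => {y | R x y}, if ∃ x ∈ U, x ∈ T ∧ c = {y | R x y} then
        weight ρ Θ c else 0 := by
    intro Θ hΘ
    rw [weight_eq_sum ρ hΘ, ← Finset.sum_fiberwise_of_maps_to (g := fun x => {y | R x y})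
      fun x hx => Finset.mem_image_of_mem (fun x => {y | R x y}) hx]
    refine Finset.sum_congr rfl fun c hc => ?_
    obtain ⟨x₀, hx₀, rfl⟩ := Finset.mem_image.1 hc
    have hcls : ∀ x, ({y | R x y} = {y | R x₀ y}) ↔ R x₀ x := by
      intro x
      constructor
      · intro he
        have : x ∈ {y | R x y} := hR.refl x
        rwa [he] at this
      · exact fun hx => Set.ext fun y => ⟨hR.trans hx, hR.trans (hR.symm hx)⟩
    rw [Finset.sum_filter]
    by_cases hx : x₀ ∈ T
    · rw [if_pos ⟨x₀, hx₀, hx, rfl⟩, weight_eq_sum ρ hΘ]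
      refine Finset.sum_congr rfl fun x hxU => ?_
      simp only [hcls, Set.mem_ofPred_eq]
      by_cases hxx : R x₀ x
      · simp [hxx, hT x₀ x (hgood _ hx₀) (hgood _ hxU) hxx hx]
      · simp [hxx]
    · rw [if_neg]
      · refine Finset.sum_eq_zero fun x hxU => ?_
        simp only [hcls]
        split
        · rename_i hxx
          rw [if_neg fun hxT => hx (hT x x₀ (hgood _ hxU) (hgood _ hx₀) (hR.symm hxx) hxT)]
        · rfl
      · rintro ⟨x, hxU, hxT, he⟩
        exact hx (hT x x₀ (hgood _ hxU) (hgood _ hx₀) (hR.symm ((hcls x).1 he.symm)) hxT)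
  rw [key Δ Finset.subset_union_left, key Ξ Finset.subset_union_right]
  refine Finset.sum_congr rfl fun c hc => ?_
  obtain ⟨x₀, hx₀, rfl⟩ := Finset.mem_image.1 hc
  rw [(liftRel_iff R Δ Ξ).1 h x₀ ρ hρ]

theorem support_preMul_subset (E : CPt ℕ) (Δ : SDist S) : (preMul E Δ).support ⊆ Δ.support :=
  Finsupp.support_mapRange

/-- The preimage under `f` of a class of `R'` is saturated for `R` among good states, and `G` drops
out of the weights. -/
theorem liftRel_mapDomain {R R' : S → S → Prop} (hR : Equivalence R) (hR' : Equivalence R')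
    {Δ Ξ : SDist S} {E F G : CPt ℕ} (h : liftRel R (preMul E Δ) (preMul F Ξ))
    (hGΔ : ∀ x, Commute (Δ x) G.1) (hGΞ : ∀ x, Commute (Ξ x) G.1) {good : S → Prop}
    (hΔ : ∀ x ∈ Δ.support, good x) (hΞ : ∀ x ∈ Ξ.support, good x) (f : S → S)
    (hf : ∀ x y, good x → good y → R x y → R' (f x) (f y)) :
    liftRel R' (preMul (G * E) (Δ.mapDomain f)) (preMul (G * F) (Ξ.mapDomain f)) := by
  rw [liftRel_iff]
  intro s ρ hρ
  have key : ∀ (E : CPt ℕ) (Θ : SDist S), (∀ x, Commute (Θ x) G.1) → ∀ T,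
      weight ρ (preMul (G * E) (Θ.mapDomain f)) T = weight ρ (preMul E Θ) (f ⁻¹' T) := by
    intro E Θ hΘ T
    rw [weight_preMul, weight_mapDomain, weight_preMul]
    exact weight_commute hΘ _ _
  rw [key E Δ hGΔ, key F Ξ hGΞ]
  exact weight_eq_of_saturated hR h (fun x hx => hΔ x (support_preMul_subset _ _ hx))
    (fun x hx => hΞ x (support_preMul_subset _ _ hx))
    (fun x y hx hy hxy hxT => hR'.trans hxT (hf x y hx hy hxy)) hρ

theorem liftRel_mono {R R' : S → S → Prop} (hR : Equivalence R) (hR' : Equivalence R')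
    (hRR : ∀ x y, R x y → R' x y) {Δ Ξ : SDist S} (h : liftRel R Δ Ξ) : liftRel R' Δ Ξ := by
  rw [liftRel_iff]
  intro s ρ hρ
  exact weight_eq_of_saturated (good := fun _ => True) hR h (fun _ _ => trivial)
    (fun _ _ => trivial) (fun x y _ _ hxy hx => hR'.trans hx (hRR x y hxy)) hρ

theorem liftRel_trans {R : S → S → Prop} {Δ Ξ Θ : SDist S} (h : liftRel R Δ Ξ)
    (h' : liftRel R Ξ Θ) : liftRel R Δ Θ := by
  rw [liftRel_iff] at *
  exact fun s ρ hρ => (h s ρ hρ).trans (h' s ρ hρ)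

theorem liftRel_refl (R : S → S → Prop) (Δ : SDist S) : liftRel R Δ Δ :=
  (liftRel_iff R Δ Δ).2 fun _ _ _ => rfl

end Lifting

section Eqsim
variable {Q : Type} {V : Set Q} {Φ Ψ Θ : CP (Hilb Q)}

theorem Eqsim.refl (V : Set Q) (Φ : CP (Hilb Q)) : Eqsim V Φ Φ :=
  ⟨fun _ _ => le_rfl, fun _ _ => le_rfl⟩

theorem Eqsim.trans (h : Eqsim V Φ Ψ) (h' : Eqsim V Ψ Θ) : Eqsim V Φ Θ :=
  ⟨fun ρ hρ => (h.1 ρ hρ).trans (h'.1 ρ hρ), fun ρ hρ => (h'.2 ρ hρ).trans (h.2 ρ hρ)⟩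

end Eqsim

/-! ### The bisimulation generated by ground bisimilarity and local super-operators. -/

section Bisimulations
variable {σ : Sig} {D : Env σ}

theorem Act.EqUnder.refl (b : BExp σ ℕ) (γ : Act σ) : γ.EqUnder b γ := by
  cases γ with
  | cout c e => exact ⟨rfl, fun ψ _ => rfl⟩
  | _ => rfl

theorem Act.EqUnder.bv_eq {b : BExp σ ℕ} {γ γ' : Act σ} (h : γ.EqUnder b γ') : γ.bv = γ'.bv := by
  cases γ <;> cases γ' <;> first
    | rfl
    | exact congrArg Act.bv h

theorem Act.EqUnder.trans {b b' b'' : BExp σ ℕ} {γ γ' γ'' : Act σ} (h : γ.EqUnder b γ')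
    (h' : γ'.EqUnder b' γ'') (hb : b''.Implies b) (hb' : b''.Implies b') : γ.EqUnder b'' γ'' := by
  cases γ <;> cases γ' <;> cases γ'' <;> first
    | exact ⟨h.1.trans h'.1, fun ψ hψ => (h.2 ψ (hb ψ hψ)).trans (h'.2 ψ (hb' ψ hψ))⟩
    | exact Eq.trans (α := Act σ) h h'
    | (cases h; done)
    | cases h'

/-- The transition from `s` to `Δ` with guard `b₁` and action `γ` is matched by `s'` under `b`. -/
def Matched (D : Env σ) (S : BExp σ ℕ → Snap σ → Snap σ → Prop) (b : BExp σ ℕ)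
    (s s' : Snap σ) (b₁ : BExp σ ℕ) (γ : Act σ) (Δ : SDist (Snap σ)) : Prop :=
  ∃ B : Set (BExp σ ℕ), B.Finite ∧ (∀ ψ, (b.and b₁).eval ψ → ∃ b' ∈ B, b'.eval ψ) ∧
    ∀ b' ∈ B, ∃ b₂ γ' Ξ, b'.Implies b₂ ∧ γ.EqUnder b' γ' ∧ STrans D s' b₂ γ' Ξ ∧
      liftRel (S b') (preMul s.op Δ) (preMul s'.op Ξ)

/-- The transfer property for all transitions that do not bind a variable in some finite set. -/
def FreshTransfer (D : Env σ) (S : BExp σ ℕ → Snap σ → Snap σ → Prop) (b : BExp σ ℕ)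
    (s s' : Snap σ) : Prop :=
  ∃ N : Set ℕ, N.Finite ∧ ∀ b₁ γ Δ, STrans D s b₁ γ Δ → Disjoint γ.bv N →
    Matched D S b s s' b₁ γ Δ

theorem FreshTransfer.refl (S : BExp σ ℕ → Snap σ → Snap σ → Prop) (b : BExp σ ℕ) (s : Snap σ) :
    FreshTransfer D S b s s := by
  refine ⟨∅, Set.finite_empty, fun b₁ γ Δ h _ => ⟨{b₁}, Set.finite_singleton _,
    fun ψ hψ => ⟨b₁, rfl, hψ.2⟩, ?_⟩⟩
  rintro _ rfl
  exact ⟨_, γ, Δ, fun _ h => h, Act.EqUnder.refl _ γ, h, liftRel_refl _ _⟩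

/-- Both excluded sets are avoided at once, since a matching action binds the same variable.
Monotonicity in the Boolean lets both liftings be compared at the conjunction. -/
theorem FreshTransfer.trans {S : BExp σ ℕ → Snap σ → Snap σ → Prop} (hS : ∀ b, Equivalence (S b))
    (hmono : ∀ b b', b'.Implies b → ∀ x y, S b x y → S b' x y) {b : BExp σ ℕ} {s s' s'' : Snap σ}
    (h : FreshTransfer D S b s s') (h' : FreshTransfer D S b s' s'') :
    FreshTransfer D S b s s'' := by
  obtain ⟨N, hN, h⟩ := h
  obtain ⟨N', hN', h'⟩ := h'
  refine ⟨N ∪ N', hN.union hN', fun b₁ γ Δ hst hγ => ?_⟩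
  rw [Set.disjoint_union_right] at hγ
  obtain ⟨B, hB, hcov, hm⟩ := h b₁ γ Δ hst hγ.1
  have : Nonempty (Act σ) := ⟨.tau⟩
  have : Nonempty (BExp σ ℕ) := ⟨.tt⟩
  choose! b₂ γ' Ξ hb₂ hγ' hst' hl using hm
  have h2 : ∀ b' ∈ B, Matched D S b s' s'' (b₂ b') (γ' b') (Ξ b') := fun b' hb' =>
    h' _ _ _ (hst' b' hb') ((hγ' b' hb').bv_eq ▸ hγ.2)
  choose! C hC hcov' hm' using h2
  -- Each case `b'` of the first matching is refined by the cases `b''` that match its answer.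
  refine ⟨⋃ b' ∈ B, (fun b'' => b'.and b'') '' C b', hB.biUnion fun b' hb' => (hC b' hb').image _,
    ?_, ?_⟩
  · intro ψ hψ
    obtain ⟨b', hb', hψ'⟩ := hcov ψ hψ
    obtain ⟨b'', hb'', hψ''⟩ := hcov' b' hb' ψ ⟨hψ.1, hb₂ b' hb' ψ hψ'⟩
    exact ⟨_, Set.mem_biUnion hb' ⟨b'', hb'', rfl⟩, hψ', hψ''⟩
  · intro c hc
    obtain ⟨b', hb', b'', hb'', rfl⟩ := Set.mem_iUnion₂.1 hc
    obtain ⟨b₃, γ'', Θ, h3, h4, h5, h6⟩ := hm' b' hb' b'' hb''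
    have hi : (b'.and b'').Implies b' := fun ψ h => h.1
    have hi' : (b'.and b'').Implies b'' := fun ψ h => h.2
    exact ⟨b₃, γ'', Θ, fun ψ h => h3 ψ h.2, (hγ' b' hb').trans h4 hi hi', h5,
      liftRel_trans (liftRel_mono (hS _) (hS _) (hmono _ _ hi) (hl b' hb'))
        (liftRel_mono (hS _) (hS _) (hmono _ _ hi') h6)⟩

theorem Act.exists_perm_fresh (γ : Act σ) {A N : Set ℕ} (hA : A.Finite) (hN : N.Finite)
    (h : Disjoint γ.bv A) :
    ∃ π : Equiv.Perm ℕ, (∀ a ∈ A, π a = a) ∧ Disjoint (γ.rename π).bv N := by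
  cases γ with
  | cin c x =>
    obtain ⟨y, hy⟩ := (hA.union hN).exists_notMem
    rw [Set.mem_union, not_or] at hy
    refine ⟨Equiv.swap x y, fun a ha => Equiv.swap_apply_of_ne_of_ne ?_ ?_, ?_⟩
    · rintro rfl
      exact Set.disjoint_left.1 h rfl ha
    · rintro rfl
      exact hy.1 ha
    · simpa [rename, bv] using hy.2
  | _ => exact ⟨Equiv.refl ℕ, fun _ _ => rfl, Set.empty_disjoint _⟩

/-- Rename the bound variable to one outside `N` by a permutation fixing the free variables of `b`,
`s` and `s'`, match there, and rename the match back. -/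
theorem FreshTransfer.transfer {S : BExp σ ℕ → Snap σ → Snap σ → Prop}
    (hS : ∀ b, Equivalence (S b))
    (hren : ∀ b x y (π : Equiv.Perm ℕ), S b x y → S (b.rename π) (x.rename π) (y.rename π))
    {b : BExp σ ℕ} {s s' : Snap σ} (h : FreshTransfer D S b s s') : Transfer D S b s s' := by
  obtain ⟨N, hN, h⟩ := h
  intro b₁ γ Δ hst hγ
  obtain ⟨π, hπ, hπN⟩ := γ.exists_perm_fresh
    ((b.finite_fv.union s.term.finite_fv).union s'.term.finite_fv) hN hγ
  have hb : b.rename π = b := BExp.rename_eq_self fun x hx => hπ x (Or.inl (Or.inl hx))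
  have hs : s.rename π = s := Snap.rename_eq_self fun x hx => hπ x (Or.inl (Or.inr hx))
  have hs' : s'.rename π.symm = s' := Snap.rename_eq_self fun x hx =>
    π.symm_apply_eq.2 (hπ x (Or.inr hx)).symm
  have hst' := hst.rename π
  rw [hs] at hst'
  obtain ⟨B, hB, hcov, hm⟩ := h _ _ _ hst' hπN
  refine ⟨BExp.rename π.symm '' B, hB.image _, ?_, ?_⟩
  · intro ψ hψ
    have hψ' : (ψ ∘ π.symm) ∘ π = ψ := funext fun x => by simp
    obtain ⟨b', hb', he⟩ := hcov (ψ ∘ π.symm)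
      ⟨by rw [← hb, BExp.eval_rename, hψ']; exact hψ.1,
        by rw [BExp.eval_rename, hψ']; exact hψ.2⟩
    exact ⟨_, ⟨b', hb', rfl⟩, (BExp.eval_rename _ _ _).2 he⟩
  · rintro _ ⟨b', hb', rfl⟩
    obtain ⟨b₂, γ', Ξ, h1, h2, h3, h4⟩ := hm b' hb'
    refine ⟨b₂.rename π.symm, γ'.rename π.symm, Ξ.mapDomain (Snap.rename π.symm),
      h1.rename _, ?_, hs' ▸ h3.rename π.symm, ?_⟩
    · have := h2.rename π.symm
      rwa [Act.rename_rename, Equiv.self_trans_symm, Act.rename_refl] at this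
    -- Renaming the targets back cancels the renaming of `Δ` on the left.
    · have := liftRel_mapDomain (G := 1) (good := fun _ => True) (hS _) (hS (b'.rename π.symm)) h4
        (fun _ => Commute.one_right _) (fun _ => Commute.one_right _) (fun _ _ => trivial)
        (fun _ _ => trivial) (Snap.rename π.symm) fun x y _ _ hxy => hren _ _ _ _ hxy
      rwa [one_mul, one_mul, ← Finsupp.mapDomain_comp, show Snap.rename π.symm ∘ Snap.rename π = id
        from funext fun x => by simp [Snap.rename_rename, Snap.rename_refl],
        Finsupp.mapDomain_id] at this

/-- Pairs obtained from ground bisimilar snapshots free of quantum input by strengthening the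
Boolean, renaming classical variables and applying super-operators on the qubits not in use. -/
def GroundStep (D : Env σ) (b : BExp σ ℕ) (s s' : Snap σ) : Prop :=
  ∃ (b₀ : BExp σ ℕ) (s₀ s₀' : Snap σ) (π : Equiv.Perm ℕ) (G : CPt ℕ),
    b.Implies (b₀.rename π) ∧ GroundBisim D b₀ s₀ s₀' ∧ FreeOfQInput D s₀.term ∧
    FreeOfQInput D s₀'.term ∧ LocalTo s₀.qvᶜ G ∧
    s = (s₀.rename π).act G ∧ s' = (s₀'.rename π).act G

/-- The transitive closure of `GroundStep`. -/
def GroundChain (D : Env σ) (b : BExp σ ℕ) : Snap σ → Snap σ → Prop :=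
  Relation.ReflTransGen (GroundStep D b)

theorem GroundBisim.invariant {b : BExp σ ℕ} {s s' : Snap σ} (h : GroundBisim D b s s') :
    s.qv = s'.qv ∧ Eqsim s.qvᶜ s.op.1 s'.op.1 := by
  obtain ⟨S, hS, h⟩ := h
  exact (hS.2 b s s' h).1

theorem GroundBisim.symm {b : BExp σ ℕ} {s s' : Snap σ} (h : GroundBisim D b s s') :
    GroundBisim D b s' s := by
  obtain ⟨S, hS, h⟩ := h
  exact ⟨S, hS, (hS.1 b).symm h⟩

theorem GroundStep.symm {b : BExp σ ℕ} {s s' : Snap σ} (h : GroundStep D b s s') :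
    GroundStep D b s' s := by
  obtain ⟨b₀, s₀, s₀', π, G, h1, h2, h3, h4, h5, h6, h7⟩ := h
  exact ⟨b₀, s₀', s₀, π, G, h1, h2.symm, h4, h3, h2.invariant.1 ▸ h5, h7, h6⟩

theorem GroundStep.mono {b b' : BExp σ ℕ} (hb : b'.Implies b) {s s' : Snap σ}
    (h : GroundStep D b s s') : GroundStep D b' s s' := by
  obtain ⟨b₀, s₀, s₀', π, G, h1, h⟩ := h
  exact ⟨b₀, s₀, s₀', π, G, fun ψ hψ => h1 ψ (hb ψ hψ), h⟩

theorem GroundStep.rename {b : BExp σ ℕ} {s s' : Snap σ} (h : GroundStep D b s s')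
    (τ : Equiv.Perm ℕ) : GroundStep D (b.rename τ) (s.rename τ) (s'.rename τ) := by
  obtain ⟨b₀, s₀, s₀', π, G, h1, h2, h3, h4, h5, rfl, rfl⟩ := h
  refine ⟨b₀, s₀, s₀', π.trans τ, G, ?_, h2, h3, h4, h5, ?_, ?_⟩
  · rw [← BExp.rename_rename]
    exact h1.rename τ
  · exact congrArg (Snap.act G) (Snap.rename_rename π τ s₀)
  · exact congrArg (Snap.act G) (Snap.rename_rename π τ s₀')

theorem GroundStep.act {b : BExp σ ℕ} {s s' : Snap σ} (h : GroundStep D b s s') {G : CPt ℕ}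
    (hG : LocalTo s.qvᶜ G) : GroundStep D b (s.act G) (s'.act G) := by
  obtain ⟨b₀, s₀, s₀', π, G', h1, h2, h3, h4, h5, rfl, rfl⟩ := h
  have hG' : LocalTo s₀.qvᶜ G := by
    rw [← Snap.qv_rename π s₀]
    exact hG
  exact ⟨b₀, s₀, s₀', π, G * G', h1, h2, h3, h4, hG'.mul h5, Snap.act_act _ _ _,
    Snap.act_act _ _ _⟩

theorem GroundStep.invariant {b : BExp σ ℕ} {s s' : Snap σ} (h : GroundStep D b s s') :
    s.qv = s'.qv ∧ Eqsim s.qvᶜ s.op.1 s'.op.1 := by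
  obtain ⟨b₀, s₀, s₀', π, G, h1, h2, h3, h4, h5, rfl, rfl⟩ := h
  have h6 : ((s₀.rename π).act G).qv = s₀.qv := Snap.qv_rename π s₀
  have h7 : ((s₀'.rename π).act G).qv = s₀'.qv := Snap.qv_rename π s₀'
  rw [h6, h7]
  exact ⟨h2.invariant.1, h2.invariant.2.local_mul h5⟩

theorem groundChain_equivalence (D : Env σ) (b : BExp σ ℕ) : Equivalence (GroundChain D b) :=
  have : Std.Symm (GroundStep D b) := ⟨fun _ _ h => h.symm⟩
  ⟨fun _ => .refl, fun h => Relation.ReflTransGen.stdSymm.symm _ _ h, fun h h' => h.trans h'⟩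

theorem GroundChain.mono {b b' : BExp σ ℕ} (hb : b'.Implies b) {s s' : Snap σ}
    (h : GroundChain D b s s') : GroundChain D b' s s' :=
  Relation.ReflTransGen.mono (fun _ _ h => GroundStep.mono hb h) _ _ h

theorem GroundChain.rename {b : BExp σ ℕ} {s s' : Snap σ} (h : GroundChain D b s s')
    (π : Equiv.Perm ℕ) : GroundChain D (b.rename π) (s.rename π) (s'.rename π) :=
  Relation.ReflTransGen.lift (Snap.rename π) (fun _ _ h => GroundStep.rename h π) _ _ h

theorem GroundChain.invariant {b : BExp σ ℕ} {s s' : Snap σ} (h : GroundChain D b s s') :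
    s.qv = s'.qv ∧ Eqsim s.qvᶜ s.op.1 s'.op.1 := by
  induction h with
  | refl => exact ⟨rfl, Eqsim.refl _ _⟩
  | tail _ h ih =>
    have h' := h.invariant
    rw [← ih.1] at h'
    exact ⟨h'.1, ih.2.trans h'.2⟩

theorem GroundChain.act {b : BExp σ ℕ} {s s' : Snap σ} (h : GroundChain D b s s') {G : CPt ℕ}
    (hG : LocalTo s.qvᶜ G) : GroundChain D b (s.act G) (s'.act G) := by
  induction h with
  | refl => exact .refl
  | tail hc h ih => exact ih.tail (h.act ((GroundChain.invariant hc).1 ▸ hG))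

theorem BExp.Sat.rename {b : BExp σ ℕ} (h : b.Sat) (π : Equiv.Perm ℕ) : (b.rename π).Sat := by
  obtain ⟨ψ, hψ⟩ := h
  refine ⟨ψ ∘ π.symm, (eval_rename _ _ _).2 ?_⟩
  rwa [show (ψ ∘ π.symm) ∘ π = ψ from funext fun x => by simp]

/-- Remove `G` and then the renaming from the transition, match it in the underlying ground
bisimulation, and put both back on the answer. Matched targets then form a single step again. -/
theorem GroundStep.freshTransfer {b : BExp σ ℕ} {s s' : Snap σ} (h : GroundStep D b s s') :
    FreshTransfer D (GroundChain D) b s s' := by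
  obtain ⟨b₀, s₀, s₀', π, G, hb, ⟨S, hS, h0⟩, hf, hf', hG, rfl, rfl⟩ := h
  obtain ⟨⟨hqv, -⟩, htr⟩ := hS.2 b₀ s₀ s₀' h0
  -- This set makes the bound variable fresh for `b₀`, `s₀` and `s₀'` after undoing `π`.
  refine ⟨π '' (b₀.fv ∪ s₀.fv ∪ s₀'.fv), (((b₀.finite_fv.union s₀.term.finite_fv).union
    s₀'.term.finite_fv).image π), fun b₁ γ Δ hst hγ => ?_⟩
  by_cases hsat : (b.and b₁).Sat
  swap
  · exact ⟨∅, Set.finite_empty, fun ψ hψ => absurd ⟨ψ, hψ⟩ hsat, fun _ h => h.elim⟩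
  have hsat₁ : b₁.Sat := let ⟨ψ, hψ⟩ := hsat; ⟨ψ, hψ.2⟩
  obtain ⟨Δ₁, hst₁, rfl⟩ := hst.of_act ((Snap.qv_rename π s₀).symm ▸ hG)
  have hst₂ := hst₁.rename π.symm
  rw [Snap.rename_rename, Equiv.self_trans_symm, Snap.rename_refl] at hst₂
  have hΔ₁ : Δ₁ = (Δ₁.mapDomain (Snap.rename π.symm)).mapDomain (Snap.rename π) := by
    rw [← Finsupp.mapDomain_comp, show Snap.rename π ∘ Snap.rename π.symm = id
        from funext fun x => by simp [Snap.rename_rename, Snap.rename_refl], Finsupp.mapDomain_id]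
  generalize Δ₁.mapDomain (Snap.rename π.symm) = Δ at hst₂ hΔ₁
  subst hΔ₁
  obtain ⟨B, hB, hcov, hm⟩ := htr _ _ _ hst₂ (by
    rw [Act.bv_rename]
    have h1 := (Set.disjoint_image_iff π.symm.injective).2 hγ
    rwa [← Set.image_comp, Equiv.symm_comp_self, Set.image_id] at h1)
  -- Unsatisfiable cases cover nothing. Dropping them makes every matching guard satisfiable, so the
  -- targets are genuine descendants and inherit freedom from quantum input.
  refine ⟨BExp.rename π '' {b' ∈ B | b'.Sat}, (hB.subset (Set.sep_subset _ _)).image _, ?_, ?_⟩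
  · intro ψ hψ
    obtain ⟨b', hb', he⟩ := hcov (ψ ∘ π) ⟨(BExp.eval_rename _ _ _).1 (hb ψ hψ.1), by
      rw [BExp.eval_rename, Function.comp_assoc, Equiv.self_comp_symm]
      exact hψ.2⟩
    exact ⟨_, ⟨b', ⟨hb', _, he⟩, rfl⟩, (BExp.eval_rename _ _ _).2 he⟩
  · rintro _ ⟨b', ⟨hb', hbs⟩, rfl⟩
    obtain ⟨b₂, γ', Ξ, h1, h2, h3, h4⟩ := hm b' hb'
    have hsat₂ : b₂.Sat := let ⟨ψ, hψ⟩ := hbs; ⟨ψ, h1 ψ hψ⟩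
    have hG' : LocalTo s₀'.qvᶜ G := hqv ▸ hG
    refine ⟨b₂.rename π, γ'.rename π, (Ξ.mapDomain (Snap.rename π)).mapDomain (Snap.act G),
      h1.rename π, ?_, (h3.rename π).act ((Snap.qv_rename π s₀').symm ▸ hG'), ?_⟩
    · have := h2.rename π
      rwa [Act.rename_rename, Equiv.symm_trans_self, Act.rename_refl] at this
    · rw [← Finsupp.mapDomain_comp, ← Finsupp.mapDomain_comp]
      -- Good targets have no qubits beyond those of `s₀`, so `G` is still local to their unused
      -- qubits.
      refine liftRel_mapDomain (E := s₀.op) (F := s₀'.op)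
        (good := fun x => FreeOfQInput D x.term ∧ x.qv ⊆ s₀.qv)
        (hS.1 b') (groundChain_equivalence D _) h4 (hst₂.commute hG) (h3.commute hG') ?_ ?_ _ ?_
      · intro x hx
        refine ⟨hf.step (hst₂.step (hsat₁.rename _) hx), ?_⟩
        have := hst₂.qv_subset hx
        rwa [hf.qbv_eq_empty hst₂ (hsat₁.rename _), Set.union_empty] at this
      · intro x hx
        refine ⟨hf'.step (h3.step hsat₂ hx), ?_⟩
        have := h3.qv_subset hx
        rwa [hf'.qbv_eq_empty h3 hsat₂, Set.union_empty, ← hqv] at this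
      · intro x y hx hy hxy
        exact .single ⟨b', x, y, π, G, fun _ h => h, ⟨S, hS, hxy⟩, hx.1, hy.1,
          hG.mono (Set.compl_subset_compl.2 hx.2), rfl, rfl⟩

/-- Fresh transfer composes along the chain; freshness is removed only at the end, for the two end
points. -/
theorem isGroundBisim_groundChain (D : Env σ) : IsGroundBisim D (GroundChain D) := by
  refine ⟨groundChain_equivalence D, fun b s s' h => ⟨h.invariant, ?_⟩⟩
  refine FreshTransfer.transfer (groundChain_equivalence D) (fun b x y π h => h.rename π) ?_
  induction h with
  | refl => exact .refl _ _ _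
  | tail _ h ih =>
    exact ih.trans (groundChain_equivalence D) (fun _ _ hb _ _ h => h.mono hb) h.freshTransfer

/-- Chains are closed under local super-operators, so the ground transfer property at the
transformed pair is the one demanded. -/
theorem isSymBisim_groundChain (D : Env σ) : IsSymBisim D (GroundChain D) :=
  ⟨groundChain_equivalence D, fun b _ _ h => ⟨fun _ => h.invariant, fun _ hG =>
    ((isGroundBisim_groundChain D).2 b _ _ (h.act hG.localTo)).2⟩⟩

theorem GroundBisim.groundChain {b : BExp σ ℕ} {s s' : Snap σ} (h : GroundBisim D b s s')
    (hs : FreeOfQInput D s.term) (hs' : FreeOfQInput D s'.term) : GroundChain D b s s' :=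
  .single ⟨b, s, s', Equiv.refl ℕ, 1, fun ψ h => (BExp.eval_rename _ b ψ).2 h, h, hs,
    hs', .one _, by rw [Snap.rename_refl, Snap.act_one], by rw [Snap.rename_refl, Snap.act_one]⟩

theorem actsOn_one (V : Set ℕ) : ActsOn V (1 : CPt ℕ) := ⟨1, fun _ _ _ => rfl⟩

theorem SymBisim.groundBisim {b : BExp σ ℕ} (hb : b.Sat) {s s' : Snap σ}
    (h : SymBisim D b s s') : GroundBisim D b s s' := by
  obtain ⟨S, hS, h⟩ := h
  -- At an unsatisfiable Boolean a symbolic bisimulation says nothing about qubits or reduced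
  -- states, whereas a ground one must; equality is the safe choice there.
  refine ⟨fun b x y => (b.Sat ∧ S b x y) ∨ (¬ b.Sat ∧ x = y), ⟨fun b => ?_, ?_⟩, Or.inl ⟨hb, h⟩⟩
  · by_cases hb : b.Sat
    · simpa [hb] using hS.1 b
    · simpa [hb] using eq_equivalence
  rintro b x y (⟨hb, h⟩ | ⟨hb, rfl⟩)
  · obtain ⟨h1, h2⟩ := hS.2 b x y h
    refine ⟨h1 hb, fun b₁ γ Δ hst hγ => ?_⟩
    have h3 := h2 1 (actsOn_one _)
    rw [Snap.act_one, Snap.act_one] at h3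
    obtain ⟨B, hB, hcov, hm⟩ := h3 b₁ γ Δ hst hγ
    -- On the satisfiable cases the modified relation agrees with `S`, so the lifting carries over.
    refine ⟨{b' ∈ B | b'.Sat}, hB.subset (Set.sep_subset _ _), fun ψ hψ => ?_, ?_⟩
    · obtain ⟨b', hb', he⟩ := hcov ψ hψ
      exact ⟨b', ⟨hb', ψ, he⟩, he⟩
    · rintro b' ⟨hb', hsat⟩
      obtain ⟨b₂, γ', Ξ, h4, h5, h6, h7⟩ := hm b' hb'
      exact ⟨b₂, γ', Ξ, h4, h5, h6, by simpa [hsat] using h7⟩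
  · exact ⟨⟨rfl, Eqsim.refl _ _⟩, fun b₁ γ Δ _ _ => ⟨∅, Set.finite_empty,
      fun ψ hψ => absurd ⟨ψ, hψ.1⟩ hb, fun _ h => h.elim⟩⟩

end Bisimulations

end QCCS

theorem mainTheorem5 (σ : QCCS.Sig) (D : QCCS.Env σ) (t u : QCCS.Term σ ℕ ℕ)
    (ht : t.WF) (hu : u.WF) (E F : QCCS.CPt ℕ) (b : QCCS.BExp σ ℕ)
    (hft : QCCS.FreeOfQInput D t) (hfu : QCCS.FreeOfQInput D u) :
    (b.Sat →
      (QCCS.SymBisim D b (.mk t ht E) (.mk u hu F) ↔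
        QCCS.GroundBisim D b (.mk t ht E) (.mk u hu F))) ∧
    (QCCS.GroundBisim D b (.mk t ht E) (.mk u hu F) →
      ∀ G : QCCS.CPt ℕ, QCCS.ActsOn t.qvᶜ G →
        QCCS.GroundBisim D b (.mk t ht (G * E)) (.mk u hu (G * F))) :=
  ⟨fun hb => ⟨fun h => h.groundBisim hb, fun h =>
      ⟨_, QCCS.isSymBisim_groundChain D, h.groundChain hft hfu⟩⟩,
    fun h _ hG => ⟨_, QCCS.isGroundBisim_groundChain D,
      (h.groundChain hft hfu).act hG.localTo⟩⟩
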